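/- Let $\delta_E$ denote the edit distance (the minimum number of single-letter insertions, deletions and substitutions transforming one string into another). For a text $T$ of length $n\ge 1$, a pattern $P$ of length $m\le n$ and an integer $k>0$, let $\mathrm{Occ}_k(P,T)$ be the set of all positions $i$ such that $\delta_E(P',T[i\mathinner{.\,.}j))\le k$ for some rotation $P'$ of $P$ and some $j$ with $i\le j\le n$. All strings are over a polynomially bounded integer alphabet, i.e. their letters are integers in $[0,(n+1)^c)$ for a constant $c$. The model is the word RAM with unit-cost arithmetic and comparisons on $w$-bit words, where $2^w\ge (n+k+1)^a$ for a sufficiently large constant $a$ (depending only on $c$); constants hidden in $\mathcal O(\cdot)$ depend only on $c$. (1) The reporting version of $k$-Edit Circular Pattern Matching can be solved in $\mathcal O(nk^2)$ time: there is an algorithm that, given $T$, $P$ and $k$, lists every element of $\mathrm{Occ}_k(P,T)$ exactly once in $\mathcal O(nk^2)$ time. (2) For $j\in\{0,\dots,n\}$ let $A_j$ be the set of all positions $i\le j$ such that $\delta_E(T[i\mathinner{.\,.}j),P_2)+\delta_E(T[j\mathinner{.\,.}r),P_1)\le k$ for some $r$ with $j\le r\le n$ and some decomposition $P=P_1P_2$.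 Then $\mathrm{Occ}_k(P,T)=\bigcup_{j=0}^{n}A_j$. Moreover, there is a procedure that, after $\mathcal O(n)$-time preprocessing of $T$ and $P$ (independent of $k$, with words such that $2^w\ge (n+1)^a$), given any $k>0$ (with $2^w\ge (n+k+1)^a$) and any $j\in\{0,\dots,n\}$, computes in $\mathcal O(k^2)$ time a list of $\mathcal O(k^2)$ (possibly intersecting) intervals of integers whose union is $A_j$. -/

import Mathlib

/-! ### Strings, edit distance, circular occurrences -/

namespace CircularMatching

/-- `EditStep U V`: `V` arises from `U` by inserting, deleting or substituting one letter. -/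
inductive EditStep : List ℕ → List ℕ → Prop
  | insert (A B : List ℕ) (x : ℕ) : EditStep (A ++ B) (A ++ x :: B)
  | delete (A B : List ℕ) (x : ℕ) : EditStep (A ++ x :: B) (A ++ B)
  | subst (A B : List ℕ) (x y : ℕ) : EditStep (A ++ x :: B) (A ++ y :: B)

/-- `Edits d U V`: `U` can be transformed into `V` by exactly `d` insertions, deletions and
substitutions of single letters. -/
inductive Edits : ℕ → List ℕ → List ℕ → Prop
  | refl (U : List ℕ) : Edits 0 U U
  | step {d : ℕ} {U V W : List ℕ} : EditStep U V → Edits d V W → Edits (d + 1) U W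

/-- Some number of edits transforms `U` into `V`, so the minimum below is over a nonempty set. -/
theorem exists_edits (U V : List ℕ) : ∃ d, Edits d U V := by
  induction U with
  | cons x U ih =>
    obtain ⟨d, h⟩ := ih
    exact ⟨d + 1, .step (.delete [] U x) h⟩
  | nil =>
    suffices h : ∀ B A : List ℕ, ∃ d, Edits d A (A ++ B) from h V []
    intro B
    induction B with
    | nil => intro A; exact ⟨0, by simpa using Edits.refl A⟩
    | cons x B ih =>
      intro A
      obtain ⟨d, h⟩ := ih (A ++ [x])
      refine ⟨d + 1, .step (V := A ++ [x]) ?_ (by simpa using h)⟩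
      simpa using EditStep.insert A [] x

/-- Edit distance: the minimum number of insertions, deletions and substitutions of letters that
transform `U` into `V`. -/
noncomputable def editDist (U V : List ℕ) : ℕ := sInf {d | Edits d U V}

/-- The fragment `T[i .. j)`. -/
def fragment (T : List ℕ) (i j : ℕ) : List ℕ := (T.drop i).take (j - i)

/-- Starting positions of circular `k`-edit occurrences of `P` in `T`: the positions `i` such that
some fragment `T[i .. j)` is at edit distance at most `k` from some rotation of `P`. -/
def circEditOcc (k : ℕ) (P T : List ℕ) : Set ℕ :=
  {i | ∃ j, i ≤ j ∧ j ≤ T.length ∧ ∃ P', P.IsRotated P' ∧ editDist P' (fragment T i j) ≤ k}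

/-- Starting positions of circular `k`-edit occurrences of `P` in `T` with split position `j`: the
fragment `T[i .. j)` is matched with a suffix `P₂` of `P`, a fragment `T[j .. r)` with the
complementary prefix `P₁`, using at most `k` edits altogether. -/
def anchoredOcc (k : ℕ) (P T : List ℕ) (j : ℕ) : Set ℕ :=
  {i | i ≤ j ∧ ∃ r, j ≤ r ∧ r ≤ T.length ∧ ∃ P₁ P₂, P = P₁ ++ P₂ ∧
    editDist (fragment T i j) P₂ + editDist (fragment T j r) P₁ ≤ k}

end CircularMatching

/-! ### Word RAM

Words are the numbers below `2 ^ w`. A program uses finitely many registers and finitely many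
random-access arrays of words; an address is a word. Programs are structured (sequencing,
conditionals, loops). Every evaluated constant, register read, array read, arithmetic operation,
comparison, write and test costs one step. -/

namespace WordRAM

/-- Arithmetic operations and comparisons. -/
inductive Op where
  | add | sub | mul | div | mod | lt | eq

/-- The result of an operation on words of `w` bits, reduced modulo `2 ^ w` (subtraction is
truncated at `0`, comparisons return `1` for true and `0` for false). -/
def Op.apply (w : ℕ) : Op → ℕ → ℕ → ℕ
  | .add, x, y => (x + y) % 2 ^ w
  | .sub, x, y => (x - y) % 2 ^ w
  | .mul, x, y => (x * y) % 2 ^ w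
  | .div, x, y => (x / y) % 2 ^ w
  | .mod, x, y => (x % y) % 2 ^ w
  | .lt, x, y => (if x < y then 1 else 0) % 2 ^ w
  | .eq, x, y => (if x = y then 1 else 0) % 2 ^ w

/-- Expressions: constants, registers, array reads, operations. -/
inductive Expr where
  | const (c : ℕ)
  | reg (x : ℕ)
  | load (a : ℕ) (e : Expr)
  | bin (o : Op) (e₁ e₂ : Expr)

/-- Contents of the registers and of the arrays. -/
@[ext] structure State where
  reg : ℕ → ℕ
  mem : ℕ → ℕ → ℕ

/-- Value of an expression. -/
def Expr.eval (w : ℕ) (s : State) : Expr → ℕ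
  | .const c => c % 2 ^ w
  | .reg x => s.reg x
  | .load a e => s.mem a (e.eval w s)
  | .bin o e₁ e₂ => o.apply w (e₁.eval w s) (e₂.eval w s)

/-- Number of steps needed to evaluate an expression. -/
def Expr.cost : Expr → ℕ
  | .const _ => 1
  | .reg _ => 1
  | .load _ e => e.cost + 1
  | .bin _ e₁ e₂ => e₁.cost + e₂.cost + 1

/-- Write `v` into register `x`. -/
def State.setReg (s : State) (x v : ℕ) : State :=
  { s with reg := Function.update s.reg x v }

/-- Write `v` into cell `i` of array `a`. -/
def State.setMem (s : State) (a i v : ℕ) : State :=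
  { s with mem := Function.update s.mem a (Function.update (s.mem a) i v) }

/-- Programs: `x := e`, `a[e₁] := e₂`, sequencing, conditional, and loop (while `e` is nonzero). -/
inductive Program where
  | skip
  | assign (x : ℕ) (e : Expr)
  | store (a : ℕ) (e₁ e₂ : Expr)
  | seq (p q : Program)
  | cond (e : Expr) (p q : Program)
  | loop (e : Expr) (p : Program)

/-- `Run w p s t s'`: with word size `w`, program `p` started in state `s` halts after exactly `t`
steps in state `s'`. -/
inductive Run (w : ℕ) : Program → State → ℕ → State → Prop
  | skip (s : State) : Run w .skip s 1 s
  | assign (s : State) (x : ℕ) (e : Expr) :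
      Run w (.assign x e) s (e.cost + 1) (s.setReg x (e.eval w s))
  | store (s : State) (a : ℕ) (e₁ e₂ : Expr) :
      Run w (.store a e₁ e₂) s (e₁.cost + e₂.cost + 1) (s.setMem a (e₁.eval w s) (e₂.eval w s))
  | seq {p q : Program} {s s₁ s₂ : State} {t₁ t₂ : ℕ} :
      Run w p s t₁ s₁ → Run w q s₁ t₂ s₂ → Run w (.seq p q) s (t₁ + t₂) s₂
  | cond_true {e : Expr} {p q : Program} {s s' : State} {t : ℕ} :
      e.eval w s ≠ 0 → Run w p s t s' → Run w (.cond e p q) s (e.cost + 1 + t) s'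
  | cond_false {e : Expr} {p q : Program} {s s' : State} {t : ℕ} :
      e.eval w s = 0 → Run w q s t s' → Run w (.cond e p q) s (e.cost + 1 + t) s'
  | loop_true {e : Expr} {p : Program} {s s₁ s₂ : State} {t₁ t₂ : ℕ} :
      e.eval w s ≠ 0 → Run w p s t₁ s₁ → Run w (.loop e p) s₁ t₂ s₂ →
        Run w (.loop e p) s (e.cost + 1 + t₁ + t₂) s₂
  | loop_false {e : Expr} {p : Program} {s : State} :
      e.eval w s = 0 → Run w (.loop e p) s (e.cost + 1) s

/-- Running time and final state are determined by the program and the initial state. -/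
theorem Run.deterministic {w : ℕ} {p : Program} {s s₁ s₂ : State} {t₁ t₂ : ℕ}
    (h₁ : Run w p s t₁ s₁) (h₂ : Run w p s t₂ s₂) : t₁ = t₂ ∧ s₁ = s₂ := by
  induction h₁ generalizing t₂ s₂ with
  | skip => cases h₂; exact ⟨rfl, rfl⟩
  | assign => cases h₂; exact ⟨rfl, rfl⟩
  | store => cases h₂; exact ⟨rfl, rfl⟩
  | seq _ _ ih₁ ih₂ =>
    cases h₂ with
    | seq a b =>
      obtain ⟨rfl, rfl⟩ := ih₁ a
      obtain ⟨rfl, rfl⟩ := ih₂ b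
      exact ⟨rfl, rfl⟩
  | cond_true h _ ih =>
    cases h₂ with
    | cond_true _ b => obtain ⟨rfl, rfl⟩ := ih b; exact ⟨rfl, rfl⟩
    | cond_false h' _ => exact absurd h' h
  | cond_false h _ ih =>
    cases h₂ with
    | cond_true h' _ => exact absurd h h'
    | cond_false _ b => obtain ⟨rfl, rfl⟩ := ih b; exact ⟨rfl, rfl⟩
  | loop_true h _ _ ih₁ ih₂ =>
    cases h₂ with
    | loop_true _ a b =>
      obtain ⟨rfl, rfl⟩ := ih₁ a
      obtain ⟨rfl, rfl⟩ := ih₂ b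
      exact ⟨rfl, rfl⟩
    | loop_false h' => exact absurd h' h
  | loop_false h =>
    cases h₂ with
    | loop_true h' _ _ => exact absurd h h'
    | loop_false _ => exact ⟨rfl, rfl⟩

/-- Initial state for a text `T` and a pattern `P`: `|T|` and `|P|` are in registers 0 and 1, `T` and
`P` are in arrays 0 and 1, everything else is 0. -/
def input (T P : List ℕ) : State where
  reg := fun x => if x = 0 then T.length else if x = 1 then P.length else 0
  mem := fun a i => if a = 0 then T.getD i 0 else if a = 1 then P.getD i 0 else 0

/-- The state holds a list of the elements of `A`, each exactly once: the number of elements is in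
register 0, the elements are in the first cells of array 2. -/
def Reports (s : State) (A : Set ℕ) : Prop :=
  ((List.range (s.reg 0)).map (s.mem 2)).Nodup ∧
    ∀ i, i ∈ A ↔ i ∈ (List.range (s.reg 0)).map (s.mem 2)

/-- The state holds a list of intervals with union `A`: the number of intervals is in register 0,
their left and right ends are in the first cells of arrays 2 and 3. -/
def ReportsIntervals (s : State) (A : Set ℕ) : Prop :=
  A = ⋃ q ∈ Finset.range (s.reg 0), Set.Icc (s.mem 2 q) (s.mem 3 q)

end WordRAM

/-!
Why the theorem holds. Cutting an alignment of a rotation `P₂ ++ P₁` of the pattern with a fragment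
`T[i .. r)` at the boundary of `P₂` and `P₁` also cuts the fragment, at a split position `j`
(`circEditOcc_eq`). For a fixed `j` the two halves are independent: the reversal of a suffix of
`T[0 .. j)` has to be matched with a prefix of the reversed pattern, of length `z` say, and a prefix
of `T[j .. n)` with the prefix of length `m - z` of the pattern, with at most `k` edits altogether
(`mem_anchoredOcc_iff`).

In either half only the `2 k + 1` diagonals next to the main one of the table of edit distances of
prefixes matter, and on a diagonal the cells with value at most `e` form an initial segment, as
values never decrease along a diagonal. The ends of these segments, the furthest-reaching points, obey
the recursion of Landau and Vishkin: a point for `e + 1` arises from those for `e` on the same and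
the neighbouring diagonals by one edit and a maximal run of matches (`EditTable.furthest_succ`). The
length of the run is a longest common prefix of two suffixes of `T ++ P ++ reverse T ++ reverse P`,
so `O(k ^ 2)` such queries give the points of both halves for all `e ≤ k` and all diagonals. To the
right of `j`, the points yield for each `e` the length `L e` of the longest prefix of the pattern
that is within distance `e` of a prefix of `T[j .. n)`; all shorter prefixes then qualify, too
(`EditTable.exists_le_iff`). To the left, the cells with value at most `e` and with
`m - z ≤ L (k - e)` form one interval on each diagonal. These at most `(k + 1) * (2 k + 3)` intervals
of starting positions make up the answer for `j` (`reportSplit_spec`). For the reporting version they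
are collected for all `j`, keeping for each left end only the largest right end, and a single sweep
lists their union (`reportAll_spec`).

Longest common prefixes are found in constant time after linear-time preprocessing.
* Suffixes are sorted (`suffixSort_spec`) by a variant of the skew algorithm of Kärkkäinen and
  Sanders in which positions are never renumbered. The sample of level `l` consists of the positions
  without a zero among their `l` lowest ternary digits; each level has at most two thirds of the
  positions of the preceding one. On the way down, blocks of length `3 ^ l` at sample positions are
  named in lexicographic order, by radix sort of triples of names. On the way up, the suffixes at the
  positions that the next level drops are sorted by a name and a rank, and merged with those of the
  next level.
* The common prefixes of lexicographically adjacent suffixes are computed by the algorithm of Kasai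
  et al. (`kasai_spec`), and a longest common prefix is a minimum over a range of them.
* Range minima (`rangeMin_spec`) are combined from a sparse table over blocks of logarithmic length
  and from words that encode, as bit masks, the stack of suffix minima of each prefix of a block.
  The highest bits of such words are looked up in a table of logarithms.

The programs are verified with a weakest-precondition calculus (`wp`) over runs on unbounded numbers
that never write a number above a fixed bound `B` (`IRun`). As the expressions in the programs are
small, all intermediate results stay below `B ^ 24`, so that such runs are runs on words of `w` bits
whenever `B ^ 24 ≤ 2 ^ w` (`IRun.run`). With `M` the length of the text plus the number of edits plus
one, `B = M ^ (c + 20)` suffices.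
-/

namespace WordRAM

/-! ### Reasoning about programs -/

/-- The result of an operation on unbounded natural numbers. -/
def Op.ideal : Op → ℕ → ℕ → ℕ
  | .add, x, y => x + y
  | .sub, x, y => x - y
  | .mul, x, y => x * y
  | .div, x, y => x / y
  | .mod, x, y => x % y
  | .lt, x, y => if x < y then 1 else 0
  | .eq, x, y => if x = y then 1 else 0

/-- The value of an expression when words are unbounded. -/
def Expr.ev (s : State) : Expr → ℕ
  | .const c => c
  | .reg x => s.reg x
  | .load a e => s.mem a (e.ev s)
  | .bin o e₁ e₂ => o.ideal (e₁.ev s) (e₂.ev s)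

/-- The number of leaves of an expression: on a state bounded by `B`, no subexpression exceeds `B`
to this power. -/
def Expr.leaves : Expr → ℕ
  | .const _ => 1
  | .reg _ => 1
  | .load _ e => e.leaves
  | .bin _ e₁ e₂ => e₁.leaves + e₂.leaves

/-- All constants are at most `100`. -/
def Expr.smallConsts : Expr → Bool
  | .const c => decide (c ≤ 100)
  | .reg _ => true
  | .load _ e => e.smallConsts
  | .bin _ e₁ e₂ => e₁.smallConsts && e₂.smallConsts

/-- Small constants and at most `24` leaves. -/
def Expr.ok (e : Expr) : Bool := e.smallConsts && decide (e.leaves ≤ 24)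

/-- All expressions of a program are small. -/
def Program.ok : Program → Bool
  | .skip => true
  | .assign _ e => e.ok
  | .store _ e₁ e₂ => e₁.ok && e₂.ok
  | .seq p q => p.ok && q.ok
  | .cond e p q => e.ok && p.ok && q.ok
  | .loop e p => e.ok && p.ok

/-- All registers and memory cells hold numbers below `B`. -/
def Bdd (B : ℕ) (s : State) : Prop := (∀ x, s.reg x < B) ∧ ∀ a i, s.mem a i < B

theorem Bdd.mono {B B' : ℕ} {s : State} (h : Bdd B s) (hB : B ≤ B') : Bdd B' s :=
  ⟨fun x => (h.1 x).trans_le hB, fun a i => (h.2 a i).trans_le hB⟩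

theorem Bdd.setReg {B : ℕ} {s : State} (h : Bdd B s) {x v : ℕ} (hv : v < B) :
    Bdd B (s.setReg x v) := by
  refine ⟨fun y => ?_, h.2⟩
  by_cases hy : y = x <;> simp [State.setReg, hy, hv, h.1]

theorem Bdd.setMem {B : ℕ} {s : State} (h : Bdd B s) {a i v : ℕ} (hv : v < B) :
    Bdd B (s.setMem a i v) := by
  refine ⟨h.1, fun b j => ?_⟩
  by_cases hy : b = a
  · subst hy
    by_cases hj : j = i <;> simp [State.setMem, hj, hv, h.2]
  · simp [State.setMem, hy, h.2]

/-- Every operation maps numbers below `B ^ p` and `B ^ q` to a number below `B ^ (p + q)`, the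
product being the extreme case. -/
theorem Expr.ev_lt_pow {B : ℕ} (hB : 100 < B) {s : State} (hs : Bdd B s) (e : Expr)
    (he : e.smallConsts = true) : 1 ≤ e.leaves ∧ e.ev s < B ^ e.leaves := by
  induction e with
  | const c =>
    simp only [Expr.smallConsts, decide_eq_true_eq] at he
    simp only [Expr.leaves, Expr.ev, pow_one]
    omega
  | reg x => simpa [Expr.leaves, Expr.ev] using hs.1 x
  | load a e ih =>
    obtain ⟨h1, h2⟩ := ih he
    exact ⟨h1, (hs.2 a _).trans_le (Nat.le_self_pow (by simp only [Expr.leaves]; omega) B)⟩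
  | bin o e₁ e₂ ih₁ ih₂ =>
    simp only [Expr.smallConsts, Bool.and_eq_true] at he
    obtain ⟨h1, h2⟩ := ih₁ he.1
    obtain ⟨h3, h4⟩ := ih₂ he.2
    refine ⟨by simp only [Expr.leaves]; omega, ?_⟩
    simp only [Expr.leaves, Expr.ev, pow_add]
    have b1 : 100 < B ^ e₁.leaves := hB.trans_le (Nat.le_self_pow (by omega) B)
    have b2 : 100 < B ^ e₂.leaves := hB.trans_le (Nat.le_self_pow (by omega) B)
    generalize B ^ e₁.leaves = p at *
    generalize B ^ e₂.leaves = q at *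
    generalize e₁.ev s = x at *
    generalize e₂.ev s = y at *
    have hpq : p + q ≤ p * q := by nlinarith
    cases o <;> simp only [Op.ideal]
    · omega
    · omega
    · exact Nat.mul_lt_mul'' h2 h4
    · exact (Nat.div_le_self _ _).trans_lt (by omega)
    · exact (Nat.mod_le _ _).trans_lt (by omega)
    · split_ifs <;> omega
    · split_ifs <;> omega

/-- The operations of the machine reduce modulo `2 ^ w`; on small expressions this has no effect. -/
theorem Expr.eval_eq_ev {B w : ℕ} (hB : 100 < B) (hw : B ^ 24 ≤ 2 ^ w) {s : State} (hs : Bdd B s)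
    (e : Expr) (he : e.smallConsts = true) (hl : e.leaves ≤ 24) : e.eval w s = e.ev s := by
  have key : ∀ e : Expr, e.smallConsts = true → e.leaves ≤ 24 → e.ev s < 2 ^ w := fun e he hl =>
    (e.ev_lt_pow hB hs he).2.trans_le ((Nat.pow_le_pow_right (by omega) hl).trans hw)
  induction e with
  | const c => exact Nat.mod_eq_of_lt (key (.const c) he hl)
  | reg x => rfl
  | load a e ih => simp only [Expr.eval, Expr.ev, ih he hl]
  | bin o e₁ e₂ ih₁ ih₂ =>
    have h := key _ he hl
    simp only [Expr.smallConsts, Bool.and_eq_true] at he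
    simp only [Expr.leaves] at hl
    simp only [Expr.eval, ih₁ he.1 (by omega), ih₂ he.2 (by omega)]
    cases o <;> exact Nat.mod_eq_of_lt h

/-- Runs on unbounded words in which only numbers below `B` are ever written. -/
inductive IRun (B : ℕ) : Program → State → ℕ → State → Prop
  | skip (s : State) : IRun B .skip s 1 s
  | assign (s : State) (x : ℕ) (e : Expr) (h : e.ev s < B) :
      IRun B (.assign x e) s (e.cost + 1) (s.setReg x (e.ev s))
  | store (s : State) (a : ℕ) (e₁ e₂ : Expr) (h : e₂.ev s < B) :
      IRun B (.store a e₁ e₂) s (e₁.cost + e₂.cost + 1) (s.setMem a (e₁.ev s) (e₂.ev s))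
  | seq {p q : Program} {s s₁ s₂ : State} {t₁ t₂ : ℕ} :
      IRun B p s t₁ s₁ → IRun B q s₁ t₂ s₂ → IRun B (.seq p q) s (t₁ + t₂) s₂
  | cond_true {e : Expr} {p q : Program} {s s' : State} {t : ℕ} :
      e.ev s ≠ 0 → IRun B p s t s' → IRun B (.cond e p q) s (e.cost + 1 + t) s'
  | cond_false {e : Expr} {p q : Program} {s s' : State} {t : ℕ} :
      e.ev s = 0 → IRun B q s t s' → IRun B (.cond e p q) s (e.cost + 1 + t) s'
  | loop_true {e : Expr} {p : Program} {s s₁ s₂ : State} {t₁ t₂ : ℕ} :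
      e.ev s ≠ 0 → IRun B p s t₁ s₁ → IRun B (.loop e p) s₁ t₂ s₂ →
        IRun B (.loop e p) s (e.cost + 1 + t₁ + t₂) s₂
  | loop_false {e : Expr} {p : Program} {s : State} :
      e.ev s = 0 → IRun B (.loop e p) s (e.cost + 1) s

theorem IRun.bdd {B : ℕ} {p : Program} {s s' : State} {t : ℕ} (h : IRun B p s t s')
    (hs : Bdd B s) : Bdd B s' := by
  induction h with
  | skip => exact hs
  | assign s x e h => exact hs.setReg h
  | store s a e₁ e₂ h => exact hs.setMem h
  | seq _ _ ih₁ ih₂ => exact ih₂ (ih₁ hs)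
  | cond_true _ _ ih => exact ih hs
  | cond_false _ _ ih => exact ih hs
  | loop_true _ _ _ ih₁ ih₂ => exact ih₂ (ih₁ hs)
  | loop_false => exact hs

/-- If words are long enough, then no overflow happens in a run that writes only small numbers. -/
theorem IRun.run {B w : ℕ} (hB : 100 < B) (hw : B ^ 24 ≤ 2 ^ w) {p : Program} {s s' : State}
    {t : ℕ} (h : IRun B p s t s') (hs : Bdd B s) (hp : p.ok = true) : Run w p s t s' := by
  have ev : ∀ (e : Expr) (s : State), Bdd B s → e.ok = true → e.ev s = e.eval w s := by
    intro e s hs he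
    simp only [Expr.ok, Bool.and_eq_true, decide_eq_true_eq] at he
    exact (e.eval_eq_ev hB hw hs he.1 he.2).symm
  induction h with
  | skip s => exact .skip s
  | assign s x e h => rw [ev e s hs hp]; exact .assign s x e
  | store s a e₁ e₂ h =>
    simp only [Program.ok, Bool.and_eq_true] at hp
    rw [ev e₁ s hs hp.1, ev e₂ s hs hp.2]; exact .store s a e₁ e₂
  | seq h₁ _ ih₁ ih₂ =>
    simp only [Program.ok, Bool.and_eq_true] at hp
    exact .seq (ih₁ hs hp.1) (ih₂ (h₁.bdd hs) hp.2)
  | cond_true h _ ih =>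
    simp only [Program.ok, Bool.and_eq_true] at hp
    rw [ev _ _ hs hp.1.1] at h
    exact .cond_true h (ih hs hp.1.2)
  | cond_false h _ ih =>
    simp only [Program.ok, Bool.and_eq_true] at hp
    rw [ev _ _ hs hp.1.1] at h
    exact .cond_false h (ih hs hp.2)
  | loop_true h h₁ _ ih₁ ih₂ =>
    have hp' := hp
    simp only [Program.ok, Bool.and_eq_true] at hp
    rw [ev _ _ hs hp.1] at h
    exact .loop_true h (ih₁ hs hp.2) (ih₂ (h₁.bdd hs) hp')
  | loop_false h =>
    simp only [Program.ok, Bool.and_eq_true] at hp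
    rw [ev _ _ hs hp.1] at h
    exact .loop_false h

/-- The registers that a program may write. -/
def Program.wr : Program → List ℕ
  | .skip => []
  | .assign x _ => [x]
  | .store _ _ _ => []
  | .seq p q => p.wr ++ q.wr
  | .cond _ p q => p.wr ++ q.wr
  | .loop _ p => p.wr

/-- The arrays that a program may write. -/
def Program.wm : Program → List ℕ
  | .skip => []
  | .assign _ _ => []
  | .store a _ _ => [a]
  | .seq p q => p.wm ++ q.wm
  | .cond _ p q => p.wm ++ q.wm
  | .loop _ p => p.wm

/-- The states agree on everything that the program cannot write. -/
structure Frame (p : Program) (s s' : State) : Prop where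
  reg : ∀ x, x ∉ p.wr → s'.reg x = s.reg x
  mem : ∀ a, a ∉ p.wm → s'.mem a = s.mem a

theorem Frame.refl (p : Program) (s : State) : Frame p s s := ⟨fun _ _ => rfl, fun _ _ => rfl⟩

theorem IRun.frame {B : ℕ} {p : Program} {s s' : State} {t : ℕ} (h : IRun B p s t s') :
    Frame p s s' := by
  induction h with
  | skip s => exact .refl _ s
  | assign s x e h =>
    refine ⟨fun y hy => ?_, fun _ _ => rfl⟩
    simp only [Program.wr, List.mem_singleton] at hy
    simp [State.setReg, hy]
  | store s a e₁ e₂ h =>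
    refine ⟨fun _ _ => rfl, fun b hb => ?_⟩
    simp only [Program.wm, List.mem_singleton] at hb
    simp [State.setMem, hb]
  | seq _ _ ih₁ ih₂ =>
    refine ⟨fun y hy => ?_, fun b hb => ?_⟩
    · simp only [Program.wr, List.mem_append, not_or] at hy
      rw [ih₂.reg y hy.2, ih₁.reg y hy.1]
    · simp only [Program.wm, List.mem_append, not_or] at hb
      rw [ih₂.mem b hb.2, ih₁.mem b hb.1]
  | cond_true _ _ ih =>
    refine ⟨fun y hy => ?_, fun b hb => ?_⟩
    · simp only [Program.wr, List.mem_append, not_or] at hy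
      exact ih.reg y hy.1
    · simp only [Program.wm, List.mem_append, not_or] at hb
      exact ih.mem b hb.1
  | cond_false _ _ ih =>
    refine ⟨fun y hy => ?_, fun b hb => ?_⟩
    · simp only [Program.wr, List.mem_append, not_or] at hy
      exact ih.reg y hy.2
    · simp only [Program.wm, List.mem_append, not_or] at hb
      exact ih.mem b hb.2
  | loop_true _ _ _ ih₁ ih₂ =>
    refine ⟨fun y hy => ?_, fun b hb => ?_⟩
    · rw [ih₂.reg y hy, ih₁.reg y hy]
    · rw [ih₂.mem b hb, ih₁.mem b hb]
  | loop_false => exact .refl _ _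

/-- Weakest precondition: from `s`, program `p` halts, writing only numbers below `B`, in a state
and after a number of steps that satisfy `Q`. -/
def wp (B : ℕ) (p : Program) (s : State) (Q : State → ℕ → Prop) : Prop :=
  ∃ t s', IRun B p s t s' ∧ Q s' t

/-- A specification of a subprogram, together with what the subprogram leaves alone, is used to
establish another postcondition. -/
theorem wp.call {B : ℕ} {p : Program} {s : State} {Q Q' : State → ℕ → Prop} (h : wp B p s Q)
    (hB : Bdd B s) (h' : ∀ s' t, Frame p s s' → Bdd B s' → Q s' t → Q' s' t) : wp B p s Q' := by
  obtain ⟨t, s', h1, h2⟩ := h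
  exact ⟨t, s', h1, h' s' t h1.frame (h1.bdd hB) h2⟩

theorem wp.mono {B : ℕ} {p : Program} {s : State} {Q Q' : State → ℕ → Prop} (h : wp B p s Q)
    (h' : ∀ s' t, Q s' t → Q' s' t) : wp B p s Q' := by
  obtain ⟨t, s', h1, h2⟩ := h
  exact ⟨t, s', h1, h' s' t h2⟩

@[simp] theorem wp_skip {B : ℕ} {s : State} {Q : State → ℕ → Prop} :
    wp B .skip s Q ↔ Q s 1 :=
  ⟨fun ⟨_, _, h, hQ⟩ => by cases h; exact hQ, fun h => ⟨_, _, .skip s, h⟩⟩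

@[simp] theorem wp_assign {B : ℕ} {s : State} {Q : State → ℕ → Prop} {x : ℕ} {e : Expr} :
    wp B (.assign x e) s Q ↔ e.ev s < B ∧ Q (s.setReg x (e.ev s)) (e.cost + 1) :=
  ⟨fun ⟨_, _, h, hQ⟩ => by cases h with | assign _ _ _ h => exact ⟨h, hQ⟩,
    fun h => ⟨_, _, .assign s x e h.1, h.2⟩⟩

@[simp] theorem wp_store {B : ℕ} {s : State} {Q : State → ℕ → Prop} {a : ℕ} {e₁ e₂ : Expr} :
    wp B (.store a e₁ e₂) s Q ↔
      e₂.ev s < B ∧ Q (s.setMem a (e₁.ev s) (e₂.ev s)) (e₁.cost + e₂.cost + 1) :=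
  ⟨fun ⟨_, _, h, hQ⟩ => by cases h with | store _ _ _ _ h => exact ⟨h, hQ⟩,
    fun h => ⟨_, _, .store s a e₁ e₂ h.1, h.2⟩⟩

@[simp] theorem wp_seq {B : ℕ} {s : State} {Q : State → ℕ → Prop} {p q : Program} :
    wp B (.seq p q) s Q ↔ wp B p s fun s₁ t₁ => wp B q s₁ fun s₂ t₂ => Q s₂ (t₁ + t₂) :=
  ⟨fun ⟨_, _, h, hQ⟩ => by cases h with | seq h₁ h₂ => exact ⟨_, _, h₁, _, _, h₂, hQ⟩,
    fun ⟨_, _, h₁, _, _, h₂, hQ⟩ => ⟨_, _, .seq h₁ h₂, hQ⟩⟩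

@[simp] theorem wp_cond {B : ℕ} {s : State} {Q : State → ℕ → Prop} {e : Expr} {p q : Program} :
    wp B (.cond e p q) s Q ↔
      (e.ev s ≠ 0 → wp B p s fun s' t => Q s' (e.cost + 1 + t)) ∧
        (e.ev s = 0 → wp B q s fun s' t => Q s' (e.cost + 1 + t)) := by
  constructor
  · rintro ⟨t, s', h, hQ⟩
    cases h with
    | cond_true h1 h2 => exact ⟨fun _ => ⟨_, _, h2, hQ⟩, fun h => absurd h h1⟩
    | cond_false h1 h2 => exact ⟨fun h => absurd h1 h, fun _ => ⟨_, _, h2, hQ⟩⟩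
  · rintro ⟨h1, h2⟩
    by_cases h : e.ev s = 0
    · obtain ⟨t, s', h3, h4⟩ := h2 h
      exact ⟨_, _, .cond_false h h3, h4⟩
    · obtain ⟨t, s', h3, h4⟩ := h1 h
      exact ⟨_, _, .cond_true h h3, h4⟩

/-- Loops by invariant `I` and potential `Φ`, which pays for all steps. -/
theorem wp_while {B : ℕ} {e : Expr} {p : Program} {s : State} {Q : State → ℕ → Prop}
    (I : State → Prop) (Φ : State → ℕ) (hB : Bdd B s) (h0 : I s)
    (hstep : ∀ s', Frame (.loop e p) s s' → Bdd B s' → I s' → e.ev s' ≠ 0 →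
      wp B p s' fun s'' t => I s'' ∧ t + e.cost + 1 + Φ s'' ≤ Φ s')
    (hQ : ∀ s' t, Frame (.loop e p) s s' → Bdd B s' → I s' → e.ev s' = 0 →
      t + Φ s' ≤ Φ s + e.cost + 1 → Q s' t) : wp B (.loop e p) s Q := by
  suffices H : ∀ n s₁, Φ s₁ = n → Frame (.loop e p) s s₁ → Bdd B s₁ → I s₁ →
      ∃ t s', IRun B (.loop e p) s₁ t s' ∧ Frame (.loop e p) s s' ∧ Bdd B s' ∧ I s' ∧ e.ev s' = 0 ∧
        t + Φ s' ≤ Φ s₁ + e.cost + 1 by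
    obtain ⟨t, s', h1, h2, h3, h4, h5, h6⟩ := H _ s rfl (.refl _ _) hB h0
    exact ⟨t, s', h1, hQ s' t h2 h3 h4 h5 h6⟩
  intro n
  induction n using Nat.strong_induction_on with
  | _ n ih =>
    intro s₁ hn hF hB₁ hI
    by_cases h : e.ev s₁ = 0
    · exact ⟨_, s₁, .loop_false h, hF, hB₁, hI, h, by omega⟩
    · obtain ⟨t, s₂, h1, h2, h3⟩ := hstep s₁ hF hB₁ hI h
      have hF₂ : Frame (.loop e p) s s₂ :=
        ⟨fun x hx => (h1.frame.reg x hx).trans (hF.reg x hx),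
          fun x hx => (h1.frame.mem x hx).trans (hF.mem x hx)⟩
      obtain ⟨t', s', h4, h5, h6, h7, h8, h9⟩ :=
        ih (Φ s₂) (by omega) s₂ rfl hF₂ (h1.bdd hB₁) h2
      exact ⟨_, s', .loop_true h h1 h4, h5, h6, h7, h8, by omega⟩

/-! ### Notation for programs -/

instance : Add Expr := ⟨.bin .add⟩
instance : Sub Expr := ⟨.bin .sub⟩
instance : Mul Expr := ⟨.bin .mul⟩
instance : Div Expr := ⟨.bin .div⟩
instance : Mod Expr := ⟨.bin .mod⟩
instance (n : ℕ) : OfNat Expr n := ⟨.const n⟩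

infix:50 " <! " => Expr.bin Op.lt
infix:50 " =! " => Expr.bin Op.eq
infix:45 " ≔ " => Program.assign
infixr:40 " ;; " => Program.seq

/-- The value of register `x`. -/
abbrev rg (x : ℕ) : Expr := .reg x

/-- The value of cell `e` of array `a`. -/
abbrev ld (a : ℕ) (e : Expr) : Expr := .load a e

/-- One-sided conditional. -/
abbrev ifThen (e : Expr) (p : Program) : Program := .cond e p .skip

section
variable (s : State) (a b : Expr)

@[simp] theorem ev_add : (a + b).ev s = a.ev s + b.ev s := rfl
@[simp] theorem ev_sub : (a - b).ev s = a.ev s - b.ev s := rfl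
@[simp] theorem ev_mul : (a * b).ev s = a.ev s * b.ev s := rfl
@[simp] theorem ev_div : (a / b).ev s = a.ev s / b.ev s := rfl
@[simp] theorem ev_mod : (a % b).ev s = a.ev s % b.ev s := rfl
@[simp] theorem ev_lt : (a <! b).ev s = if a.ev s < b.ev s then 1 else 0 := rfl
@[simp] theorem ev_eq : (a =! b).ev s = if a.ev s = b.ev s then 1 else 0 := rfl
@[simp] theorem ev_reg (x : ℕ) : (Expr.reg x).ev s = s.reg x := rfl
@[simp] theorem ev_load (x : ℕ) : (Expr.load x a).ev s = s.mem x (a.ev s) := rfl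
@[simp] theorem ev_ofNat (n : ℕ) : (no_index (OfNat.ofNat n : Expr)).ev s = (OfNat.ofNat n : ℕ) := rfl

@[simp] theorem cost_add : (a + b).cost = a.cost + b.cost + 1 := rfl
@[simp] theorem cost_sub : (a - b).cost = a.cost + b.cost + 1 := rfl
@[simp] theorem cost_mul : (a * b).cost = a.cost + b.cost + 1 := rfl
@[simp] theorem cost_div : (a / b).cost = a.cost + b.cost + 1 := rfl
@[simp] theorem cost_mod : (a % b).cost = a.cost + b.cost + 1 := rfl
@[simp] theorem cost_bin (o : Op) : (Expr.bin o a b).cost = a.cost + b.cost + 1 := rfl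
@[simp] theorem cost_reg (x : ℕ) : (Expr.reg x).cost = 1 := rfl
@[simp] theorem cost_load (x : ℕ) : (Expr.load x a).cost = a.cost + 1 := rfl
@[simp] theorem cost_ofNat (n : ℕ) : (no_index (OfNat.ofNat n : Expr)).cost = 1 := rfl

@[simp] theorem reg_setReg (x v y : ℕ) :
    (s.setReg x v).reg y = if y = x then v else s.reg y := by
  simp [State.setReg, Function.update_apply]
@[simp] theorem mem_setReg (x v : ℕ) : (s.setReg x v).mem = s.mem := rfl
@[simp] theorem reg_setMem (x i v : ℕ) : (s.setMem x i v).reg = s.reg := rfl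
@[simp] theorem mem_setMem (x i v y : ℕ) :
    (s.setMem x i v).mem y = if y = x then Function.update (s.mem x) i v else s.mem y := by
  simp [State.setMem, Function.update_apply]

end

/-- Loop with counter `i` from `lo` up to, but not including, `hi`. -/
def forLoop (i : ℕ) (lo hi : Expr) (body : Program) : Program :=
  i ≔ lo ;; .loop (rg i <! hi) (body ;; i ≔ rg i + 1)

/-- Rule for counting loops whose body takes at most `c` steps. -/
theorem wp_for {B i : ℕ} {lo hi : Expr} {body : Program} {s : State} {Q : State → ℕ → Prop}
    (l h c : ℕ) (I : ℕ → State → Prop) (hB : Bdd B s) (hi_body : i ∉ body.wr) (hhB : h < B)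
    (hlo : lo.ev s = l) (hlh : l ≤ h)
    (hhi : ∀ s', Frame (forLoop i lo hi body) s s' → hi.ev s' = h)
    (h0 : I l (s.setReg i l))
    (hstep : ∀ q s', l ≤ q → q < h → s'.reg i = q → Frame (forLoop i lo hi body) s s' →
      Bdd B s' → I q s' →
      wp B body s' fun s'' t => t ≤ c ∧ I (q + 1) (s''.setReg i (q + 1)))
    (hQ : ∀ s' t, t ≤ (c + hi.cost + 9) * (h - l) + lo.cost + hi.cost + 9 → s'.reg i = h →
      Frame (forLoop i lo hi body) s s' → Bdd B s' → I h s' → Q s' t) :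
    wp B (forLoop i lo hi body) s Q := by
  unfold forLoop
  rw [wp_seq, wp_assign, hlo]
  refine ⟨by omega, ?_⟩
  have hF0 : ∀ {s'}, Frame (.loop (rg i <! hi) (body ;; i ≔ rg i + 1)) (s.setReg i l) s' →
      Frame (forLoop i lo hi body) s s' := by
    intro s' hF
    constructor
    · intro x hx
      simp only [forLoop, Program.wr, List.mem_append, List.mem_singleton, not_or] at hx
      rw [hF.reg x (by simpa [Program.wr] using hx.2)]
      simp [hx.1]
    · intro a ha
      simp only [forLoop, Program.wm, List.mem_append, not_or] at ha
      rw [hF.mem a (by simpa [Program.wm] using ha.2)]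
      simp
  refine wp_while (fun s' => l ≤ s'.reg i ∧ s'.reg i ≤ h ∧ I (s'.reg i) s')
    (fun s' => (c + hi.cost + 9) * (h - s'.reg i)) (hB.setReg (by omega))
    (by simpa using ⟨hlh, h0⟩) ?_ ?_
  · rintro s' hF hB' ⟨h1, h2, h3⟩ hne
    have e1 := hhi s' (hF0 hF)
    simp only [ev_lt, ev_reg, e1] at hne
    have hlt : s'.reg i < h := by by_contra hc; simp [hc] at hne
    rw [wp_seq]
    refine (hstep _ s' h1 hlt rfl (hF0 hF) hB' h3).call hB' ?_
    rintro s'' t hF' hB'' ⟨ht, hI⟩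
    rw [wp_assign]
    have e2 : s''.reg i = s'.reg i := hF'.reg i hi_body
    simp only [ev_add, ev_reg, ev_ofNat, e2, reg_setReg, if_true]
    refine ⟨by omega, ⟨by omega, by omega, hI⟩, ?_⟩
    obtain ⟨d, hd⟩ : ∃ d, h - s'.reg i = d + 1 := ⟨h - s'.reg i - 1, by omega⟩
    have : h - (s'.reg i + 1) = d := by omega
    rw [this, hd]
    simp only [cost_bin, cost_add, cost_reg, cost_ofNat]
    linarith
  · rintro s' t hF hB' ⟨h1, h2, h3⟩ he ht
    have e1 := hhi s' (hF0 hF)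
    simp only [ev_lt, ev_reg, e1, ite_eq_right_iff, one_ne_zero, imp_false, not_lt] at he
    have e3 : s'.reg i = h := le_antisymm h2 he
    refine hQ s' _ ?_ e3 (hF0 hF) hB' (e3 ▸ h3)
    simp only [reg_setReg, if_true, cost_bin, cost_reg] at ht
    omega

/-! ### Radix sort -/

/-! Registers and arrays are referred to by names, which begin with `r` and `a`. Registers `0` to `3`
and arrays `0` to `3` serve for input and output. -/

notation "aKey" => (10 : ℕ)
notation "aOrd" => (11 : ℕ)
notation "aCnt" => (12 : ℕ)
notation "aTmp" => (13 : ℕ)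
notation "rM" => (20 : ℕ)
notation "rU" => (21 : ℕ)
notation "rPw" => (22 : ℕ)
notation "rMx" => (23 : ℕ)
notation "rQ" => (24 : ℕ)
notation "rX" => (25 : ℕ)
notation "rD" => (26 : ℕ)

/-- `o` lists the numbers below `M` by nondecreasing key `K`. -/
structure SortedBy (M : ℕ) (K o : ℕ → ℕ) : Prop where
  lt : ∀ q < M, o q < M
  inj : ∀ p < M, ∀ q < M, o p = o q → p = q
  mono : ∀ p q, p < q → q < M → K (o p) ≤ K (o q)

/-- The place of position `q` in the stable sort of the first `M` positions by `a`. -/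
def stablePos (M : ℕ) (a : ℕ → ℕ) (q : ℕ) : ℕ :=
  Nat.count (fun x => a x < a q) M + Nat.count (fun x => a x = a q) q

theorem count_lt_succ (a : ℕ → ℕ) (v M : ℕ) :
    Nat.count (fun x => a x < v + 1) M =
      Nat.count (fun x => a x < v) M + Nat.count (fun x => a x = v) M := by
  induction M with
  | zero => simp
  | succ M ih =>
    simp only [Nat.count_succ, ih]
    rcases lt_trichotomy (a M) v with h | h | h
    · simp [h, h.ne, show a M < v + 1 by omega]; omega
    · simp [h]; omega
    · simp [show ¬ a M < v + 1 by omega, show ¬ a M < v by omega, h.ne']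

theorem count_lt_mono (a : ℕ → ℕ) {v v' : ℕ} (h : v ≤ v') (M : ℕ) :
    Nat.count (fun x => a x < v) M ≤ Nat.count (fun x => a x < v') M :=
  Nat.count_mono_left (fun _ _ hx => lt_of_lt_of_le hx h)

/-- The items of one digit occupy consecutive places. -/
theorem stablePos_lt_count (M : ℕ) (a : ℕ → ℕ) {q : ℕ} (hq : q < M) :
    stablePos M a q < Nat.count (fun x => a x < a q + 1) M := by
  rw [count_lt_succ, stablePos]
  have h := Nat.count_monotone (fun x => a x = a q) (Nat.succ_le_of_lt hq)
  rw [Nat.succ_eq_add_one, Nat.count_succ] at h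
  simp at h
  omega

theorem stablePos_lt (M : ℕ) (a : ℕ → ℕ) {q : ℕ} (hq : q < M) : stablePos M a q < M :=
  (stablePos_lt_count M a hq).trans_le (Nat.count_le _)

theorem stablePos_lt_stablePos (M : ℕ) (a : ℕ → ℕ) {p q : ℕ} (hp : p < M)
    (h : a p < a q ∨ a p = a q ∧ p < q) : stablePos M a p < stablePos M a q := by
  rcases h with h | ⟨h, hpq⟩
  · refine (stablePos_lt_count M a hp).trans_le ((count_lt_mono a h M).trans ?_)
    exact Nat.le_add_right _ _
  · have h' := Nat.count_monotone (fun x => a x = a q) (Nat.succ_le_of_lt hpq)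
    rw [Nat.succ_eq_add_one, Nat.count_succ] at h'
    simp only [h, if_true] at h'
    simp only [stablePos, h]
    omega

theorem stablePos_inj (M : ℕ) (a : ℕ → ℕ) {p q : ℕ} (hp : p < M) (hq : q < M)
    (h : stablePos M a p = stablePos M a q) : p = q := by
  by_contra hne
  rcases lt_trichotomy (a p) (a q) with h1 | h1 | h1
  · exact (stablePos_lt_stablePos M a hp (.inl h1)).ne h
  · rcases Nat.lt_or_gt_of_ne hne with h2 | h2
    · exact (stablePos_lt_stablePos M a hp (.inr ⟨h1, h2⟩)).ne h
    · exact (stablePos_lt_stablePos M a hq (.inr ⟨h1.symm, h2⟩)).ne' h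
  · exact (stablePos_lt_stablePos M a hq (.inl h1)).ne' h

theorem exists_eq_of_inj {M : ℕ} {f : ℕ → ℕ} (hf : ∀ q < M, f q < M)
    (hinj : ∀ p < M, ∀ q < M, f p = f q → p = q) {y : ℕ} (hy : y < M) : ∃ q < M, f q = y := by
  have h := Finset.surj_on_of_inj_on_of_card_le (s := Finset.range M) (t := Finset.range M)
    (fun q _ => f q) (fun q hq => by simpa using hf q (by simpa using hq))
    (fun p q hp hq e => hinj p (by simpa using hp) q (by simpa using hq) e) le_rfl y
    (by simpa using hy)
  obtain ⟨q, hq, e⟩ := h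
  exact ⟨q, by simpa using hq, e.symm⟩

/-- A stable pass by the digit `d` refines an order by `K` to one by any `K'` in which `d` counts
first and `K` second. -/
theorem SortedBy.stable {M : ℕ} {K K' d o o' : ℕ → ℕ} (h : SortedBy M K o)
    (ho' : ∀ q < M, o' (stablePos M (fun x => d (o x)) q) = o q)
    (hK : ∀ x y, d x < d y → K' x ≤ K' y) (hK' : ∀ x y, d x = d y → K x ≤ K y → K' x ≤ K' y) :
    SortedBy M K' o' := by
  set a : ℕ → ℕ := fun x => d (o x) with ha
  have surj : ∀ p < M, ∃ q < M, stablePos M a q = p := fun p hp =>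
    exists_eq_of_inj (fun q hq => stablePos_lt M a hq)
      (fun p hp q hq e => stablePos_inj M a hp hq e) hp
  refine ⟨fun p hp => ?_, fun p hp p' hp' e => ?_, fun p p' hpp hp' => ?_⟩
  · obtain ⟨q, hq, rfl⟩ := surj p hp
    rw [ho' q hq]; exact h.lt q hq
  · obtain ⟨q, hq, rfl⟩ := surj p hp
    obtain ⟨q', hq', rfl⟩ := surj p' hp'
    rw [ho' q hq, ho' q' hq'] at e
    rw [h.inj q hq q' hq' e]
  · obtain ⟨q, hq, rfl⟩ := surj p (hpp.trans hp')
    obtain ⟨q', hq', rfl⟩ := surj p' hp'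
    rw [ho' q hq, ho' q' hq']
    rcases lt_trichotomy (a q) (a q') with h1 | h1 | h1
    · exact hK _ _ h1
    · rcases lt_trichotomy q q' with h2 | h2 | h2
      · exact hK' _ _ h1 (h.mono q q' h2 hq')
      · subst h2; exact absurd hpp (lt_irrefl _)
      · exact absurd (stablePos_lt_stablePos M a hq' (.inr ⟨h1.symm, h2⟩)) (by omega)
    · exact absurd (stablePos_lt_stablePos M a hq' (.inl h1)) (by omega)

/-- One stable counting pass over the items in `aOrd`, by the digit of their keys of weight `rPw` in
base `rU`. -/
def countingPass : Program :=
  forLoop rQ 0 (rg rU + 1) (.store aCnt (rg rQ) 0) ;;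
  forLoop rQ 0 (rg rM)
    (rD ≔ ld aKey (ld aOrd (rg rQ)) / rg rPw % rg rU + 1 ;;
      .store aCnt (rg rD) (ld aCnt (rg rD) + 1)) ;;
  forLoop rQ 0 (rg rU) (.store aCnt (rg rQ + 1) (ld aCnt (rg rQ + 1) + ld aCnt (rg rQ))) ;;
  forLoop rQ 0 (rg rM)
    (rX ≔ ld aOrd (rg rQ) ;;
      rD ≔ ld aKey (rg rX) / rg rPw % rg rU ;;
      .store aTmp (ld aCnt (rg rD)) (rg rX) ;;
      .store aCnt (rg rD) (ld aCnt (rg rD) + 1)) ;;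
  forLoop rQ 0 (rg rM) (.store aOrd (rg rQ) (ld aTmp (rg rQ)))

/-- A pass replaces the order by the keys modulo `p` by the one modulo `p * U`. -/
theorem countingPass_spec {B M U p : ℕ} {K : ℕ → ℕ} {s : State} (hB : Bdd B s)
    (hM : s.reg rM = M) (hU : s.reg rU = U) (hp : s.reg rPw = p) (hK : s.mem aKey = K)
    (hMB : M + 1 < B) (hUB : U + 1 < B) (hU0 : 0 < U)
    (hs : SortedBy M (fun x => K x % p) (s.mem aOrd)) :
    wp B countingPass s fun s' t => t ≤ 200 * (M + U) + 200 ∧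
      SortedBy M (fun x => K x % (p * U)) (s'.mem aOrd) := by
  set o := s.mem aOrd with ho
  set a : ℕ → ℕ := fun x => K (o x) / p % U with ha
  have haU : ∀ x, a x < U := fun x => Nat.mod_lt _ hU0
  rw [countingPass, wp_seq]
  -- the counters are cleared
  refine wp_for 0 (U + 1) 10 (fun q s' => ∀ u < q, s'.mem aCnt u = 0) hB (by decide) hUB
    (by simp) (by omega) (fun s' hF => by simp [hF.reg rU (by decide), hU]) (by simp) ?_ ?_
  · intro q s' _ hq hi hF hB' hI
    simp [hi]
    refine ⟨by omega, fun u hu => ?_⟩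
    rw [Function.update_apply]
    split_ifs with h
    · rfl
    · exact hI u (by omega)
  intro s1 t1 ht1 _ hF1 hB1 hI1
  have hM1 : s1.reg rM = M := by rw [hF1.reg _ (by decide), hM]
  have hU1 : s1.reg rU = U := by rw [hF1.reg _ (by decide), hU]
  have hp1 : s1.reg rPw = p := by rw [hF1.reg _ (by decide), hp]
  have hK1 : s1.mem aKey = K := by rw [hF1.mem _ (by decide), hK]
  have ho1 : s1.mem aOrd = o := by rw [hF1.mem _ (by decide)]
  clear_value o
  rw [wp_seq]
  -- `aCnt[u + 1]` becomes the number of items with digit `u`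
  refine wp_for 0 M 30 (fun q s' => ∀ u ≤ U, s'.mem aCnt u =
      if u = 0 then 0 else Nat.count (fun x => a x = u - 1) q) hB1 (by decide) (by omega)
    (by simp) (by omega) (fun s' hF => by simp [hF.reg rM (by decide), hM1]) ?_ ?_ ?_
  · intro u hu
    simpa using hI1 u (by omega)
  · intro q s' _ hq hi hF hB' hI
    have e1 : s'.mem aKey = K := by rw [hF.mem _ (by decide), hK1]
    have e2 : s'.mem aOrd = o := by rw [hF.mem _ (by decide), ho1]
    have e3 : s'.reg rPw = p := by rw [hF.reg _ (by decide), hp1]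
    have e4 : s'.reg rU = U := by rw [hF.reg _ (by decide), hU1]
    have hq' := haU q
    have e5 : K (o q) / p % U = a q := rfl
    have e6 := hI (a q + 1) (by omega)
    have := Nat.count_le (p := fun x => a x = a q) (n := q)
    simp [hi, e1, e2, e3, e4, e5] at e6 ⊢
    refine ⟨by omega, by omega, fun u hu => ?_⟩
    rw [Function.update_apply]
    split_ifs with h h' h'
    · omega
    · subst h
      simp [Nat.count_succ, e6]
    · simpa [h'] using hI u hu
    · rw [hI u hu, if_neg h', Nat.count_succ, if_neg (by omega)]; rfl
  intro s2 t2 ht2 _ hF2 hB2 hI2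
  have hM2 : s2.reg rM = M := by rw [hF2.reg _ (by decide), hM1]
  have hU2 : s2.reg rU = U := by rw [hF2.reg _ (by decide), hU1]
  have hp2 : s2.reg rPw = p := by rw [hF2.reg _ (by decide), hp1]
  have hK2 : s2.mem aKey = K := by rw [hF2.mem _ (by decide), hK1]
  have ho2 : s2.mem aOrd = o := by rw [hF2.mem _ (by decide), ho1]
  rw [wp_seq]
  -- `aCnt[u]` becomes the number of items with a digit less than `u`
  refine wp_for 0 U 30 (fun q s' => ∀ u ≤ U, s'.mem aCnt u =
      if u ≤ q then Nat.count (fun x => a x < u) M else Nat.count (fun x => a x = u - 1) M)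
    hB2 (by decide) (by omega) (by simp) (by omega)
    (fun s' hF => by simp [hF.reg rU (by decide), hU2]) ?_ ?_ ?_
  · intro u hu
    have h := hI2 u hu
    rcases u with _ | u
    · simpa using h
    · simpa using h
  · intro q s' _ hq hi hF hB' hI
    have h1 := hI q (by omega)
    have h2 := hI (q + 1) (by omega)
    have h3 := count_lt_succ a q M
    have h4 := Nat.count_le (p := fun x => a x < q + 1) (n := M)
    simp at h1 h2
    simp [hi]
    refine ⟨by omega, fun u hu => ?_⟩
    rw [Function.update_apply]
    split_ifs with h h' h'
    · subst h; omega
    · omega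
    · rw [hI u hu, if_pos (by omega)]
    · rw [hI u hu, if_neg (by omega)]
  intro s3 t3 ht3 _ hF3 hB3 hI3
  have hM3 : s3.reg rM = M := by rw [hF3.reg _ (by decide), hM2]
  have hU3 : s3.reg rU = U := by rw [hF3.reg _ (by decide), hU2]
  have hp3 : s3.reg rPw = p := by rw [hF3.reg _ (by decide), hp2]
  have hK3 : s3.mem aKey = K := by rw [hF3.mem _ (by decide), hK2]
  have ho3 : s3.mem aOrd = o := by rw [hF3.mem _ (by decide), ho2]
  rw [wp_seq]
  -- the items are moved to their places, and `aCnt[u]` is the next free place for digit `u`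
  refine wp_for 0 M 50 (fun q s' =>
      (∀ u < U, s'.mem aCnt u = Nat.count (fun x => a x < u) M + Nat.count (fun x => a x = u) q) ∧
      ∀ q' < q, s'.mem aTmp (stablePos M a q') = o q')
    hB3 (by decide) (by omega) (by simp) (by omega)
    (fun s' hF => by simp [hF.reg rM (by decide), hM3]) ?_ ?_ ?_
  · refine ⟨fun u hu => ?_, by simp⟩
    simpa [hu.le] using hI3 u hu.le
  · rintro q s' - hq hi hF hB' ⟨hI, hI'⟩
    have e1 : s'.mem aKey = K := by rw [hF.mem _ (by decide), hK3]
    have e2 : s'.mem aOrd = o := by rw [hF.mem _ (by decide), ho3]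
    have e3 : s'.reg rPw = p := by rw [hF.reg _ (by decide), hp3]
    have e4 : s'.reg rU = U := by rw [hF.reg _ (by decide), hU3]
    have hq' := haU q
    have e5 : K (o q) / p % U = a q := rfl
    have e6 : s'.mem aCnt (a q) = stablePos M a q := hI _ (haU q)
    have e7 := stablePos_lt M a hq
    have e8 := hs.lt q hq
    simp [hi, e1, e2, e3, e4, e5, e6]
    refine ⟨by omega, by omega, by omega, by omega, fun u hu => ?_, fun q' hqq => ?_⟩
    · rw [Function.update_apply, Nat.count_succ]
      split_ifs with h h' h'
      · subst h; rw [stablePos]; rfl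
      · omega
      · omega
      · exact hI u hu
    · rw [Function.update_apply]
      split_ifs with h
      · rw [stablePos_inj M a (by omega) hq h]
      · refine hI' q' (lt_of_le_of_ne (by omega) fun hc => h (by rw [hc]))
  intro s4 t4 ht4 _ hF4 hB4 hI4
  have hM4 : s4.reg rM = M := by rw [hF4.reg _ (by decide), hM3]
  have ho4 : s4.mem aOrd = o := by rw [hF4.mem _ (by decide), ho3]
  refine wp_for 0 M 10 (fun q s' => ∀ q' < q, s'.mem aOrd q' = s4.mem aTmp q')
    hB4 (by decide) (by omega) (by simp) (by omega)
    (fun s' hF => by simp [hF.reg rM (by decide), hM4]) (by simp) ?_ ?_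
  · rintro q s' - hq hi hF hB' hI
    have e1 : s'.mem aTmp = s4.mem aTmp := by rw [hF.mem _ (by decide)]
    simp [hi, e1]
    refine ⟨hB4.2 _ _, fun q' hq' => ?_⟩
    rw [Function.update_apply]
    split_ifs with h
    · rw [h]
    · exact hI q' (by omega)
  intro s5 t5 ht5 _ hF5 hB5 hI5
  simp at ht1 ht2 ht3 ht4 ht5
  refine ⟨by omega, ?_⟩
  have key : SortedBy M (fun x => K x % (p * U)) (s4.mem aTmp) := by
    refine hs.stable (d := fun x => K x / p % U) hI4.2 (fun x y h => ?_) (fun x y h h' => ?_)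
    · simp only [Nat.mod_mul]
      rcases Nat.eq_zero_or_pos p with rfl | hp0
      · simp at h
      have h1 := Nat.mod_lt (K x) hp0
      have h2 : p * (K x / p % U + 1) ≤ p * (K y / p % U) := Nat.mul_le_mul_left p h
      rw [mul_add] at h2
      omega
    · simp only [Nat.mod_mul]
      rw [h]; exact Nat.add_le_add_right h' _
  exact ⟨fun q hq => by rw [hI5 q hq]; exact key.lt q hq,
    fun p hp q hq e => key.inj p hp q hq (by rw [← hI5 p hp, ← hI5 q hq, e]),
    fun p q hpq hq => by rw [hI5 q hq, hI5 p (by omega)]; exact key.mono p q hpq hq⟩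

/-- Sorts the items `0, …, M - 1` by their keys in `aKey`, with digits in base `rU`. -/
def radixSort : Program :=
  forLoop rQ 0 (rg rM) (.store aOrd (rg rQ) (rg rQ)) ;;
  rMx ≔ 0 ;;
  forLoop rQ 0 (rg rM) (ifThen (rg rMx <! ld aKey (rg rQ)) (rMx ≔ ld aKey (rg rQ))) ;;
  rPw ≔ 1 ;;
  .loop (rg rPw <! rg rMx + 1) (countingPass ;; rPw ≔ rg rPw * rg rU)

/-- Keys below `U ^ c` are sorted in at most `c` passes. -/
theorem radixSort_spec {B M U X c : ℕ} {K : ℕ → ℕ} {s : State} (hB : Bdd B s)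
    (hM : s.reg rM = M) (hU : s.reg rU = U) (hK : s.mem aKey = K)
    (hMB : M + 1 < B) (hUB : U + 1 < B) (hU0 : 2 ≤ U) (hX : ∀ q < M, K q < X) (hX0 : 0 < X)
    (hXB : X * U < B) (hXc : X ≤ U ^ c) :
    wp B radixSort s fun s' t => t ≤ (300 * (M + U) + 300) * (c + 1) ∧
      SortedBy M K (s'.mem aOrd) := by
  have hXB' : X < B := lt_of_le_of_lt (Nat.le_mul_of_pos_right X (by omega)) hXB
  rw [radixSort, wp_seq]
  refine wp_for 0 M 10 (fun q s' => ∀ u < q, s'.mem aOrd u = u) hB (by decide) (by omega)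
    (by simp) (by omega) (fun s' hF => by simp [hF.reg rM (by decide), hM]) (by simp) ?_ ?_
  · intro q s' _ hq hi hF hB' hI
    simp [hi]
    refine ⟨by omega, fun u hu => ?_⟩
    rw [Function.update_apply]
    split_ifs with h
    · exact h.symm
    · exact hI u (by omega)
  intro s1 t1 ht1 _ hF1 hB1 hI1
  have hM1 : s1.reg rM = M := by rw [hF1.reg _ (by decide), hM]
  have hU1 : s1.reg rU = U := by rw [hF1.reg _ (by decide), hU]
  have hK1 : s1.mem aKey = K := by rw [hF1.mem _ (by decide), hK]
  rw [wp_seq, wp_assign]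
  refine ⟨by simp; omega, ?_⟩
  rw [wp_seq]
  refine wp_for 0 M 20 (fun q s' => (∀ u < q, K u ≤ s'.reg rMx) ∧ s'.reg rMx < X)
    (hB1.setReg (by simp; omega)) (by decide) (by omega)
    (by simp) (by omega) (fun s' hF => by simp [hF.reg rM (by decide), hM1]) (by simpa) ?_ ?_
  · rintro q s' - hq hi hF hB' ⟨hI, hI'⟩
    have e1 : s'.mem aKey = K := by rw [hF.mem _ (by decide)]; simp [hK1]
    have hq' := hX q hq
    simp [hi, e1]
    refine ⟨fun h => ⟨by omega, fun u hu => ?_, hq'⟩, fun h => ⟨fun u hu => ?_, hI'⟩⟩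
    · rcases hu.lt_or_eq with h1 | rfl
      · exact (hI u h1).trans h.le
      · exact le_rfl
    · rcases hu.lt_or_eq with h1 | rfl
      · exact hI u h1
      · exact h
  intro s2 t2 ht2 _ hF2 hB2 hI2
  have hM2 : s2.reg rM = M := by rw [hF2.reg _ (by decide)]; simp [hM1]
  have hU2 : s2.reg rU = U := by rw [hF2.reg _ (by decide)]; simp [hU1]
  have hK2 : s2.mem aKey = K := by rw [hF2.mem _ (by decide)]; simp [hK1]
  have ho2 : ∀ u < M, s2.mem aOrd u = u := by
    rw [hF2.mem _ (by decide)]; simpa using hI1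
  obtain ⟨hI2, hI2'⟩ := hI2
  rw [wp_seq, wp_assign]
  refine ⟨by simp; omega, ?_⟩
  refine wp_while (fun s' => ∃ i, s'.reg rPw = U ^ i ∧
      SortedBy M (fun x => K x % U ^ i) (s'.mem aOrd))
    (fun s' => (200 * (M + U) + 220) * (c - Nat.log U (s'.reg rPw)))
    (hB2.setReg (by simp; omega)) ⟨0, by simp, ?_⟩ ?_ ?_
  · simp only [pow_zero, Nat.mod_one, mem_setReg]
    exact ⟨fun q hq => by rw [ho2 q hq]; exact hq,
      fun p hp q hq e => by rwa [ho2 p hp, ho2 q hq] at e, fun _ _ _ _ => le_rfl⟩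
  · rintro s3 hF3 hB3 ⟨i, hi, hI⟩ hne
    have hM3 : s3.reg rM = M := by rw [hF3.reg _ (by decide)]; simp [hM2]
    have hU3 : s3.reg rU = U := by rw [hF3.reg _ (by decide)]; simp [hU2]
    have hK3 : s3.mem aKey = K := by rw [hF3.mem _ (by decide)]; simp [hK2]
    have hMx3 : s3.reg rMx = s2.reg rMx := by rw [hF3.reg _ (by decide)]; simp
    have hlt : U ^ i < s2.reg rMx + 1 := by
      by_contra hc; simp [hi, hMx3, hc] at hne
    have hic : i < c := (Nat.pow_lt_pow_iff_right (by omega)).1 (by omega : U ^ i < U ^ c)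
    rw [wp_seq]
    refine (countingPass_spec hB3 hM3 hU3 hi hK3 hMB hUB (by omega) hI).call hB3 ?_
    rintro s4 t4 hF4 hB4 ⟨ht4, h4⟩
    have e1 : s4.reg rPw = U ^ i := by rw [hF4.reg _ (by decide), hi]
    have e2 : s4.reg rU = U := by rw [hF4.reg _ (by decide), hU3]
    have e3 : U ^ i * U ≤ X * U := Nat.mul_le_mul_right U (by omega)
    simp [e1, e2]
    refine ⟨by omega, ⟨i + 1, (pow_succ _ _).symm, by rw [pow_succ]; exact h4⟩, ?_⟩
    rw [← pow_succ, Nat.log_pow (by omega), hi, Nat.log_pow (by omega)]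
    obtain ⟨d, hd⟩ : ∃ d, c - i = d + 1 := ⟨c - i - 1, by omega⟩
    have : c - (i + 1) = d := by omega
    rw [this, hd]
    linarith
  · rintro s3 t3 hF3 hB3 ⟨i, hi, hI⟩ he ht3
    have hMx3 : s3.reg rMx = s2.reg rMx := by rw [hF3.reg _ (by decide)]; simp
    have hlt : s2.reg rMx + 1 ≤ U ^ i := by
      by_contra hc; simp [hi, hMx3] at he; omega
    have hmod : ∀ q < M, K q % U ^ i = K q := fun q hq =>
      Nat.mod_eq_of_lt (by have := hI2 q hq; omega)
    simp at ht1 ht2 ht3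
    refine ⟨?_, hI.lt, hI.inj, fun p q hpq hq => ?_⟩
    · simp
      have h1 : t3 ≤ (200 * (M + U) + 220) * c + 6 := by omega
      have h2 := Nat.mul_le_mul_right c
        (by omega : 200 * (M + U) + 220 ≤ 300 * (M + U) + 300)
      rw [mul_add_one]
      omega
    · have h := hI.mono p q hpq hq
      rwa [hmod _ (hI.lt q hq), hmod _ (hI.lt p (by omega))] at h

/-! ### Order of suffixes -/

/-- Pairs with second entry below `Y` compare lexicographically as the numbers with these digits. -/
theorem lex_lt_iff {Y a a' b b' : ℕ} (hb : b < Y) (hb' : b' < Y) :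
    a * Y + b < a' * Y + b' ↔ a < a' ∨ a = a' ∧ b < b' := by
  constructor
  · intro h
    rcases lt_trichotomy a a' with h1 | h1 | h1
    · exact .inl h1
    · subst h1; exact .inr ⟨rfl, by omega⟩
    · have := Nat.mul_le_mul_right Y (Nat.succ_le_of_lt h1)
      rw [Nat.succ_mul] at this
      omega
  · rintro (h | ⟨rfl, h⟩)
    · have := Nat.mul_le_mul_right Y (Nat.succ_le_of_lt h)
      rw [Nat.succ_mul] at this
      omega
    · omega

theorem lex_eq_iff {Y a a' b b' : ℕ} (hb : b < Y) (hb' : b' < Y) :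
    a * Y + b = a' * Y + b' ↔ a = a' ∧ b = b' := by
  have h1 := lex_lt_iff (a := a) (a' := a') hb hb'
  have h2 := lex_lt_iff (a := a') (a' := a) hb' hb
  constructor
  · intro h
    have h3 := mt h1.2 (by omega)
    have h4 := mt h2.2 (by omega)
    push Not at h3 h4
    have h5 : a = a' := by omega
    exact ⟨h5, le_antisymm (h4.2 h5.symm) (h3.2 h5)⟩
  · rintro ⟨rfl, rfl⟩; rfl

/-- The letters `S p, …, S (p + l - 1)` read as a number in base `X`. -/
def blockVal (S : ℕ → ℕ) (X p : ℕ) : ℕ → ℕ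
  | 0 => 0
  | l + 1 => blockVal S X p l * X + S (p + l)

theorem blockVal_add (S : ℕ → ℕ) (X p a b : ℕ) :
    blockVal S X p (a + b) = blockVal S X p a * X ^ b + blockVal S X (p + a) b := by
  induction b with
  | zero => simp [blockVal]
  | succ b ih => rw [← add_assoc, blockVal, ih, blockVal, pow_succ, add_assoc]; ring

/-- `S` is a string of `N` positive letters below `X`, padded with zeros. -/
structure IsPadded (N X : ℕ) (S : ℕ → ℕ) : Prop where
  pos : ∀ i < N, 0 < S i
  zero : ∀ i, N ≤ i → S i = 0
  lt : ∀ i, S i < X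

/-- A number that represents the suffix starting at `p`: suffixes compare lexicographically as
these numbers do. -/
def sufVal (N X : ℕ) (S : ℕ → ℕ) (p : ℕ) : ℕ := blockVal S X p N

section
variable {N X : ℕ} {S : ℕ → ℕ}

theorem IsPadded.blockVal_lt (h : IsPadded N X S) (p l : ℕ) : blockVal S X p l < X ^ l := by
  induction l with
  | zero => simp [blockVal]
  | succ l ih =>
    have h1 := h.lt (p + l)
    have h2 := Nat.mul_le_mul_right X (Nat.succ_le_of_lt ih)
    rw [Nat.succ_mul] at h2
    rw [blockVal, pow_succ]
    omega

theorem IsPadded.blockVal_eq_iff (h : IsPadded N X S) (p q l : ℕ) :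
    blockVal S X p l = blockVal S X q l ↔ ∀ t < l, S (p + t) = S (q + t) := by
  induction l with
  | zero => simp [blockVal]
  | succ l ih =>
    rw [blockVal, blockVal, lex_eq_iff (h.lt _) (h.lt _), ih, Nat.forall_lt_succ_right]

theorem IsPadded.blockVal_eq_zero (h : IsPadded N X S) {p : ℕ} (hp : N ≤ p) (l : ℕ) :
    blockVal S X p l = 0 := by
  induction l with
  | zero => rfl
  | succ l ih => rw [blockVal, ih, h.zero _ (by omega)]; simp

theorem IsPadded.blockVal_pos (h : IsPadded N X S) {p l : ℕ} (hp : p < N) (hl : 0 < l) :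
    0 < blockVal S X p l := by
  obtain ⟨l, rfl⟩ : ∃ k, l = 1 + k := ⟨l - 1, by omega⟩
  have h1 := h.pos p hp
  have h2 : 0 < X ^ l := Nat.pow_pos (by have := h.lt p; omega)
  rw [blockVal_add]
  have : blockVal S X p 1 = S p := by simp [blockVal]
  rw [this]
  have := Nat.mul_pos h1 h2
  omega

/-- Two suffixes compare by their blocks of length `a`, then by what follows. -/
theorem IsPadded.sufVal_lt_iff (h : IsPadded N X S) (a p q : ℕ) :
    sufVal N X S p < sufVal N X S q ↔ blockVal S X p a < blockVal S X q a ∨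
      blockVal S X p a = blockVal S X q a ∧ sufVal N X S (p + a) < sufVal N X S (q + a) := by
  have key : ∀ p, sufVal N X S p * X ^ a = blockVal S X p a * X ^ N + sufVal N X S (p + a) := by
    intro p
    have h1 := blockVal_add S X p N a
    rw [h.blockVal_eq_zero (p := p + N) (by omega), add_zero, add_comm N a, blockVal_add] at h1
    exact h1.symm
  have hX : 0 < X ^ a := Nat.pow_pos (by have := h.lt 0; omega)
  rw [← Nat.mul_lt_mul_right hX, key, key]
  exact lex_lt_iff (h.blockVal_lt _ _) (h.blockVal_lt _ _)

theorem IsPadded.sufVal_inj (h : IsPadded N X S) {p q : ℕ} (hp : p < N) (hq : q < N)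
    (e : sufVal N X S p = sufVal N X S q) : p = q := by
  have key : ∀ p q, p < q → q < N → sufVal N X S p ≠ sufVal N X S q := by
    intro p q hpq hq e
    have h1 := (h.blockVal_eq_iff p q N).1 e (N - q) (by omega)
    rw [h.zero (q + (N - q)) (by omega)] at h1
    have h2 := h.pos (p + (N - q)) (by omega)
    omega
  rcases lt_trichotomy p q with h1 | h1 | h1
  · exact absurd e (key p q h1 hq)
  · exact h1
  · exact absurd e.symm (key q p h1 hp)

theorem IsPadded.blockVal_le (h : IsPadded N X S) {p q : ℕ}
    (e : sufVal N X S p ≤ sufVal N X S q) (l : ℕ) : blockVal S X p l ≤ blockVal S X q l := by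
  by_contra hc
  exact absurd ((h.sufVal_lt_iff l q p).2 (.inl (by omega))) (by omega)

theorem IsPadded.sufVal_pos (h : IsPadded N X S) {p : ℕ} (hp : p < N) : 0 < sufVal N X S p :=
  h.blockVal_pos hp (by omega)

theorem IsPadded.sufVal_eq_zero (h : IsPadded N X S) {p : ℕ} (hp : N ≤ p) :
    sufVal N X S p = 0 :=
  h.blockVal_eq_zero hp _

end

/-! ### Samples of positions -/

/-- Position `p` belongs to the sample of level `l`: none of the `l` lowest ternary digits of `p`
vanishes. -/
def Good (l p : ℕ) : Prop := ∀ d < l, p / 3 ^ d % 3 ≠ 0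

theorem good_succ {l p : ℕ} : Good (l + 1) p ↔ Good l p ∧ p / 3 ^ l % 3 ≠ 0 :=
  Nat.forall_lt_succ_right

theorem good_add {l p : ℕ} : Good l (p + 3 ^ l) ↔ Good l p := by
  have key : ∀ d < l, (p + 3 ^ l) / 3 ^ d % 3 = p / 3 ^ d % 3 := by
    intro d hd
    obtain ⟨e, rfl⟩ : ∃ e, l = d + (e + 1) := ⟨l - d - 1, by omega⟩
    rw [pow_add, Nat.add_mul_div_left _ _ (by positivity), pow_succ]
    omega
  exact forall₂_congr fun d hd => by rw [key d hd]

theorem good_add_mul {l p : ℕ} (k : ℕ) : Good l (p + k * 3 ^ l) ↔ Good l p := by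
  induction k with
  | zero => simp
  | succ k ih => rw [Nat.succ_mul, ← add_assoc, good_add, ih]

/-- Elements of the sample of level `l` are at least `(3 ^ l - 1) / 2`, the number all of whose `l`
digits are `1`; hence logarithmically many levels are nonempty. -/
theorem Good.pow_le {l p : ℕ} (h : Good l p) : 3 ^ l ≤ 2 * p + 1 := by
  suffices H : 3 ^ l ≤ 2 * (p % 3 ^ l) + 1 from H.trans (by have := Nat.mod_le p (3 ^ l); omega)
  induction l with
  | zero => simp
  | succ l ih =>
    rw [good_succ] at h
    have h1 := ih h.1
    rw [pow_succ, Nat.mod_mul]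
    have h2 : 3 ^ l * 1 ≤ 3 ^ l * (p / 3 ^ l % 3) := Nat.mul_le_mul_left _ (by omega)
    omega

/-- The positions of level `l` of a string of length `N`. -/
def Sample (N l p : ℕ) : Prop := p < N ∧ Good l p

theorem Sample.succ_iff {N l p : ℕ} :
    Sample N (l + 1) p ↔ Sample N l p ∧ p / 3 ^ l % 3 ≠ 0 := by
  simp only [Sample, good_succ, and_assoc]

theorem sample_finite (N l : ℕ) (D : ℕ → Prop) : {p | Sample N l p ∧ D p}.Finite :=
  (Set.finite_lt_nat N).subset fun _ hp => hp.1.1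

theorem sample_split (N l : ℕ) :
    {p | Sample N l p ∧ p / 3 ^ l % 3 = 0}.ncard + {p | Sample N (l + 1) p}.ncard =
      {p | Sample N l p}.ncard := by
  have hfin : {p | Sample N (l + 1) p}.Finite :=
    (sample_finite N (l + 1) fun _ => True).subset fun p hp => ⟨hp, trivial⟩
  have hdisj : Disjoint {p | Sample N l p ∧ p / 3 ^ l % 3 = 0} {p | Sample N (l + 1) p} := by
    rw [Set.disjoint_left]
    rintro p ⟨_, h⟩ h'
    exact (Sample.succ_iff.1 h').2 h
  rw [← Set.ncard_union_eq hdisj (sample_finite N l _) hfin]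
  congr 1
  ext p
  simp only [Set.mem_union, Set.mem_ofPred_eq, Sample.succ_iff]
  tauto

/-- Passing to the next level drops at least a third of the sample, since subtracting `3 ^ l`
injects each class of the lowest remaining digit into the class below. -/
theorem sample_succ_le (N l : ℕ) :
    3 * {p | Sample N (l + 1) p}.ncard ≤ 2 * {p | Sample N l p}.ncard := by
  set C : ℕ → Set ℕ := fun c => {p | Sample N l p ∧ p / 3 ^ l % 3 = c} with hC
  have hfin : ∀ c, (C c).Finite := fun c => sample_finite N l _
  have step : ∀ c, c < 2 → (C (c + 1)).ncard ≤ (C c).ncard := by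
    intro c hc
    have hpos : 0 < 3 ^ l := by positivity
    have hle : ∀ p ∈ C (c + 1), 3 ^ l ≤ p := by
      rintro p ⟨_, h⟩
      by_contra hlt
      rw [Nat.div_eq_of_lt (by omega)] at h
      simp at h
    refine Set.ncard_le_ncard_of_injOn (fun p => p - 3 ^ l) ?_ ?_ (hfin c)
    · intro p hp
      have h1 := hle p hp
      obtain ⟨⟨hp1, hp2⟩, hp3⟩ := hp
      obtain ⟨q, rfl⟩ : ∃ q, p = q + 3 ^ l := ⟨p - 3 ^ l, by omega⟩
      rw [good_add] at hp2
      rw [Nat.add_div_right _ hpos] at hp3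
      simp only [Nat.add_sub_cancel]
      exact ⟨⟨by omega, hp2⟩, by omega⟩
    · intro p hp q hq e
      have h1 := hle p hp
      have h2 := hle q hq
      simp only at e
      omega
  have hsplit := sample_split N l
  have h12 : {p | Sample N (l + 1) p}.ncard = (C 1).ncard + (C 2).ncard := by
    rw [← Set.ncard_union_eq _ (hfin 1) (hfin 2)]
    · congr 1
      ext p
      simp only [hC, Set.mem_union, Set.mem_ofPred_eq, Sample.succ_iff, ← and_or_left]
      have : p / 3 ^ l % 3 < 3 := Nat.mod_lt _ (by norm_num)
      exact and_congr_right fun _ => by omega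
    · rw [Set.disjoint_left]
      rintro p ⟨_, h⟩ ⟨_, h'⟩
      omega
  have h1 := step 0 (by norm_num)
  have h2 := step 1 (by norm_num)
  change (C 0).ncard + _ = _ at hsplit
  simp only [zero_add] at h1
  norm_num at h2
  omega

/-- `f 0 < ⋯ < f (M - 1)` are the numbers with property `Q`. -/
structure IncList (M : ℕ) (f : ℕ → ℕ) (Q : ℕ → Prop) : Prop where
  prop : ∀ q < M, Q (f q)
  mono : ∀ p q, p < q → q < M → f p < f q
  surj : ∀ x, Q x → ∃ q < M, f q = x

theorem IncList.inj {M : ℕ} {f : ℕ → ℕ} {Q : ℕ → Prop} (h : IncList M f Q) {p q : ℕ} (hp : p < M)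
    (hq : q < M) (e : f p = f q) : p = q := by
  rcases lt_trichotomy p q with h1 | h1 | h1
  · exact absurd e (h.mono p q h1 hq).ne
  · exact h1
  · exact absurd e (h.mono q p h1 hp).ne'

theorem IncList.ncard {M : ℕ} {f : ℕ → ℕ} {Q : ℕ → Prop} (h : IncList M f Q) :
    {x | Q x}.ncard = M := by
  have : {x | Q x} = f '' Set.Iio M := by
    ext x
    exact ⟨fun hx => h.surj x hx, fun ⟨q, hq, e⟩ => e ▸ h.prop q hq⟩
  have hinj : Set.InjOn f (Set.Iio M) := fun p hp q hq e => h.inj hp hq e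
  rw [this, hinj.ncard_image]
  simp

theorem IncList.nil (f : ℕ → ℕ) {Q : ℕ → Prop} (h : ∀ x, ¬ Q x) : IncList 0 f Q :=
  ⟨by simp, by simp, fun x hx => absurd hx (h x)⟩

theorem IncList.congr {M : ℕ} {f g : ℕ → ℕ} {Q Q' : ℕ → Prop} (h : IncList M f Q)
    (hfg : ∀ q < M, g q = f q) (hQ : ∀ x, Q x ↔ Q' x) : IncList M g Q' :=
  ⟨fun q hq => by rw [hfg q hq, ← hQ]; exact h.prop q hq,
    fun p q hpq hq => by rw [hfg q hq, hfg p (by omega)]; exact h.mono p q hpq hq,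
    fun x hx => by
      obtain ⟨q, hq, e⟩ := h.surj x ((hQ x).2 hx)
      exact ⟨q, hq, by rw [hfg q hq, e]⟩⟩

/-- Filtering an increasing list: the next entry is kept. -/
theorem IncList.push {M z q : ℕ} {f g g' : ℕ → ℕ} {Q D : ℕ → Prop} (hf : IncList M f Q)
    (hq : q < M) (h : IncList z g fun x => D x ∧ ∃ q' < q, f q' = x) (hD : D (f q))
    (hg : ∀ a < z, g' a = g a) (hg' : g' z = f q) :
    IncList (z + 1) g' fun x => D x ∧ ∃ q' < q + 1, f q' = x := by
  refine ⟨fun a ha => ?_, fun a b hab hb => ?_, ?_⟩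
  · rcases Nat.lt_succ_iff_lt_or_eq.1 ha with h1 | rfl
    · rw [hg a h1]
      obtain ⟨h2, q', h3, h4⟩ := h.prop a h1
      exact ⟨h2, q', by omega, h4⟩
    · rw [hg']; exact ⟨hD, q, by omega, rfl⟩
  · rw [hg a (by omega)]
    rcases Nat.lt_succ_iff_lt_or_eq.1 hb with h1 | rfl
    · rw [hg b h1]; exact h.mono a b hab h1
    · obtain ⟨_, q', h3, h4⟩ := h.prop a hab
      rw [hg', ← h4]; exact hf.mono q' q h3 hq
  · rintro x ⟨h1, q', h2, h3⟩
    rcases Nat.lt_succ_iff_lt_or_eq.1 h2 with h4 | rfl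
    · obtain ⟨a, ha, e⟩ := h.surj x ⟨h1, q', h4, h3⟩
      exact ⟨a, by omega, by rw [hg a ha, e]⟩
    · exact ⟨z, by omega, by rw [hg', h3]⟩

/-- Filtering an increasing list: the next entry is dropped. -/
theorem IncList.skip {z q : ℕ} {f g : ℕ → ℕ} {D : ℕ → Prop}
    (h : IncList z g fun x => D x ∧ ∃ q' < q, f q' = x) (hD : ¬ D (f q)) :
    IncList z g fun x => D x ∧ ∃ q' < q + 1, f q' = x := by
  refine h.congr (fun _ _ => rfl) fun x => and_congr_right fun hx => ?_
  refine ⟨fun ⟨q', h1, h2⟩ => ⟨q', by omega, h2⟩, fun ⟨q', h1, h2⟩ => ⟨q', ?_, h2⟩⟩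
  rcases Nat.lt_succ_iff_lt_or_eq.1 h1 with h3 | rfl
  · exact h3
  · exact absurd (h2 ▸ hx) hD

/-- A list filtered to the end contains exactly the entries with property `D`. -/
theorem IncList.filter {M z : ℕ} {f g : ℕ → ℕ} {Q D : ℕ → Prop} (hf : IncList M f Q)
    (h : IncList z g fun x => D x ∧ ∃ q' < M, f q' = x) : IncList z g fun x => Q x ∧ D x := by
  refine h.congr (fun _ _ => rfl) fun x => ⟨?_, ?_⟩
  · rintro ⟨h1, q', h2, rfl⟩
    exact ⟨hf.prop q' h2, h1⟩
  · rintro ⟨h1, h2⟩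
    exact ⟨h2, hf.surj x h1⟩

/-! ### Descending through the levels of samples -/

notation "rLt" => (10 : ℕ)
notation "rLp" => (11 : ℕ)
notation "rN" => (12 : ℕ)
notation "rW" => (13 : ℕ)
notation "rOff" => (14 : ℕ)
notation "rSt" => (15 : ℕ)
notation "rLev" => (16 : ℕ)
notation "rLen" => (17 : ℕ)
notation "rSub" => (18 : ℕ)
notation "rZ" => (27 : ℕ)
notation "rNm" => (28 : ℕ)
notation "rPrev" => (29 : ℕ)
notation "rA" => (30 : ℕ)
notation "rB" => (31 : ℕ)
notation "rY" => (32 : ℕ)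
notation "rI" => (33 : ℕ)
notation "aPl" => (14 : ℕ)
notation "aLl" => (15 : ℕ)
notation "aLen" => (16 : ℕ)
notation "aSam" => (17 : ℕ)
notation "aRnk" => (18 : ℕ)
notation "aIt" => (19 : ℕ)
notation "aOut" => (20 : ℕ)

/-- Walks through the sorted items and gives the item `x` at position `aPl[rOff + x]` the number of
distinct keys up to its own as name. -/
def naming : Program :=
  rNm ≔ 0 ;;
  rPrev ≔ 0 ;;
  forLoop rQ 0 (rg rM)
    (rX ≔ ld aOrd (rg rQ) ;;
      .cond (ld aKey (rg rX) =! rg rPrev) .skip (rNm ≔ rg rNm + 1 ;; rPrev ≔ ld aKey (rg rX)) ;;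
      .store aLl (rg rOff + ld aPl (rg rOff + rg rX)) (rg rNm))

/-- The names compare as the keys do, and are between `1` and the number of items. -/
theorem naming_spec {B M off : ℕ} {K pl ll : ℕ → ℕ} {s : State} (hB : Bdd B s)
    (hM : s.reg rM = M) (hoff : s.reg rOff = off) (hK : s.mem aKey = K) (hpl : s.mem aPl = pl)
    (hll : s.mem aLl = ll) (hMB : M + 1 < B) (hs : SortedBy M K (s.mem aOrd))
    (hK0 : ∀ x < M, 0 < K x) (hinj : ∀ x < M, ∀ y < M, pl (off + x) = pl (off + y) → x = y) :
    wp B naming s fun s' t => t ≤ 100 * M + 100 ∧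
      (∀ x < M, ∀ y < M, s'.mem aLl (off + pl (off + x)) < s'.mem aLl (off + pl (off + y)) ↔
        K x < K y) ∧
      (∀ x < M, 1 ≤ s'.mem aLl (off + pl (off + x)) ∧ s'.mem aLl (off + pl (off + x)) ≤ M) ∧
      ∀ i, (∀ x < M, i ≠ off + pl (off + x)) → s'.mem aLl i = ll i := by
  set o := s.mem aOrd with ho
  have hB2 : Bdd B ((s.setReg rNm 0).setReg rPrev 0) :=
    (hB.setReg (by omega)).setReg (by omega)
  rw [naming, wp_seq, wp_assign]
  refine ⟨by simp; omega, ?_⟩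
  rw [wp_seq, wp_assign]
  refine ⟨by simp; omega, ?_⟩
  simp only [ev_ofNat]
  set v : State → ℕ → ℕ := fun s' a => s'.mem aLl (off + pl (off + o a)) with hv
  refine wp_for 0 M 50 (fun q s' =>
      (∀ a < q, 1 ≤ v s' a ∧ v s' a ≤ s'.reg rNm ∧ K (o a) ≤ s'.reg rPrev ∧
        (K (o a) = s'.reg rPrev ↔ v s' a = s'.reg rNm)) ∧
      (∀ a < q, ∀ b < q, v s' a < v s' b ↔ K (o a) < K (o b)) ∧
      (∀ a < M, q ≤ a → s'.reg rPrev ≤ K (o a)) ∧ s'.reg rNm ≤ q ∧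
      (s'.reg rPrev = 0 ∨ 1 ≤ s'.reg rNm) ∧
      ∀ i, (∀ x < M, i ≠ off + pl (off + x)) → s'.mem aLl i = ll i)
    hB2 (by decide) (by omega) (by simp) (by omega)
    (fun s' hF => by simp [hF.reg rM (by decide), hM]) (by simp [hll]) ?_ ?_
  · rintro q s' - hq hi hF hB' ⟨h1, h2, h3, h4, h5, h6⟩
    have e1 : s'.mem aKey = K := by rw [hF.mem _ (by decide)]; simp [hK]
    have e2 : s'.mem aOrd = o := by rw [hF.mem _ (by decide)]; simp [ho]
    have e3 : s'.mem aPl = pl := by rw [hF.mem _ (by decide)]; simp [hpl]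
    have e4 : s'.reg rOff = off := by rw [hF.reg _ (by decide)]; simp [hoff]
    have hoq := hs.lt q hq
    have hne : ∀ a < q, off + pl (off + o a) ≠ off + pl (off + o q) := by
      intro a ha e
      have := hs.inj a (by omega) q hq (hinj _ (hs.lt a (by omega)) _ hoq (by omega))
      omega
    have hKB : K (o q) < B := e1 ▸ hB'.2 aKey _
    have hle := h3 q hq le_rfl
    have h0 := hK0 _ hoq
    have hmono : ∀ a < M, q + 1 ≤ a → K (o q) ≤ K (o a) := fun a ha hqa =>
      hs.mono q a hqa ha
    have hout : ∀ u i, (∀ x < M, i ≠ off + pl (off + x)) →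
        Function.update (s'.mem aLl) (off + pl (off + o q)) u i = ll i := by
      intro u i hi
      rw [Function.update_apply, if_neg (hi _ hoq)]
      exact h6 i hi
    simp [hi, e1, e2, e3, e4]
    refine ⟨by omega, fun heq => ⟨by omega, ?_, ?_, ?_, by omega, by omega, hout _⟩,
      fun hneq => ⟨by omega, by omega, by omega, ?_, ?_, hmono, by omega, hout _⟩⟩
    · intro a ha
      rcases ha.lt_or_eq with ha | rfl
      · simp only [hv, mem_setReg, mem_setMem, if_true, Function.update_of_ne (hne a ha)]
        exact h1 a ha
      · simp only [hv, mem_setReg, mem_setMem, if_true, Function.update_self]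
        exact ⟨by omega, le_rfl, by omega, by simp [heq]⟩
    · intro a ha b hb
      rcases ha.lt_or_eq with ha | rfl <;> rcases hb.lt_or_eq with hb | rfl
      · simp only [hv, mem_setReg, mem_setMem, if_true, Function.update_of_ne (hne _ ha),
          Function.update_of_ne (hne _ hb)]
        exact h2 a ha b hb
      · simp only [hv, mem_setReg, mem_setMem, if_true, Function.update_of_ne (hne _ ha),
          Function.update_self]
        obtain ⟨_, g2, g3, g4⟩ := h1 a ha
        simp only [hv] at g2 g4
        omega
      · simp only [hv, mem_setReg, mem_setMem, if_true, Function.update_of_ne (hne _ hb),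
          Function.update_self]
        obtain ⟨_, g2, g3, g4⟩ := h1 b hb
        simp only [hv] at g2 g4
        omega
      · simp
    · intro a ha hqa
      exact h3 a ha (by omega)
    · intro a ha
      rcases ha.lt_or_eq with ha | rfl
      · simp only [hv, mem_setReg, mem_setMem, if_true, Function.update_of_ne (hne a ha)]
        obtain ⟨g1, g2, g3, g4⟩ := h1 a ha
        simp only [hv] at g1 g2 g4
        exact ⟨by omega, by omega, by omega, by omega⟩
      · simp [hv]
    · intro a ha b hb
      rcases ha.lt_or_eq with ha | rfl <;> rcases hb.lt_or_eq with hb | rfl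
      · simp only [hv, mem_setReg, mem_setMem, if_true, Function.update_of_ne (hne _ ha),
          Function.update_of_ne (hne _ hb)]
        exact h2 a ha b hb
      · simp only [hv, mem_setReg, mem_setMem, if_true, Function.update_of_ne (hne _ ha),
          Function.update_self]
        obtain ⟨_, g2, g3, g4⟩ := h1 a ha
        simp only [hv] at g2 g4
        omega
      · simp only [hv, mem_setReg, mem_setMem, if_true, Function.update_of_ne (hne _ hb),
          Function.update_self]
        obtain ⟨_, g2, g3, g4⟩ := h1 b hb
        simp only [hv] at g2 g4
        omega
      · simp
  intro s' t ht _ hF hB' ⟨h1, h2, _, h4, _, h6⟩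
  have surj : ∀ x < M, ∃ a < M, o a = x := fun x hx => exists_eq_of_inj hs.lt hs.inj hx
  simp at ht
  refine ⟨by simp; omega, ?_, ?_, h6⟩
  · intro x hx y hy
    obtain ⟨a, ha, rfl⟩ := surj x hx
    obtain ⟨b, hb, rfl⟩ := surj y hy
    exact h2 a ha b hb
  · intro x hx
    obtain ⟨a, ha, rfl⟩ := surj x hx
    obtain ⟨g1, g2, _⟩ := h1 a ha
    exact ⟨g1, g2.trans h4⟩

/-- The tables `pl` and `ll` hold level `l`, at offset `l * W`: the `M` sample positions in
increasing order, and names of the blocks of length `3 ^ l` starting at the positions, which compare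
as the blocks do. Positions between `N` and `W`, past the end of the string, are included in the
comparison; their name is `0`. -/
structure IsLevel (N X : ℕ) (S : ℕ → ℕ) (W l M : ℕ) (pl ll : ℕ → ℕ) : Prop where
  list : IncList M (fun q => pl (l * W + q)) (Sample N l)
  lt_iff : ∀ p < W, ∀ q < W, Good l p → Good l q →
    (ll (l * W + p) < ll (l * W + q) ↔ blockVal S X p (3 ^ l) < blockVal S X q (3 ^ l))
  le : ∀ p < W, Good l p → ll (l * W + p) ≤ M
  pos : ∀ p < N, Good l p → 0 < ll (l * W + p)

section
variable {N X W l M : ℕ} {S pl ll : ℕ → ℕ}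

theorem IsLevel.eq_iff (h : IsLevel N X S W l M pl ll) {p q : ℕ} (hp : p < W) (hq : q < W)
    (gp : Good l p) (gq : Good l q) : ll (l * W + p) = ll (l * W + q) ↔
      blockVal S X p (3 ^ l) = blockVal S X q (3 ^ l) := by
  have h1 := h.lt_iff p hp q hq gp gq
  have h2 := h.lt_iff q hq p hp gq gp
  omega

/-- Sorting key of a position at the next level: the names of three consecutive blocks. -/
def tripleKey (ll : ℕ → ℕ) (off st U p : ℕ) : ℕ :=
  (ll (off + p) * U + ll (off + p + st)) * U + ll (off + p + 2 * st)

/-- Three consecutive blocks of length `3 ^ l` make up one of length `3 ^ (l + 1)`. They start at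
positions of level `l`, since adding `3 ^ l` does not change the `l` lowest ternary digits. -/
theorem IsLevel.tripleKey_lt_iff (h : IsLevel N X S W l M pl ll) (hS : IsPadded N X S) {U : ℕ}
    (hU : M < U) {p q : ℕ} (hp : p + 2 * 3 ^ l < W) (hq : q + 2 * 3 ^ l < W) (gp : Good l p)
    (gq : Good l q) : tripleKey ll (l * W) (3 ^ l) U p < tripleKey ll (l * W) (3 ^ l) U q ↔
      blockVal S X p (3 ^ (l + 1)) < blockVal S X q (3 ^ (l + 1)) := by
  have e : 3 ^ (l + 1) = 3 ^ l + 3 ^ l + 3 ^ l := by rw [pow_succ]; ring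
  have gp1 := good_add.2 gp
  have gq1 := good_add.2 gq
  have gp2 := (good_add_mul 2).2 gp
  have gq2 := (good_add_mul 2).2 gq
  have e2 : ∀ p, p + (3 ^ l + 3 ^ l) = p + 2 * 3 ^ l := fun p => by ring
  simp only [tripleKey, e, blockVal_add]
  simp only [add_assoc, e2]
  rw [lex_lt_iff (by have := h.le _ hp gp2; omega) (by have := h.le _ hq gq2; omega),
    lex_lt_iff (by have := h.le (p + 3 ^ l) (by omega) gp1; omega)
      (by have := h.le (q + 3 ^ l) (by omega) gq1; omega),
    lex_eq_iff (by have := h.le (p + 3 ^ l) (by omega) gp1; omega)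
      (by have := h.le (q + 3 ^ l) (by omega) gq1; omega),
    lex_lt_iff (hS.blockVal_lt _ _) (hS.blockVal_lt _ _),
    lex_lt_iff (hS.blockVal_lt _ _) (hS.blockVal_lt _ _),
    lex_eq_iff (hS.blockVal_lt _ _) (hS.blockVal_lt _ _),
    h.lt_iff p (by omega) q (by omega) gp gq, h.eq_iff (by omega) (by omega) gp gq,
    h.lt_iff _ (by omega) _ (by omega) gp1 gq1, h.eq_iff (by omega) (by omega) gp1 gq1,
    h.lt_iff _ hp _ hq gp2 gq2]

theorem IsLevel.tripleKey_lt (h : IsLevel N X S W l M pl ll) {U : ℕ} (hU : M < U) {p : ℕ}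
    (hp : p + 2 * 3 ^ l < W) (gp : Good l p) : tripleKey ll (l * W) (3 ^ l) U p < U ^ 3 := by
  have h1 := h.le p (by omega) gp
  have h2 := h.le (p + 3 ^ l) (by omega) (good_add.2 gp)
  have h3 := h.le (p + 2 * 3 ^ l) hp ((good_add_mul 2).2 gp)
  have key : ∀ a b Y, a < Y → b < U → a * U + b < Y * U := by
    intro a b Y ha hb
    have := Nat.mul_le_mul_right U (Nat.succ_le_of_lt ha)
    rw [Nat.succ_mul] at this
    omega
  rw [pow_succ, pow_succ, pow_one]
  simp only [tripleKey, add_assoc]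
  exact key _ _ _ (key _ _ _ (by omega) (by omega)) (by omega)

end

/-- Appends the sample positions of the next level, with their keys. -/
def collectSample : Program :=
  rZ ≔ 0 ;;
  forLoop rQ 0 (rg rLen)
    (rX ≔ ld aPl (rg rOff + rg rQ) ;;
      ifThen (rg rX / rg rSt % 3)
        (.store aPl (rg rOff + rg rW + rg rZ) (rg rX) ;;
          .store aKey (rg rZ) ((ld aLl (rg rOff + rg rX) * rg rU +
            ld aLl (rg rOff + rg rX + rg rSt)) * rg rU + ld aLl (rg rOff + rg rX + 2 * rg rSt)) ;;
          rZ ≔ rg rZ + 1))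

theorem collectSample_spec {B N X W l M U : ℕ} {S pl ll : ℕ → ℕ} {s : State} (hB : Bdd B s)
    (hlen : s.reg rLen = M) (hoff : s.reg rOff = l * W) (hst : s.reg rSt = 3 ^ l)
    (hW : s.reg rW = W) (hU : s.reg rU = U) (hpl : s.mem aPl = pl) (hll : s.mem aLl = ll)
    (h : IsLevel N X S W l M pl ll) (hMU : M < U) (hNW : 5 * N + 2 < W) (hMW : M < W)
    (hUB : U ^ 3 < B) (hMB : M + 1 < B) :
    wp B collectSample s fun s' t => t ≤ 100 * M + 100 ∧
      s'.reg rZ ≤ M ∧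
      IncList (s'.reg rZ) (fun a => s'.mem aPl ((l + 1) * W + a)) (Sample N (l + 1)) ∧
      (∀ a < s'.reg rZ, s'.mem aKey a =
        tripleKey ll (l * W) (3 ^ l) U (s'.mem aPl ((l + 1) * W + a))) ∧
      ∀ i < (l + 1) * W, s'.mem aPl i = pl i := by
  rw [collectSample, wp_seq, wp_assign]
  refine ⟨by simp; omega, ?_⟩
  simp only [ev_ofNat]
  refine wp_for 0 M 60 (fun q s' => s'.reg rZ ≤ q ∧
      IncList (s'.reg rZ) (fun a => s'.mem aPl ((l + 1) * W + a))
        (fun x => x / 3 ^ l % 3 ≠ 0 ∧ ∃ q' < q, pl (l * W + q') = x) ∧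
      (∀ a < s'.reg rZ, s'.mem aKey a =
        tripleKey ll (l * W) (3 ^ l) U (s'.mem aPl ((l + 1) * W + a))) ∧
      ∀ i < (l + 1) * W, s'.mem aPl i = pl i)
    (hB.setReg (by omega)) (by decide) (by omega) (by simp) (by omega)
    (fun s' hF => by simp [hF.reg rLen (by decide), hlen]) ?_ ?_ ?_
  · simp [hpl]
    exact IncList.nil _ (by simp)
  · rintro q s' - hq hi hF hB' ⟨h1, h2, h3, h4⟩
    have e1 : s'.mem aLl = ll := by rw [hF.mem _ (by decide)]; simp [hll]
    have e2 : s'.reg rOff = l * W := by rw [hF.reg _ (by decide)]; simp [hoff]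
    have e3 : s'.reg rSt = 3 ^ l := by rw [hF.reg _ (by decide)]; simp [hst]
    have e4 : s'.reg rW = W := by rw [hF.reg _ (by decide)]; simp [hW]
    have e5 : s'.reg rU = U := by rw [hF.reg _ (by decide)]; simp [hU]
    have e6 : l * W + W = (l + 1) * W := by ring
    have e7 : s'.mem aPl (l * W + q) = pl (l * W + q) := h4 _ (by omega)
    obtain ⟨g1, g2⟩ := h.list.prop q hq
    have g3 := g2.pow_le
    have g4 := h.tripleKey_lt hMU (by omega) g2
    have hzB : s'.reg rZ < B := hB'.1 _
    have hxB : pl (l * W + q) < B := e7 ▸ hB'.2 aPl _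
    simp [hi, e1, e2, e3, e4, e5, e6, e7]
    refine ⟨by omega, fun hD => ⟨by omega, ?_, by omega, h1, ?_, ?_, ?_⟩,
      fun hD => ⟨by omega, ?_, h3, h4⟩⟩
    · exact lt_trans g4 hUB
    · have h5 := h.list.push (g' := fun a => Function.update (s'.mem aPl) ((l + 1) * W + s'.reg rZ)
          (pl (l * W + q)) ((l + 1) * W + a)) hq h2 hD
        (fun a ha => Function.update_of_ne (by omega) _ _) (Function.update_self _ _ _)
      simpa only [ne_eq, Nat.lt_succ_iff] using h5
    · intro a ha
      rcases ha.lt_or_eq with ha | rfl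
      · rw [Function.update_of_ne (by omega), Function.update_of_ne (by omega)]
        exact h3 a ha
      · simp [tripleKey]
    · intro i hi
      rw [Function.update_of_ne (by omega)]
      exact h4 i hi
    · simpa only [ne_eq, Nat.lt_succ_iff] using h2.skip (by simpa using hD)
  intro s' t ht _ hF hB' ⟨h1, h2, h3, h4⟩
  simp at ht
  refine ⟨by simp; omega, h1, ?_, h3, h4⟩
  refine (h.list.filter h2).congr (fun _ _ => rfl) fun x => ?_
  rw [Sample.succ_iff]

/-- The number of sample positions of level `l`. -/
noncomputable def sampleCard (N l : ℕ) : ℕ := {p | Sample N l p}.ncard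

theorem sampleCard_zero (N : ℕ) : sampleCard N 0 = N := by
  have : {p | Sample N 0 p} = Set.Iio N := by
    ext p; simp [Sample, Good]
  rw [sampleCard, this]; simp

theorem sampleCard_succ_le (N l : ℕ) : 3 * sampleCard N (l + 1) ≤ 2 * sampleCard N l :=
  sample_succ_le N l

theorem sampleCard_le (N l : ℕ) : sampleCard N l ≤ N := by
  induction l with
  | zero => exact (sampleCard_zero N).le
  | succ l ih => have := sampleCard_succ_le N l; omega

/-- The sample sizes form a series that is dominated by a geometric one. -/
theorem sum_sampleCard_le (N l : ℕ) :
    ∑ i ∈ Finset.range l, sampleCard N i + 3 * sampleCard N l ≤ 3 * N := by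
  induction l with
  | zero => simp [sampleCard_zero]
  | succ l ih =>
    have := sampleCard_succ_le N l
    rw [Finset.sum_range_succ]
    omega

theorem pow_le_of_sampleCard_pos {N l : ℕ} (h : 0 < sampleCard N l) : 3 ^ l ≤ 2 * N + 1 := by
  obtain ⟨p, hp⟩ := Set.nonempty_of_ncard_ne_zero (s := {p | Sample N l p})
    (by rw [sampleCard] at h; omega)
  have h1 := hp.2.pow_le
  have h2 := hp.1
  omega

theorem IsLevel.congr {N X W l M : ℕ} {S pl ll pl' ll' : ℕ → ℕ} (h : IsLevel N X S W l M pl ll)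
    (hMW : M ≤ W) (hNW : N ≤ W) (hpl : ∀ i < (l + 1) * W, pl' i = pl i)
    (hll : ∀ i < (l + 1) * W, ll' i = ll i) : IsLevel N X S W l M pl' ll' := by
  have hlt : ∀ q < W, l * W + q < (l + 1) * W := fun q hq => by rw [Nat.succ_mul]; omega
  refine ⟨h.list.congr (fun q hq => hpl _ (hlt q (by omega))) fun _ => Iff.rfl,
    fun p hp q hq gp gq => ?_, fun p hp gp => ?_, fun p hp gp => ?_⟩
  · rw [hll _ (hlt p hp), hll _ (hlt q hq)]; exact h.lt_iff p hp q hq gp gq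
  · rw [hll _ (hlt p hp)]; exact h.le p hp gp
  · rw [hll _ (hlt p (by omega))]; exact h.pos p hp gp

/-- Constructs the next level from level `rLev`. -/
def descendStep : Program :=
  rU ≔ rg rLen + 2 ;;
  collectSample ;;
  rM ≔ rg rZ ;;
  radixSort ;;
  rOff ≔ rg rOff + rg rW ;;
  naming ;;
  rLev ≔ rg rLev + 1 ;;
  rSt ≔ rg rSt * 3 ;;
  rLen ≔ rg rZ ;;
  .store aLen (rg rLev) (rg rLen)

/-- The levels up to `l` have been constructed, and the registers describe level `l`. The names of
level `0` are the letters of the string `S`. -/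
structure LevelsUpTo (N X : ℕ) (S : ℕ → ℕ) (W l : ℕ) (s : State) : Prop where
  w : s.reg rW = W
  off : s.reg rOff = l * W
  st : s.reg rSt = 3 ^ l
  lev : s.reg rLev = l
  len : s.reg rLen = sampleCard N l
  level : ∀ l' ≤ l, IsLevel N X S W l' (sampleCard N l') (s.mem aPl) (s.mem aLl)
  lens : ∀ l' ≤ l, s.mem aLen l' = sampleCard N l'
  zero : ∀ i, N ≤ i % W → s.mem aLl i = 0
  letters : ∀ p < W, s.mem aLl p = S p

theorem descendStep_spec {B N X W l : ℕ} {S : ℕ → ℕ} {s : State} (hB : Bdd B s)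
    (hS : IsPadded N X S) (hNW : 5 * N + 2 < W) (hWN : W ≤ 8 * N + 8)
    (hNB : 100 * (N + 2) ^ 4 < B) (h : LevelsUpTo N X S W l s) (hl : 0 < sampleCard N l) :
    wp B descendStep s fun s' t => t ≤ 10000 * sampleCard N l ∧ LevelsUpTo N X S W (l + 1) s' := by
  set M := sampleCard N l with hM
  have hMN : M ≤ N := sampleCard_le N l
  have h3 := pow_le_of_sampleCard_pos hl
  have hl3 : l < 3 ^ l := Nat.lt_pow_self (by norm_num)
  have hU4 : (M + 2) ^ 3 * (M + 2) ≤ (N + 2) ^ 4 := by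
    rw [← pow_succ]; exact Nat.pow_le_pow_left (by omega) 4
  have hU3 : (M + 2) ^ 3 ≤ (M + 2) ^ 3 * (M + 2) := Nat.le_mul_of_pos_right _ (by omega)
  have hN24 : (N + 2) ^ 2 ≤ (N + 2) ^ 4 := Nat.pow_le_pow_right (by omega) (by norm_num)
  have hN2 : N + 2 ≤ (N + 2) ^ 4 := Nat.le_self_pow (by norm_num) _
  have hoffB : (l + 1) * W < B := by
    have : (l + 1) * W ≤ (2 * N + 1) * (8 * N + 8) := Nat.mul_le_mul (by omega) hWN
    nlinarith
  have e6 : l * W + W = (l + 1) * W := by ring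
  rw [descendStep, wp_seq, wp_assign]
  simp only [ev_add, ev_reg, ev_ofNat, h.len]
  refine ⟨by omega, ?_⟩
  have hB1 := hB.setReg (x := rU) (v := M + 2) (by omega)
  rw [wp_seq]
  refine (collectSample_spec (l := l) (M := M) (W := W) (U := M + 2) hB1 (by simp [h.len, hM])
    (by simp [h.off]) (by simp [h.st]) (by simp [h.w]) (by simp) rfl rfl (h.level l le_rfl)
    (by omega) hNW (by omega) (by omega) (by omega)).call hB1 ?_
  rintro s1 t1 hF1 hB1 ⟨ht1, hz, hlist, hkey, hplold⟩
  simp only [mem_setReg] at hkey hplold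
  have hz' : s1.reg rZ = sampleCard N (l + 1) := hlist.ncard.symm
  set z := sampleCard N (l + 1) with hzdef
  rw [hz'] at hz hlist hkey
  have a1 : s1.reg rU = M + 2 := by rw [hF1.reg _ (by decide)]; simp
  have a2 : s1.reg rOff = l * W := by rw [hF1.reg _ (by decide)]; simp [h.off]
  have a3 : s1.reg rSt = 3 ^ l := by rw [hF1.reg _ (by decide)]; simp [h.st]
  have a4 : s1.reg rW = W := by rw [hF1.reg _ (by decide)]; simp [h.w]
  have a5 : s1.reg rLev = l := by rw [hF1.reg _ (by decide)]; simp [h.lev]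
  have a6 : s1.mem aLl = s.mem aLl := by rw [hF1.mem _ (by decide)]; simp
  have a7 : s1.mem aLen = s.mem aLen := by rw [hF1.mem _ (by decide)]; simp
  rw [wp_seq, wp_assign]
  simp only [ev_reg, hz']
  refine ⟨by omega, ?_⟩
  have hB1' := hB1.setReg (x := rM) (v := z) (by omega)
  have hLl := h.level l le_rfl
  have hsmp : ∀ x < z, s1.mem aPl ((l + 1) * W + x) < N ∧
      Good l (s1.mem aPl ((l + 1) * W + x)) := fun x hx =>
    ⟨(hlist.prop x hx).1, (good_succ.1 (hlist.prop x hx).2).1⟩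
  have hkpos : ∀ x < z, 0 < s1.mem aKey x := by
    intro x hx
    obtain ⟨g1, g2⟩ := hsmp x hx
    rw [hkey x hx, tripleKey]
    have := hLl.pos _ g1 g2
    positivity
  have hklt : ∀ x < z, s1.mem aKey x < (M + 2) ^ 3 := by
    intro x hx
    obtain ⟨g1, g2⟩ := hsmp x hx
    rw [hkey x hx]
    exact hLl.tripleKey_lt (by omega) (by omega) g2
  rw [wp_seq]
  refine (radixSort_spec (M := z) (U := M + 2) (X := (M + 2) ^ 3) (c := 3) (K := s1.mem aKey) hB1'
    (by simp) (by simp [a1]) rfl (by omega) (by omega) (by omega) hklt (by positivity)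
    (by omega) le_rfl).call hB1' ?_
  rintro s2 t2 hF2 hB2 ⟨ht2, hsorted⟩
  have b1 : s2.reg rZ = z := by rw [hF2.reg _ (by decide)]; simp [hz']
  have b2 : s2.reg rOff = l * W := by rw [hF2.reg _ (by decide)]; simp [a2]
  have b3 : s2.reg rSt = 3 ^ l := by rw [hF2.reg _ (by decide)]; simp [a3]
  have b4 : s2.reg rW = W := by rw [hF2.reg _ (by decide)]; simp [a4]
  have b5 : s2.reg rLev = l := by rw [hF2.reg _ (by decide)]; simp [a5]
  have b6 : s2.mem aLl = s.mem aLl := by rw [hF2.mem _ (by decide)]; simp [a6]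
  have b7 : s2.mem aLen = s.mem aLen := by rw [hF2.mem _ (by decide)]; simp [a7]
  have b8 : s2.mem aKey = s1.mem aKey := by rw [hF2.mem _ (by decide)]; simp
  have b9 : s2.mem aPl = s1.mem aPl := by rw [hF2.mem _ (by decide)]; simp
  have b10 : s2.reg rM = z := by rw [hF2.reg _ (by decide)]; simp
  rw [wp_seq, wp_assign]
  simp only [ev_add, ev_reg, b2, b4, e6]
  refine ⟨hoffB, ?_⟩
  have hB2' := hB2.setReg (x := rOff) hoffB
  rw [wp_seq]
  refine (naming_spec (M := z) (off := (l + 1) * W) (K := s1.mem aKey) (pl := s1.mem aPl)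
    (ll := s.mem aLl) hB2' (by simp [b10]) (by simp) (by simp [b8]) (by simp [b9]) (by simp [b6])
    (by omega) (by simpa using hsorted) hkpos
    (fun x hx y hy e => hlist.inj hx hy e)).call hB2' ?_
  rintro s3 t3 hF3 hB3 ⟨ht3, hn1, hn2, hn3⟩
  have c1 : s3.reg rZ = z := by rw [hF3.reg _ (by decide)]; simp [b1]
  have c2 : s3.reg rOff = (l + 1) * W := by rw [hF3.reg _ (by decide)]; simp
  have c3 : s3.reg rSt = 3 ^ l := by rw [hF3.reg _ (by decide)]; simp [b3]
  have c4 : s3.reg rW = W := by rw [hF3.reg _ (by decide)]; simp [b4]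
  have c5 : s3.reg rLev = l := by rw [hF3.reg _ (by decide)]; simp [b5]
  have c7 : s3.mem aLen = s.mem aLen := by rw [hF3.mem _ (by decide)]; simp [b7]
  have c9 : s3.mem aPl = s1.mem aPl := by rw [hF3.mem _ (by decide)]; simp [b9]
  have hnew : ∀ i < (l + 1) * W, s3.mem aLl i = s.mem aLl i := fun i hi =>
    hn3 i fun x hx => by omega
  have hzero : ∀ i, N ≤ i % W → s3.mem aLl i = 0 := by
    intro i hi
    rw [hn3 i, h.zero i hi]
    rintro x hx rfl
    have := (hsmp x hx).1
    rw [Nat.mul_add_mod_of_lt (by omega)] at hi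
    omega
  have hlev : ∀ l' ≤ l + 1, IsLevel N X S W l' (sampleCard N l') (s3.mem aPl) (s3.mem aLl) := by
    intro l' hl'
    rcases hl'.lt_or_eq with hl' | rfl
    · refine (h.level l' (by omega)).congr ((sampleCard_le N l').trans (by omega)) (by omega)
        (fun i hi => ?_) (fun i hi => ?_)
      · have := Nat.mul_le_mul_right W (by omega : l' + 1 ≤ l + 1)
        rw [c9]; exact hplold i (by omega)
      · have := Nat.mul_le_mul_right W (by omega : l' + 1 ≤ l + 1)
        exact hnew i (by omega)
    · have hpos : ∀ p < N, Good (l + 1) p → 1 ≤ s3.mem aLl ((l + 1) * W + p) ∧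
          s3.mem aLl ((l + 1) * W + p) ≤ z := by
        intro p hp gp
        obtain ⟨x, hx, rfl⟩ := hlist.surj p ⟨hp, gp⟩
        exact hn2 x hx
      have hmod : ∀ p < W, ((l + 1) * W + p) % W = p := fun p hp => Nat.mul_add_mod_of_lt hp
      have hz0 : ∀ p < W, N ≤ p → s3.mem aLl ((l + 1) * W + p) = 0 := fun p hp hNp =>
        hzero _ (by rw [hmod p hp]; exact hNp)
      refine ⟨hlist.congr (fun q _ => by rw [c9]) fun _ => Iff.rfl, ?_, ?_,
        fun p hp gp => (hpos p hp gp).1⟩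
      · intro p hp q hq gp gq
        rcases lt_or_ge p N with hpN | hpN <;> rcases lt_or_ge q N with hqN | hqN
        · obtain ⟨x, hx, rfl⟩ := hlist.surj p ⟨hpN, gp⟩
          obtain ⟨y, hy, rfl⟩ := hlist.surj q ⟨hqN, gq⟩
          rw [hn1 x hx y hy, hkey x hx, hkey y hy]
          exact hLl.tripleKey_lt_iff hS (by omega) (by omega) (by omega) (good_succ.1 gp).1
            (good_succ.1 gq).1
        · rw [hz0 q hq hqN, hS.blockVal_eq_zero hqN]; simp
        · have h4 := hpos q hqN gq
          have h5 := hS.blockVal_pos hqN (l := 3 ^ (l + 1)) (by positivity)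
          rw [hz0 p hp hpN, hS.blockVal_eq_zero hpN]
          omega
        · rw [hz0 q hq hqN, hz0 p hp hpN, hS.blockVal_eq_zero hqN, hS.blockVal_eq_zero hpN]
      · intro p hp gp
        rcases lt_or_ge p N with hpN | hpN
        · exact (hpos p hpN gp).2
        · rw [hz0 p hp hpN]; exact Nat.zero_le _
  simp only [wp_seq, wp_assign, wp_store]
  simp [c1, c3, c5]
  have hN8 : 100 * (N + 2) ≤ 100 * (N + 2) ^ 4 := Nat.mul_le_mul_left _ hN2
  refine ⟨by omega, by omega, by omega, by omega, ?_⟩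
  refine ⟨by simp [c4], by simp [c2], by simp [pow_succ], by simp, by simp [hzdef],
    by simpa using hlev, ?_, by simpa using hzero, fun p hp => ?_⟩
  swap
  · have hpW := Nat.mul_le_mul_right W (by omega : 1 ≤ l + 1)
    simp only [mem_setMem, mem_setReg, if_neg (by decide : ¬ aLl = aLen)]
    rw [hnew p (by omega), h.letters p hp]
  intro l' hl'
  simp only [mem_setMem, if_true, mem_setReg, c7]
  rw [Function.update_apply]
  split_ifs with h4
  · rw [h4]
  · exact h.lens l' (by omega)

/-! ### Sorting all suffixes -/

/-- `f` lists `M` sample positions of level `l` in increasing order of their suffixes. -/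
structure SufList (N X : ℕ) (S : ℕ → ℕ) (l M : ℕ) (f : ℕ → ℕ) : Prop where
  prop : ∀ t < M, Sample N l (f t)
  mono : ∀ t t', t < t' → t' < M → sufVal N X S (f t) < sufVal N X S (f t')

section
variable {N X l M : ℕ} {S f : ℕ → ℕ}

theorem SufList.inj (h : SufList N X S l M f) {p q : ℕ} (hp : p < M) (hq : q < M)
    (e : f p = f q) : p = q := by
  rcases lt_trichotomy p q with h1 | h1 | h1
  · exact absurd (congrArg _ e) (h.mono p q h1 hq).ne
  · exact h1
  · exact absurd (congrArg _ e) (h.mono q p h1 hp).ne'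

theorem SufList.surj (h : SufList N X S l (sampleCard N l) f) {x : ℕ} (hx : Sample N l x) :
    ∃ t < sampleCard N l, f t = x := by
  have hfin : {p | Sample N l p}.Finite :=
    (sample_finite N l fun _ => True).subset fun p hp => ⟨hp, trivial⟩
  have hinj : Set.InjOn f (Set.Iio (sampleCard N l)) := fun p hp q hq e => h.inj hp hq e
  have hsub : f '' Set.Iio (sampleCard N l) ⊆ {p | Sample N l p} := by
    rintro _ ⟨t, ht, rfl⟩; exact h.prop t ht
  have heq := Set.eq_of_subset_of_ncard_le hsub (by rw [hinj.ncard_image]; simp [sampleCard]) hfin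
  have : x ∈ f '' Set.Iio (sampleCard N l) := heq ▸ hx
  exact this

/-- The values of `r` at the sample positions of level `l`, and at those of the same residues past
the end of the string, compare as the suffixes do, and are at most `M`. -/
structure IsRank (N X : ℕ) (S : ℕ → ℕ) (l M : ℕ) (r : ℕ → ℕ) : Prop where
  lt_iff : ∀ p q, Good l p → Good l q → (r p < r q ↔ sufVal N X S p < sufVal N X S q)
  le : ∀ p, Good l p → r p ≤ M

theorem SufList.isRank (h : SufList N X S l (sampleCard N l) f) (hS : IsPadded N X S) {r : ℕ → ℕ}
    (hr : ∀ t < sampleCard N l, r (f t) = t + 1) (hr0 : ∀ p, N ≤ p → r p = 0) :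
    IsRank N X S l (sampleCard N l) r := by
  refine ⟨fun p q gp gq => ?_, fun p gp => ?_⟩
  · rcases lt_or_ge p N with hp | hp <;> rcases lt_or_ge q N with hq | hq
    · obtain ⟨t, ht, rfl⟩ := h.surj ⟨hp, gp⟩
      obtain ⟨u, hu, rfl⟩ := h.surj ⟨hq, gq⟩
      rw [hr t ht, hr u hu]
      rcases lt_trichotomy t u with h1 | rfl | h1
      · have := h.mono t u h1 hu; omega
      · simp
      · have := h.mono u t h1 ht; omega
    · rw [hr0 q hq, hS.sufVal_eq_zero hq]; simp
    · obtain ⟨u, hu, rfl⟩ := h.surj ⟨hq, gq⟩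
      rw [hr0 p hp, hS.sufVal_eq_zero hp, hr u hu]
      have := hS.sufVal_pos hq
      omega
    · rw [hr0 p hp, hr0 q hq, hS.sufVal_eq_zero hp, hS.sufVal_eq_zero hq]
  · rcases lt_or_ge p N with hp | hp
    · obtain ⟨t, ht, rfl⟩ := h.surj ⟨hp, gp⟩
      rw [hr t ht]; exact ht
    · rw [hr0 p hp]; exact Nat.zero_le _

end

/-- Sorting key of a position whose next block starts at a ranked position: the name of the block at
`p` and the rank of what follows. -/
def pairKey (ll r : ℕ → ℕ) (off st U p : ℕ) : ℕ := ll (off + p) * U + r (p + st)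

/-- Sorting key of a position such that the second block after it starts at a ranked position: the
names of two blocks and the rank of what follows. -/
def doubleKey (ll r : ℕ → ℕ) (off st U p : ℕ) : ℕ :=
  (ll (off + p) * U + ll (off + p + st)) * U + r (p + 2 * st)

section
variable {N X W l M M' U : ℕ} {S pl ll r : ℕ → ℕ}

theorem IsLevel.pairKey_lt_iff (h : IsLevel N X S W l M pl ll) (hr : IsRank N X S (l + 1) M' r)
    (hS : IsPadded N X S) (hU : M' < U) {p q : ℕ} (hp : p < W) (hq : q < W)
    (gp : Good l p) (gq : Good l q) (gp' : Good (l + 1) (p + 3 ^ l))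
    (gq' : Good (l + 1) (q + 3 ^ l)) :
    pairKey ll r (l * W) (3 ^ l) U p < pairKey ll r (l * W) (3 ^ l) U q ↔
      sufVal N X S p < sufVal N X S q := by
  rw [pairKey, pairKey, lex_lt_iff (by have := hr.le _ gp'; omega) (by have := hr.le _ gq'; omega),
    hS.sufVal_lt_iff (3 ^ l) p q, h.lt_iff p hp q hq gp gq, h.eq_iff hp hq gp gq,
    hr.lt_iff _ _ gp' gq']

theorem IsLevel.doubleKey_lt_iff (h : IsLevel N X S W l M pl ll)
    (hr : IsRank N X S (l + 1) M' r) (hS : IsPadded N X S) (hMU : M < U) (hU : M' < U) {p q : ℕ}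
    (hp : p + 3 ^ l < W) (hq : q + 3 ^ l < W) (gp : Good l p) (gq : Good l q)
    (gp' : Good (l + 1) (p + 2 * 3 ^ l)) (gq' : Good (l + 1) (q + 2 * 3 ^ l)) :
    doubleKey ll r (l * W) (3 ^ l) U p < doubleKey ll r (l * W) (3 ^ l) U q ↔
      sufVal N X S p < sufVal N X S q := by
  have e : ∀ p, p + 3 ^ l + 3 ^ l = p + 2 * 3 ^ l := fun p => by ring
  have gp1 := good_add.2 gp
  have gq1 := good_add.2 gq
  have hp0 : p < W := lt_of_le_of_lt (Nat.le_add_right _ _) hp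
  have hq0 : q < W := lt_of_le_of_lt (Nat.le_add_right _ _) hq
  have hp1 := h.le _ hp gp1
  have hq1 := h.le _ hq gq1
  simp only [doubleKey, add_assoc (l * W)]
  rw [lex_lt_iff (by have := hr.le _ gp'; omega) (by have := hr.le _ gq'; omega),
    lex_lt_iff (by omega) (by omega), lex_eq_iff (by omega) (by omega),
    hS.sufVal_lt_iff (3 ^ l) p q, hS.sufVal_lt_iff (3 ^ l) (p + 3 ^ l),
    h.lt_iff p hp0 q hq0 gp gq, h.eq_iff hp0 hq0 gp gq,
    h.lt_iff _ hp _ hq gp1 gq1, h.eq_iff hp hq gp1 gq1, hr.lt_iff _ _ gp' gq', e, e]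
  tauto

end

/-- State of a merge of `A 0, …, A (z - 1)` and `C 0, …, C (n - 1)`, both increasing with respect to
`v`: the first `a` entries of `A` and the first `b` of `C` have been moved to `o`. -/
structure MergeInv (v : ℕ → ℕ) (P : ℕ → Prop) (A C : ℕ → ℕ) (z n a b : ℕ) (o : ℕ → ℕ) :
    Prop where
  az : a ≤ z
  bn : b ≤ n
  prop : ∀ t < a + b, P (o t)
  mono : ∀ t t', t < t' → t' < a + b → v (o t) < v (o t')
  ltA : ∀ t < a + b, ∀ i < z, a ≤ i → v (o t) < v (A i)
  ltC : ∀ t < a + b, ∀ i < n, b ≤ i → v (o t) < v (C i)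

section
variable {v A C o o' : ℕ → ℕ} {P : ℕ → Prop} {z n a b : ℕ}

theorem MergeInv.symm (h : MergeInv v P A C z n a b o) : MergeInv v P C A n z b a o :=
  ⟨h.bn, h.az, by rw [add_comm]; exact h.prop, by rw [add_comm]; exact h.mono,
    by rw [add_comm]; exact h.ltC, by rw [add_comm]; exact h.ltA⟩

theorem MergeInv.stepA (h : MergeInv v P A C z n a b o) (ha : a < z) (hP : P (A a))
    (hA : ∀ i j, i < j → j < z → v (A i) < v (A j)) (hC : ∀ i < n, b ≤ i → v (A a) < v (C i))
    (ho : ∀ t < a + b, o' t = o t) (ho' : o' (a + b) = A a) :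
    MergeInv v P A C z n (a + 1) b o' := by
  have e : a + 1 + b = a + b + 1 := by omega
  refine ⟨ha, h.bn, fun t ht => ?_, fun t t' htt ht' => ?_, fun t ht i hi hai => ?_,
    fun t ht i hi hbi => ?_⟩
  · rcases Nat.lt_succ_iff_lt_or_eq.1 (e ▸ ht) with h1 | rfl
    · rw [ho t h1]; exact h.prop t h1
    · rw [ho']; exact hP
  · rw [ho t (by omega)]
    rcases Nat.lt_succ_iff_lt_or_eq.1 (e ▸ ht') with h1 | rfl
    · rw [ho t' h1]; exact h.mono t t' htt h1
    · rw [ho']; exact h.ltA t htt a ha le_rfl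
  · rcases Nat.lt_succ_iff_lt_or_eq.1 (e ▸ ht) with h1 | rfl
    · rw [ho t h1]; exact h.ltA t h1 i hi (by omega)
    · rw [ho']; exact hA a i (by omega) hi
  · rcases Nat.lt_succ_iff_lt_or_eq.1 (e ▸ ht) with h1 | rfl
    · rw [ho t h1]; exact h.ltC t h1 i hi hbi
    · rw [ho']; exact hC i hi hbi

theorem MergeInv.stepC (h : MergeInv v P A C z n a b o) (hb : b < n) (hP : P (C b))
    (hC : ∀ i j, i < j → j < n → v (C i) < v (C j)) (hA : ∀ i < z, a ≤ i → v (C b) < v (A i))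
    (ho : ∀ t < a + b, o' t = o t) (ho' : o' (a + b) = C b) :
    MergeInv v P A C z n a (b + 1) o' :=
  (h.symm.stepA hb hP hC hA (by rwa [add_comm]) (by rwa [add_comm])).symm

end

/-- The program text of `doubleKey`, for the position in register `x`. -/
def doubleKeyExpr (x : ℕ) : Expr :=
  (ld aLl (rg rOff + rg x) * rg rU + ld aLl (rg rOff + rg x + rg rSt)) * rg rU +
    ld aRnk (rg x + 2 * rg rSt)

/-- Merges the sorted positions outside the next sample, `aIt[aOrd[0]], …`, with the sorted next
sample in `aSam`. The former have ternary digit `0` at place `l`. If the digit of the other position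
is `1`, then the digits one block further are `1` and `2`, so that both positions are ranked;
otherwise those two blocks further are `2` and `1`. -/
def mergeSuffixes : Program :=
  rA ≔ 0 ;;
  rB ≔ 0 ;;
  forLoop rQ 0 (rg rLen)
    (rX ≔ ld aIt (ld aOrd (rg rA)) ;;
      rY ≔ ld aSam (rg rB) ;;
      .cond (rg rB <! rg rSub)
        (.cond (rg rA <! rg rZ)
          (.cond (rg rY / rg rSt % 3 =! 1)
            (rD ≔ (ld aLl (rg rOff + rg rX) * rg rU + ld aRnk (rg rX + rg rSt) <!
              ld aLl (rg rOff + rg rY) * rg rU + ld aRnk (rg rY + rg rSt)))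
            (rD ≔ (doubleKeyExpr rX <! doubleKeyExpr rY)))
          (rD ≔ 0))
        (rD ≔ 1) ;;
      .cond (rg rD)
        (.store aOut (rg rQ) (rg rX) ;; rA ≔ rg rA + 1)
        (.store aOut (rg rQ) (rg rY) ;; rB ≔ rg rB + 1))

/-- Position `p + k * 3 ^ l` belongs to the next sample if its ternary digit at place `l` is not
`0`. -/
theorem good_next {l p : ℕ} (k : ℕ) (gp : Good l p) (h : (p / 3 ^ l + k) % 3 ≠ 0) :
    Good (l + 1) (p + k * 3 ^ l) := by
  rw [good_succ, good_add_mul, Nat.add_mul_div_right _ _ (by positivity)]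
  exact ⟨gp, h⟩

theorem mergeSuffixes_spec {B N X W l U z : ℕ} {S pl ll r sam A : ℕ → ℕ} {s : State}
    (hB : Bdd B s) (hS : IsPadded N X S) (hlen : s.reg rLen = sampleCard N l)
    (hsub : s.reg rSub = sampleCard N (l + 1)) (hz : s.reg rZ = z) (hoff : s.reg rOff = l * W)
    (hst : s.reg rSt = 3 ^ l) (hU : s.reg rU = U) (hll : s.mem aLl = ll) (hr : s.mem aRnk = r)
    (hsam : s.mem aSam = sam) (hA : ∀ a < z, s.mem aIt (s.mem aOrd a) = A a)
    (h : IsLevel N X S W l (sampleCard N l) pl ll)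
    (hrank : IsRank N X S (l + 1) (sampleCard N (l + 1)) r)
    (hlist : SufList N X S (l + 1) (sampleCard N (l + 1)) sam)
    (hAs : ∀ a < z, Sample N l (A a) ∧ A a / 3 ^ l % 3 = 0)
    (hAm : ∀ a b, a < b → b < z → sufVal N X S (A a) < sufVal N X S (A b))
    (hzs : z + sampleCard N (l + 1) = sampleCard N l) (hMU : sampleCard N l < U)
    (hNW : 5 * N + 2 < W) (hMB : N + 1 < B) :
    wp B mergeSuffixes s fun s' t => t ≤ 200 * sampleCard N l + 100 ∧
      SufList N X S l (sampleCard N l) (s'.mem aOut) := by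
  set M := sampleCard N l with hM
  set n := sampleCard N (l + 1) with hn
  have hMN : M ≤ N := sampleCard_le N l
  rw [mergeSuffixes, wp_seq, wp_assign]
  refine ⟨by simp; omega, ?_⟩
  rw [wp_seq, wp_assign]
  refine ⟨by simp; omega, ?_⟩
  simp only [ev_ofNat]
  refine wp_for 0 M 150 (fun q s' => s'.reg rA + s'.reg rB = q ∧
      MergeInv (sufVal N X S) (Sample N l) A sam z n (s'.reg rA) (s'.reg rB) (s'.mem aOut))
    ((hB.setReg (by omega)).setReg (by omega)) (by decide) (by omega) (by simp) (by omega)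
    (fun s' hF => by simp [hF.reg rLen (by decide), hlen]) ?_ ?_ ?_
  · simp
    exact ⟨by omega, by omega, by simp, by simp, by simp, by simp⟩
  · rintro q s' - hq hi hF hB' ⟨h1, h2⟩
    have e1 : s'.mem aLl = ll := by rw [hF.mem _ (by decide)]; simp [hll]
    have e2 : s'.reg rOff = l * W := by rw [hF.reg _ (by decide)]; simp [hoff]
    have e3 : s'.reg rSt = 3 ^ l := by rw [hF.reg _ (by decide)]; simp [hst]
    have e4 : s'.reg rZ = z := by rw [hF.reg _ (by decide)]; simp [hz]
    have e5 : s'.reg rU = U := by rw [hF.reg _ (by decide)]; simp [hU]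
    have e6 : s'.mem aRnk = r := by rw [hF.mem _ (by decide)]; simp [hr]
    have e7 : s'.mem aSam = sam := by rw [hF.mem _ (by decide)]; simp [hsam]
    have e8 : s'.reg rSub = n := by rw [hF.reg _ (by decide)]; simp [hsub]
    have e9 : s'.mem aOrd = s.mem aOrd := by rw [hF.mem _ (by decide)]; simp
    have e10 : s'.mem aIt = s.mem aIt := by rw [hF.mem _ (by decide)]; simp
    have hAB : s.mem aIt (s.mem aOrd (s'.reg rA)) < B := hB.2 _ _
    have hCB : sam (s'.reg rB) < B := by rw [← hsam]; exact hB.2 _ _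
    have haB : s'.reg rA < B := hB'.1 _
    have hbB : s'.reg rB < B := hB'.1 _
    have haz := h2.az
    have hbn := h2.bn
    -- moving one entry of either list
    have goA : s'.reg rA < z → (∀ i < n, s'.reg rB ≤ i →
        sufVal N X S (A (s'.reg rA)) < sufVal N X S (sam i)) →
        MergeInv (sufVal N X S) (Sample N l) A sam z n (s'.reg rA + 1) (s'.reg rB)
          (Function.update (s'.mem aOut) q (A (s'.reg rA))) := fun ha hlt =>
      h2.stepA ha (hAs _ ha).1 hAm hlt (fun t ht => Function.update_of_ne (by omega) _ _)
        (by rw [h1, Function.update_self])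
    have goC : s'.reg rB < n → (∀ i < z, s'.reg rA ≤ i →
        sufVal N X S (sam (s'.reg rB)) < sufVal N X S (A i)) →
        MergeInv (sufVal N X S) (Sample N l) A sam z n (s'.reg rA) (s'.reg rB + 1)
          (Function.update (s'.mem aOut) q (sam (s'.reg rB))) := fun hb hlt =>
      h2.stepC hb (Sample.succ_iff.1 (hlist.prop _ hb)).1 hlist.mono hlt
        (fun t ht => Function.update_of_ne (by omega) _ _) (by rw [h1, Function.update_self])
    have leA : ∀ i < z, s'.reg rA ≤ i →
        sufVal N X S (A (s'.reg rA)) ≤ sufVal N X S (A i) := fun i hi hai => by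
      rcases hai.lt_or_eq with h3 | h3
      · exact (hAm _ _ h3 hi).le
      · rw [h3]
    have leC : ∀ i < n, s'.reg rB ≤ i →
        sufVal N X S (sam (s'.reg rB)) ≤ sufVal N X S (sam i) := fun i hi hai => by
      rcases hai.lt_or_eq with h3 | h3
      · exact (hlist.mono _ _ h3 hi).le
      · rw [h3]
    have hcase : ∀ D : Prop, (D ↔ sufVal N X S (A (s'.reg rA)) < sufVal N X S (sam (s'.reg rB))) →
        s'.reg rA < z → s'.reg rB < n →
        (D → MergeInv (sufVal N X S) (Sample N l) A sam z n (s'.reg rA + 1) (s'.reg rB)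
          (Function.update (s'.mem aOut) q (A (s'.reg rA)))) ∧
        (¬ D → MergeInv (sufVal N X S) (Sample N l) A sam z n (s'.reg rA) (s'.reg rB + 1)
          (Function.update (s'.mem aOut) q (sam (s'.reg rB)))) := by
      intro D hD ha hb
      refine ⟨fun hd => goA ha fun i hi hbi => (hD.1 hd).trans_le (leC i hi hbi), fun hd =>
        goC hb fun i hi hai => lt_of_lt_of_le ?_ (leA i hi hai)⟩
      have h3 := mt hD.2 hd
      rcases lt_or_eq_of_le (not_lt.1 h3) with h4 | h4
      · exact h4
      · have h5 := hS.sufVal_inj (hlist.prop _ hb).1 (hAs _ ha).1.1 h4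
        have h6 := (Sample.succ_iff.1 (hlist.prop _ hb)).2
        rw [h5] at h6
        exact absurd (hAs _ ha).2 h6
    simp [hi, e1, e2, e3, e4, e5, e6, e7, e8, e9, e10, doubleKeyExpr]
    refine ⟨hAB, hCB, fun hb => ⟨fun ha => ?_, fun ha => ⟨by omega, hCB, by omega, by omega,
      goC hb fun i hi hai => by omega⟩⟩, fun hb => ⟨by omega, hAB, by omega, by omega, ?_⟩⟩
    · rw [hA _ ha] at hAB ⊢
      obtain ⟨⟨p1, p2⟩, p3⟩ := hAs _ ha
      obtain ⟨q1, q2⟩ := hlist.prop _ hb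
      rw [good_succ] at q2
      have p4 := p2.pow_le
      have q3 : sam (s'.reg rB) / 3 ^ l % 3 < 3 := Nat.mod_lt _ (by norm_num)
      refine ⟨fun hc => ?_, fun hc => ?_⟩
      · obtain ⟨g1, g2⟩ := hcase _ (h.pairKey_lt_iff (M' := n) (U := U) hrank hS (by omega) (by omega) (by omega) p2
          q2.1 (by simpa using good_next 1 p2 (by omega))
          (by simpa using good_next 1 q2.1 (by omega))) ha hb
        exact ⟨by split_ifs <;> omega, fun hd => ⟨hAB, by omega, by omega, g1 hd⟩,
          fun hd => ⟨hCB, by omega, by omega, g2 (not_lt.2 hd)⟩⟩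
      · obtain ⟨g1, g2⟩ := hcase _ (h.doubleKey_lt_iff (M' := n) hrank hS hMU (by omega) (by omega)
          (by omega) p2 q2.1 (good_next 2 p2 (by omega)) (good_next 2 q2.1 (by omega))) ha hb
        exact ⟨by split_ifs <;> omega, fun hd => ⟨hAB, by omega, by omega, g1 hd⟩,
          fun hd => ⟨hCB, by omega, by omega, g2 (not_lt.2 hd)⟩⟩
    · have ha : s'.reg rA < z := by omega
      rw [hA _ ha]
      exact goA ha fun i hi hbi => by omega
  intro s' t ht _ hF hB' ⟨h1, h2⟩
  simp at ht
  refine ⟨by simp; omega, ?_, ?_⟩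
  · rw [← h1]; exact h2.prop
  · rw [← h1]; exact h2.mono

/-- Collects the positions of the current level outside the next sample, with their keys. -/
def collectRest : Program :=
  rZ ≔ 0 ;;
  forLoop rQ 0 (rg rLen)
    (rX ≔ ld aPl (rg rOff + rg rQ) ;;
      .cond (rg rX / rg rSt % 3) .skip
        (.store aIt (rg rZ) (rg rX) ;;
          .store aKey (rg rZ) (ld aLl (rg rOff + rg rX) * rg rU + ld aRnk (rg rX + rg rSt)) ;;
          rZ ≔ rg rZ + 1))

theorem collectRest_spec {B N X W l M M' U : ℕ} {S pl ll r : ℕ → ℕ} {s : State} (hB : Bdd B s)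
    (hlen : s.reg rLen = M) (hoff : s.reg rOff = l * W) (hst : s.reg rSt = 3 ^ l)
    (hU : s.reg rU = U) (hpl : s.mem aPl = pl) (hll : s.mem aLl = ll) (hr : s.mem aRnk = r)
    (h : IsLevel N X S W l M pl ll) (hrank : IsRank N X S (l + 1) M' r) (hMU : M < U)
    (hMU' : M' < U) (hNW : N < W) (hUB : U ^ 2 < B) (hMB : M + 1 < B) :
    wp B collectRest s fun s' t => t ≤ 100 * M + 100 ∧
      s'.reg rZ ≤ M ∧
      IncList (s'.reg rZ) (s'.mem aIt) (fun x => Sample N l x ∧ x / 3 ^ l % 3 = 0) ∧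
      (∀ a < s'.reg rZ, s'.mem aKey a = pairKey ll r (l * W) (3 ^ l) U (s'.mem aIt a)) ∧
      ∀ a < s'.reg rZ, s'.mem aKey a < U ^ 2 := by
  rw [collectRest, wp_seq, wp_assign]
  refine ⟨by simp; omega, ?_⟩
  simp only [ev_ofNat]
  refine wp_for 0 M 60 (fun q s' => s'.reg rZ ≤ q ∧
      IncList (s'.reg rZ) (s'.mem aIt)
        (fun x => x / 3 ^ l % 3 = 0 ∧ ∃ q' < q, pl (l * W + q') = x) ∧
      (∀ a < s'.reg rZ, s'.mem aKey a = pairKey ll r (l * W) (3 ^ l) U (s'.mem aIt a)) ∧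
      ∀ a < s'.reg rZ, s'.mem aKey a < U ^ 2)
    (hB.setReg (by omega)) (by decide) (by omega) (by simp) (by omega)
    (fun s' hF => by simp [hF.reg rLen (by decide), hlen]) ?_ ?_ ?_
  · simp
    exact IncList.nil _ (by simp)
  · rintro q s' - hq hi hF hB' ⟨h1, h2, h3, h4⟩
    have e1 : s'.mem aLl = ll := by rw [hF.mem _ (by decide)]; simp [hll]
    have e2 : s'.reg rOff = l * W := by rw [hF.reg _ (by decide)]; simp [hoff]
    have e3 : s'.reg rSt = 3 ^ l := by rw [hF.reg _ (by decide)]; simp [hst]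
    have e4 : s'.mem aRnk = r := by rw [hF.mem _ (by decide)]; simp [hr]
    have e5 : s'.reg rU = U := by rw [hF.reg _ (by decide)]; simp [hU]
    have e7 : s'.mem aPl = pl := by rw [hF.mem _ (by decide)]; simp [hpl]
    obtain ⟨g1, g2⟩ := h.list.prop q hq
    have hzB : s'.reg rZ < B := hB'.1 _
    have hxB : pl (l * W + q) < B := e7 ▸ hB'.2 aPl _
    simp [hi, e1, e2, e3, e4, e5, e7]
    refine ⟨by omega, fun hD => ⟨by omega, ?_, h3, h4⟩,
      fun hD => ?_⟩
    · simpa only [Nat.lt_succ_iff] using h2.skip hD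
    have hlt : pairKey ll r (l * W) (3 ^ l) U (pl (l * W + q)) < U ^ 2 := by
      have k1 := h.le _ (by omega) g2
      have k2 := hrank.le (pl (l * W + q) + 3 ^ l)
        (by simpa using good_next 1 g2 (by omega))
      have k3 := Nat.mul_le_mul_right U (by omega : ll (l * W + pl (l * W + q)) + 1 ≤ U)
      rw [pairKey, pow_two]
      rw [Nat.succ_mul] at k3
      omega
    refine ⟨by omega, lt_trans hlt hUB, by omega, h1, ?_, ?_, ?_⟩
    · have h5 := h.list.push hq h2 hD
        (fun a ha => Function.update_of_ne (by omega) (pl (l * W + q)) (s'.mem aIt))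
        (Function.update_self _ _ _)
      simpa only [Nat.lt_succ_iff] using h5
    · intro a ha
      rcases ha.lt_or_eq with ha | rfl
      · rw [Function.update_of_ne (by omega), Function.update_of_ne (by omega)]
        exact h3 a ha
      · simp [pairKey]
    · intro a ha
      rcases ha.lt_or_eq with ha | rfl
      · rw [Function.update_of_ne (by omega)]
        exact h4 a ha
      · rw [Function.update_self]; exact hlt
  intro s' t ht _ hF hB' ⟨h1, h2, h3, h4⟩
  simp at ht
  exact ⟨by simp; omega, h1, h.list.filter h2, h3, h4⟩

/-- Stores the ranks of the positions in the sorted list `aSam`. -/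
def storeRanks : Program :=
  forLoop rQ 0 (rg rLen) (.store aRnk (ld aSam (rg rQ)) (rg rQ + 1))

theorem storeRanks_spec {B N X l : ℕ} {S sam : ℕ → ℕ} {s : State} (hB : Bdd B s)
    (hS : IsPadded N X S) (hlen : s.reg rLen = sampleCard N l) (hsam : s.mem aSam = sam)
    (hlist : SufList N X S l (sampleCard N l) sam) (h0 : ∀ p, N ≤ p → s.mem aRnk p = 0)
    (hMB : N + 1 < B) :
    wp B storeRanks s fun s' t => t ≤ 100 * sampleCard N l + 100 ∧
      IsRank N X S l (sampleCard N l) (s'.mem aRnk) ∧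
      (∀ t < sampleCard N l, s'.mem aRnk (sam t) = t + 1) ∧
      ∀ p, N ≤ p → s'.mem aRnk p = 0 := by
  have hMN := sampleCard_le N l
  refine wp_for 0 (sampleCard N l) 30 (fun q s' => (∀ t < q, s'.mem aRnk (sam t) = t + 1) ∧
      ∀ p, N ≤ p → s'.mem aRnk p = 0) hB (by decide) (by omega) (by simp) (by omega)
    (fun s' hF => by simp [hF.reg rLen (by decide), hlen]) (by simpa using h0) ?_ ?_
  · rintro q s' - hq hi hF hB' ⟨h1, h2⟩
    have e1 : s'.mem aSam = sam := by rw [hF.mem _ (by decide), hsam]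
    have h3 := (hlist.prop q hq).1
    simp [hi, e1]
    refine ⟨by omega, fun t ht => ?_, fun p hp => ?_⟩
    · rcases ht.lt_or_eq with ht | rfl
      · rw [Function.update_of_ne, h1 t ht]
        exact fun e => ht.ne (hlist.inj (by omega) hq e)
      · rw [Function.update_self]
    · rw [Function.update_of_ne (by omega)]
      exact h2 p hp
  intro s' t ht _ hF hB' ⟨h1, h2⟩
  simp at ht
  exact ⟨by omega, hlist.isRank hS h1 h2, h1, h2⟩

/-- Sorts the suffixes of level `rLev - 1`, given those of level `rLev` in sorted order. The
positions with digit `0`, which the latter lack, are sorted by their block and by the rank of the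
position one block further, which has digit `1`. -/
def ascendStep : Program :=
  storeRanks ;;
  rLev ≔ rg rLev - 1 ;;
  rOff ≔ rg rOff - rg rW ;;
  rSt ≔ rg rSt / 3 ;;
  rSub ≔ rg rLen ;;
  rLen ≔ ld aLen (rg rLev) ;;
  rU ≔ rg rLen + 2 ;;
  collectRest ;;
  rM ≔ rg rZ ;;
  radixSort ;;
  mergeSuffixes ;;
  forLoop rQ 0 (rg rLen) (.store aSam (rg rQ) (ld aOut (rg rQ)))

/-- The suffixes of level `l` have been sorted. -/
structure SortedLevel (N X : ℕ) (S : ℕ → ℕ) (W l : ℕ) (s : State) : Prop extends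
    LevelsUpTo N X S W l s where
  sam : SufList N X S l (sampleCard N l) (s.mem aSam)
  rnk : ∀ p, N ≤ p → s.mem aRnk p = 0

theorem ascendStep_spec {B N X W l : ℕ} {S : ℕ → ℕ} {s : State} (hB : Bdd B s)
    (hS : IsPadded N X S) (hNW : 5 * N + 2 < W) (hNB : 100 * (N + 2) ^ 4 < B)
    (h : SortedLevel N X S W (l + 1) s) (hl : 0 < sampleCard N l) :
    wp B ascendStep s fun s' t => t ≤ 10000 * sampleCard N l ∧ SortedLevel N X S W l s' := by
  have hMN : sampleCard N l ≤ N := sampleCard_le N l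
  have hsucc := sampleCard_succ_le N l
  have hN2 : N + 2 ≤ (N + 2) ^ 4 := Nat.le_self_pow (by norm_num) _
  have hNB1 : 100 * (N + 2) < B := by omega
  have hU3 : (sampleCard N l + 2) ^ 2 * (sampleCard N l + 2) ≤ (N + 2) ^ 4 := by
    rw [← pow_succ]
    exact (Nat.pow_le_pow_left (by omega) 3).trans (Nat.pow_le_pow_right (by omega) (by norm_num))
  have hU2 : (sampleCard N l + 2) ^ 2 ≤ (sampleCard N l + 2) ^ 2 * (sampleCard N l + 2) :=
    Nat.le_mul_of_pos_right _ (by omega)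
  rw [ascendStep, wp_seq]
  refine (storeRanks_spec (N := N) (l := l + 1) hB hS h.len rfl h.sam h.rnk
    (by omega)).call hB ?_
  rintro s1 t1 hF1 hB1 ⟨ht1, hrank, -, hr0⟩
  have a1 : s1.reg rOff = (l + 1) * W := by rw [hF1.reg _ (by decide), h.off]
  have a2 : s1.reg rSt = 3 ^ (l + 1) := by rw [hF1.reg _ (by decide), h.st]
  have a3 : s1.reg rW = W := by rw [hF1.reg _ (by decide), h.w]
  have a4 : s1.reg rLev = l + 1 := by rw [hF1.reg _ (by decide), h.lev]
  have a5 : s1.reg rLen = sampleCard N (l + 1) := by rw [hF1.reg _ (by decide), h.len]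
  have a6 : s1.mem aLen = s.mem aLen := by rw [hF1.mem _ (by decide)]
  have a7 : s1.mem aPl = s.mem aPl := by rw [hF1.mem _ (by decide)]
  have a8 : s1.mem aLl = s.mem aLl := by rw [hF1.mem _ (by decide)]
  have a9 : s1.mem aSam = s.mem aSam := by rw [hF1.mem _ (by decide)]
  have e1 : (l + 1) * W - W = l * W := by rw [Nat.succ_mul]; omega
  have e2 : (3 : ℕ) ^ (l + 1) / 3 = 3 ^ l := by rw [pow_succ]; omega
  have e3 : s.mem aLen l = sampleCard N l := h.lens l (by omega)
  have b1 : (l + 1) * W < B := a1 ▸ hB1.1 _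
  have b2 : 3 ^ (l + 1) < B := a2 ▸ hB1.1 _
  have b4 : l + 1 < B := a4 ▸ hB1.1 _
  simp only [wp_seq, wp_assign]
  simp [a1, a2, a3, a4, a5, a6, e1, e2, e3]
  refine ⟨by omega, by omega, by omega, by omega, by omega, by omega, ?_⟩
  generalize hs2 : State.setReg (State.setReg (State.setReg (State.setReg (State.setReg
    (State.setReg s1 _ _) _ _) _ _) _ _) _ _) _ _ = s2
  have hB2 : Bdd B s2 := by
    rw [← hs2]
    exact (((((hB1.setReg (by omega)).setReg (by omega)).setReg (by omega)).setReg
      (by omega)).setReg (by omega)).setReg (by omega)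
  have c1 : s2.reg rOff = l * W := by simp [← hs2]
  have c2 : s2.reg rSt = 3 ^ l := by simp [← hs2]
  have c3 : s2.reg rW = W := by simp [← hs2, a3]
  have c4 : s2.reg rLev = l := by simp [← hs2]
  have c5 : s2.reg rLen = sampleCard N l := by simp [← hs2]
  have c6 : s2.reg rSub = sampleCard N (l + 1) := by simp [← hs2]
  have c7 : s2.reg rU = sampleCard N l + 2 := by simp [← hs2]
  have c8 : s2.mem = s1.mem := by simp [← hs2]
  have hlev := h.level l (by omega)
  refine (collectRest_spec (l := l) (U := sampleCard N l + 2) hB2 c5 c1 c2 c7 (by rw [c8, a7])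
    (by rw [c8, a8]) (by rw [c8]) hlev hrank (by omega) (by omega) (by omega) (by omega)
    (by omega)).call hB2 ?_
  rintro s3 t3 hF3 hB3 ⟨ht3, hz, hlist, hkey, hklt⟩
  have hzs : s3.reg rZ + sampleCard N (l + 1) = sampleCard N l := by
    rw [← hlist.ncard]; exact sample_split N l
  set z := s3.reg rZ with hzdef
  have d1 : s3.reg rOff = l * W := by rw [hF3.reg _ (by decide), c1]
  have d2 : s3.reg rSt = 3 ^ l := by rw [hF3.reg _ (by decide), c2]
  have d3 : s3.reg rW = W := by rw [hF3.reg _ (by decide), c3]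
  have d4 : s3.reg rLev = l := by rw [hF3.reg _ (by decide), c4]
  have d5 : s3.reg rLen = sampleCard N l := by rw [hF3.reg _ (by decide), c5]
  have d6 : s3.reg rSub = sampleCard N (l + 1) := by rw [hF3.reg _ (by decide), c6]
  have d7 : s3.reg rU = sampleCard N l + 2 := by rw [hF3.reg _ (by decide), c7]
  have d8 : s3.mem aPl = s.mem aPl := by rw [hF3.mem _ (by decide), c8, a7]
  have d9 : s3.mem aLl = s.mem aLl := by rw [hF3.mem _ (by decide), c8, a8]
  have d10 : s3.mem aLen = s.mem aLen := by rw [hF3.mem _ (by decide), c8, a6]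
  have d11 : s3.mem aSam = s.mem aSam := by rw [hF3.mem _ (by decide), c8, a9]
  have d12 : s3.mem aRnk = s1.mem aRnk := by rw [hF3.mem _ (by decide), c8]
  refine ⟨by omega, ?_⟩
  have hB3' := hB3.setReg (x := rM) (v := z) (by omega)
  refine (radixSort_spec (M := z) (U := sampleCard N l + 2) (X := (sampleCard N l + 2) ^ 2)
    (c := 2) (K := s3.mem aKey) hB3' (by simp) (by simp [d7]) rfl (by omega) (by omega) (by omega)
    hklt (by positivity) (by omega) le_rfl).call hB3' ?_
  rintro s4 t4 hF4 hB4 ⟨ht4, hsorted⟩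
  have f1 : s4.reg rOff = l * W := by rw [hF4.reg _ (by decide)]; simp [d1]
  have f2 : s4.reg rSt = 3 ^ l := by rw [hF4.reg _ (by decide)]; simp [d2]
  have f3 : s4.reg rW = W := by rw [hF4.reg _ (by decide)]; simp [d3]
  have f4 : s4.reg rLev = l := by rw [hF4.reg _ (by decide)]; simp [d4]
  have f5 : s4.reg rLen = sampleCard N l := by rw [hF4.reg _ (by decide)]; simp [d5]
  have f6 : s4.reg rSub = sampleCard N (l + 1) := by rw [hF4.reg _ (by decide)]; simp [d6]
  have f7 : s4.reg rU = sampleCard N l + 2 := by rw [hF4.reg _ (by decide)]; simp [d7]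
  have f8 : s4.mem aPl = s.mem aPl := by rw [hF4.mem _ (by decide)]; simp [d8]
  have f9 : s4.mem aLl = s.mem aLl := by rw [hF4.mem _ (by decide)]; simp [d9]
  have f10 : s4.mem aLen = s.mem aLen := by rw [hF4.mem _ (by decide)]; simp [d10]
  have f11 : s4.mem aSam = s.mem aSam := by rw [hF4.mem _ (by decide)]; simp [d11]
  have f12 : s4.mem aRnk = s1.mem aRnk := by rw [hF4.mem _ (by decide)]; simp [d12]
  have f13 : s4.mem aIt = s3.mem aIt := by rw [hF4.mem _ (by decide)]; simp
  have f14 : s4.reg rZ = z := by rw [hF4.reg _ (by decide)]; simp [hzdef]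
  have hAs : ∀ a < z, Sample N l (s3.mem aIt (s4.mem aOrd a)) ∧
      s3.mem aIt (s4.mem aOrd a) / 3 ^ l % 3 = 0 := fun a ha =>
    hlist.prop _ (hsorted.lt a ha)
  have hAm : ∀ a b, a < b → b < z → sufVal N X S (s3.mem aIt (s4.mem aOrd a)) <
      sufVal N X S (s3.mem aIt (s4.mem aOrd b)) := by
    intro a b hab hb
    obtain ⟨⟨p1, p2⟩, p3⟩ := hAs a (by omega)
    obtain ⟨⟨q1, q2⟩, q3⟩ := hAs b hb
    have hle := hsorted.mono a b hab hb
    rw [hkey _ (hsorted.lt a (by omega)), hkey _ (hsorted.lt b hb)] at hle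
    have hiff := hlev.pairKey_lt_iff hrank hS (U := sampleCard N l + 2) (by omega)
      (p := s3.mem aIt (s4.mem aOrd b)) (q := s3.mem aIt (s4.mem aOrd a)) (by omega) (by omega)
      q2 p2 (by simpa using good_next 1 q2 (by omega)) (by simpa using good_next 1 p2 (by omega))
    refine lt_of_le_of_ne (not_lt.1 fun hc => absurd (hiff.2 hc) (by omega)) fun e => ?_
    have h1 := hlist.inj (hsorted.lt a (by omega)) (hsorted.lt b hb) (hS.sufVal_inj p1 q1 e)
    exact hab.ne (hsorted.inj a (by omega) b hb h1)
  refine (mergeSuffixes_spec (l := l) (U := sampleCard N l + 2) (z := z) (ll := s.mem aLl)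
    (A := fun a => s3.mem aIt (s4.mem aOrd a)) hB4 hS f5 f6 f14 f1 f2 f7 f9 f12 f11
    (fun a _ => by rw [f13]) hlev hrank h.sam hAs hAm hzs (by omega) hNW (by omega)).call hB4 ?_
  rintro s5 t5 hF5 hB5 ⟨ht5, hout⟩
  have g1 : s5.reg rOff = l * W := by rw [hF5.reg _ (by decide), f1]
  have g2 : s5.reg rSt = 3 ^ l := by rw [hF5.reg _ (by decide), f2]
  have g3 : s5.reg rW = W := by rw [hF5.reg _ (by decide), f3]
  have g4 : s5.reg rLev = l := by rw [hF5.reg _ (by decide), f4]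
  have g5 : s5.reg rLen = sampleCard N l := by rw [hF5.reg _ (by decide), f5]
  have g8 : s5.mem aPl = s.mem aPl := by rw [hF5.mem _ (by decide), f8]
  have g9 : s5.mem aLl = s.mem aLl := by rw [hF5.mem _ (by decide), f9]
  have g10 : s5.mem aLen = s.mem aLen := by rw [hF5.mem _ (by decide), f10]
  have g12 : s5.mem aRnk = s1.mem aRnk := by rw [hF5.mem _ (by decide), f12]
  refine wp_for 0 (sampleCard N l) 10 (fun q s' => ∀ t < q, s'.mem aSam t = s5.mem aOut t)
    hB5 (by decide) (by omega) (by simp) (by omega)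
    (fun s' hF => by simp [hF.reg rLen (by decide), g5]) (by simp) ?_ ?_
  · rintro q s' - hq hi hF hB' hI
    have e1 : s'.mem aOut = s5.mem aOut := by rw [hF.mem _ (by decide)]
    simp [hi, e1]
    refine ⟨hB5.2 _ _, fun q' hq' => ?_⟩
    rw [Function.update_apply]
    split_ifs with h
    · rw [h]
    · exact hI q' (by omega)
  intro s6 t6 ht6 _ hF6 hB6 hI6
  simp at ht6
  refine ⟨by omega, ⟨?_, ?_, ?_, ?_, ?_, ?_, ?_, ?_, ?_⟩, ⟨?_, ?_⟩, ?_⟩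
  · rw [hF6.reg _ (by decide), g3]
  · rw [hF6.reg _ (by decide), g1]
  · rw [hF6.reg _ (by decide), g2]
  · rw [hF6.reg _ (by decide), g4]
  · rw [hF6.reg _ (by decide), g5]
  · rw [hF6.mem _ (by decide), hF6.mem _ (by decide), g8, g9]
    exact fun l' hl' => h.level l' (by omega)
  · rw [hF6.mem _ (by decide), g10]
    exact fun l' hl' => h.lens l' (by omega)
  · rw [hF6.mem _ (by decide), g9]; exact h.zero
  · rw [hF6.mem _ (by decide), g9]; exact h.letters
  · intro t ht
    rw [hI6 t ht]; exact hout.prop t ht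
  · intro t t' htt ht'
    rw [hI6 t (by omega), hI6 t' ht']; exact hout.mono t t' htt ht'
  · rw [hF6.mem _ (by decide), g12]; exact hr0

/-- Level `0`: all positions, with the ranks of their keys in `aKey` as letters. The stride `rW`
between levels exceeds the furthest position, less than `5 * N + 2`, that a sorting key refers to. -/
def levelZero : Program :=
  rW ≔ 8 * rg rN + 8 ;;
  rOff ≔ 0 ;;
  forLoop rQ 0 (rg rN) (.store aPl (rg rQ) (rg rQ)) ;;
  rM ≔ rg rN ;;
  rU ≔ rg rN + 2 ;;
  radixSort ;;
  naming ;;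
  rLev ≔ 0 ;;
  rSt ≔ 1 ;;
  rLen ≔ rg rN ;;
  .store aLen 0 (rg rN)

theorem levelZero_spec {B N X₀ c : ℕ} {K : ℕ → ℕ} {s : State} (hB : Bdd B s)
    (hN : s.reg rN = N) (hK : s.mem aKey = K) (hll : ∀ i, s.mem aLl i = 0)
    (hK0 : ∀ x < N, 0 < K x) (hKX : ∀ x < N, K x < X₀) (hX0 : 0 < X₀)
    (hXc : X₀ ≤ (N + 2) ^ c) (hXB : X₀ * (N + 2) < B) (hNB : 100 * (N + 2) < B) :
    wp B levelZero s fun s' t => t ≤ 2000 * (N + 2) * (c + 1) ∧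
      ∃ S, IsPadded N (N + 1) S ∧ (∀ p < N, ∀ q < N, S p = S q ↔ K p = K q) ∧
        LevelsUpTo N (N + 1) S (8 * N + 8) 0 s' := by
  rw [levelZero, wp_seq, wp_assign]
  simp only [ev_add, ev_mul, ev_reg, ev_ofNat, hN]
  refine ⟨by omega, ?_⟩
  rw [wp_seq, wp_assign]
  refine ⟨by simp; omega, ?_⟩
  simp only [ev_ofNat]
  have hB1 : Bdd B ((s.setReg rW (8 * N + 8)).setReg rOff 0) :=
    (hB.setReg (by omega)).setReg (by omega)
  rw [wp_seq]
  refine wp_for 0 N 10 (fun q s' => ∀ u < q, s'.mem aPl u = u) hB1 (by decide) (by omega)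
    (by simp) (by omega) (fun s' hF => by simp [hF.reg rN (by decide), hN]) (by simp) ?_ ?_
  · intro q s' _ hq hi hF hB' hI
    simp [hi]
    refine ⟨by omega, fun u hu => ?_⟩
    rw [Function.update_apply]
    split_ifs with h
    · exact h.symm
    · exact hI u (by omega)
  intro s1 t1 ht1 _ hF1 hB1 hI1
  have a1 : s1.reg rN = N := by rw [hF1.reg _ (by decide)]; simp [hN]
  have a2 : s1.reg rW = 8 * N + 8 := by rw [hF1.reg _ (by decide)]; simp
  have a3 : s1.reg rOff = 0 := by rw [hF1.reg _ (by decide)]; simp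
  have a4 : s1.mem aKey = K := by rw [hF1.mem _ (by decide)]; simp [hK]
  have a5 : s1.mem aLl = s.mem aLl := by rw [hF1.mem _ (by decide)]; simp
  simp only [wp_seq, wp_assign, ev_add, ev_reg, ev_ofNat, reg_setReg, a1]
  refine ⟨by omega, by simp; omega, ?_⟩
  simp only [if_neg (by decide : ¬ rN = rM)]
  have hB2 : Bdd B ((s1.setReg rM N).setReg rU (N + 2)) :=
    (hB1.setReg (by omega)).setReg (by omega)
  refine (radixSort_spec (M := N) (U := N + 2) (X := X₀) (c := c) (K := K) hB2 (by simp) (by simp)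
    (by simp [a4]) (by omega) (by omega) (by omega) hKX hX0 hXB hXc).call hB2 ?_
  rintro s2 t2 hF2 hB2 ⟨ht2, hsorted⟩
  have b1 : s2.reg rN = N := by rw [hF2.reg _ (by decide)]; simp [a1]
  have b2 : s2.reg rW = 8 * N + 8 := by rw [hF2.reg _ (by decide)]; simp [a2]
  have b3 : s2.reg rOff = 0 := by rw [hF2.reg _ (by decide)]; simp [a3]
  have b4 : s2.mem aKey = K := by rw [hF2.mem _ (by decide)]; simp [a4]
  have b5 : s2.mem aLl = s.mem aLl := by rw [hF2.mem _ (by decide)]; simp [a5]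
  have b6 : s2.mem aPl = s1.mem aPl := by rw [hF2.mem _ (by decide)]; simp
  have b7 : s2.reg rM = N := by rw [hF2.reg _ (by decide)]; simp
  have hpl : ∀ x < N, s1.mem aPl x = x := hI1
  refine (naming_spec (M := N) (off := 0) (pl := s1.mem aPl) hB2 b7 b3 b4 b6 b5 (by omega) hsorted
    hK0 (fun x hx y hy e => by simpa [hpl x hx, hpl y hy] using e)).call hB2 ?_
  rintro s3 t3 hF3 hB3 ⟨ht3, hn1, hn2, hn3⟩
  have c1 : s3.reg rN = N := by rw [hF3.reg _ (by decide), b1]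
  have c2 : s3.reg rW = 8 * N + 8 := by rw [hF3.reg _ (by decide), b2]
  have c3 : s3.reg rOff = 0 := by rw [hF3.reg _ (by decide), b3]
  have c6 : s3.mem aPl = s1.mem aPl := by rw [hF3.mem _ (by decide), b6]
  simp only [zero_add] at hn1 hn2 hn3
  set S := s3.mem aLl with hSdef
  have hn1' : ∀ x < N, ∀ y < N, S x < S y ↔ K x < K y := fun x hx y hy => by
    have := hn1 x hx y hy
    rwa [hpl x hx, hpl y hy] at this
  have hn2' : ∀ x < N, 1 ≤ S x ∧ S x ≤ N := fun x hx => by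
    have := hn2 x hx
    rwa [hpl x hx] at this
  have hn3' : ∀ x, N ≤ x → S x = 0 := fun x hx => by
    rw [hn3 x fun y hy => by rw [hpl y hy]; omega]; exact hll x
  have hS : IsPadded N (N + 1) S := by
    refine ⟨fun i hi => (hn2' i hi).1, hn3', fun i => ?_⟩
    rcases lt_or_ge i N with hi | hi
    · have := (hn2' i hi).2; omega
    · rw [hn3' i hi]; omega
  simp [c1]
  refine ⟨by omega, by omega, by omega, ?_, S, hS, fun p hp q hq => ?_, ?_⟩
  · simp at ht1
    have h1 := Nat.le_mul_of_pos_right (2000 * (N + 2)) (by omega : 0 < c + 1)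
    have h2 : (300 * (N + (N + 2)) + 300) * (c + 1) ≤ (900 * (N + 2)) * (c + 1) :=
      Nat.mul_le_mul_right _ (by omega)
    have h3 : 2000 * (N + 2) * (c + 1) = (900 * (N + 2)) * (c + 1) + 1100 * (N + 2) * (c + 1) := by
      ring
    have h4 := Nat.le_mul_of_pos_right (1100 * (N + 2)) (by omega : 0 < c + 1)
    omega
  · have h1 := hn1' p hp q hq
    have h2 := hn1' q hq p hp
    omega
  · have hg : ∀ p, Good 0 p := fun p => by simp [Good]
    refine ⟨by simp [c2], by simp [c3], by simp, by simp, by simp [sampleCard_zero], ?_, ?_, ?_,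
      fun p hp => by simp [hSdef]⟩
    · intro l' hl'
      obtain rfl : l' = 0 := by omega
      rw [sampleCard_zero]
      simp only [mem_setMem, mem_setReg, c6]
      simp only [if_neg (by decide : ¬ aPl = aLen), if_neg (by decide : ¬ aLl = aLen),
        ← hSdef]
      refine ⟨⟨fun q hq => ?_, fun p q hpq hq => ?_, fun x hx => ?_⟩, fun p hp q hq _ _ => ?_,
        fun p hp _ => ?_, fun p hp _ => ?_⟩
      · simpa [hpl q hq] using ⟨hq, hg q⟩
      · simpa [hpl q hq, hpl p (by omega)] using hpq
      · exact ⟨x, hx.1, by simpa using hpl x hx.1⟩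
      · simp [blockVal]
      · have := hS.lt p; simp; omega
      · simpa using hS.pos p hp
    · intro l' hl'
      obtain rfl : l' = 0 := by omega
      simp [sampleCard_zero]
    · intro i hi
      simp only [mem_setMem, mem_setReg, if_neg (by decide : ¬ aLl = aLen)]
      exact hn3' i (hi.trans (Nat.mod_le _ _))

/-- Sorts all suffixes of a string whose letters are given as positive keys, into `aSam`, and ranks
them in `aRnk`. -/
def suffixSort : Program :=
  levelZero ;;
  .loop (rg rLen) descendStep ;;
  .loop (rg rLev) ascendStep ;;
  storeRanks

/-- The time is linear, as it is a constant per sample position of every level. The letters of the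
string `S` are the ranks of the given keys, so that `S` has the same equalities between letters. -/
theorem suffixSort_spec {B N X₀ c : ℕ} {K : ℕ → ℕ} {s : State} (hB : Bdd B s)
    (hN : s.reg rN = N) (hN0 : 0 < N) (hK : s.mem aKey = K) (hll : ∀ i, s.mem aLl i = 0)
    (hrnk : ∀ i, s.mem aRnk i = 0)
    (hK0 : ∀ x < N, 0 < K x) (hKX : ∀ x < N, K x < X₀) (hX0 : 0 < X₀)
    (hXc : X₀ ≤ (N + 2) ^ c) (hXB : X₀ * (N + 2) < B) (hNB : 100 * (N + 2) ^ 4 < B) :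
    wp B suffixSort s fun s' t => t ≤ 100000 * N * (c + 1) ∧
      ∃ S, IsPadded N (N + 1) S ∧ (∀ p < N, ∀ q < N, S p = S q ↔ K p = K q) ∧
        (∀ p < 8 * N + 8, s'.mem aLl p = S p) ∧ SufList N (N + 1) S 0 N (s'.mem aSam) ∧
        ∀ t < N, s'.mem aRnk (s'.mem aSam t) = t + 1 := by
  have hN2 : N + 2 ≤ (N + 2) ^ 4 := Nat.le_self_pow (by norm_num) _
  have hNB1 : 100 * (N + 2) < B := by omega
  rw [suffixSort, wp_seq]
  refine (levelZero_spec hB hN hK hll hK0 hKX hX0 hXc hXB hNB1).call hB ?_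
  rintro s1 t1 hF1 hB1 ⟨ht1, S, hS, hSK, h1⟩
  rw [wp_seq]
  have hr1 : s1.mem aRnk = s.mem aRnk := by rw [hF1.mem _ (by decide)]
  -- each step shrinks the sample by a third, which pays for it
  refine wp_while (fun s' => ∃ l, LevelsUpTo N (N + 1) S (8 * N + 8) l s' ∧
      ∀ l' < l, 0 < sampleCard N l') (fun s' => 30100 * s'.reg rLen) hB1 ⟨0, h1, by simp⟩ ?_ ?_
  · rintro s' hF hB' ⟨l, hl, hpos⟩ hne
    rw [ev_reg, hl.len] at hne
    refine (descendStep_spec hB' hS (by omega) le_rfl hNB hl (by omega)).mono ?_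
    rintro s'' t ⟨ht, hl'⟩
    refine ⟨⟨l + 1, hl', fun l' h => ?_⟩, ?_⟩
    · rcases Nat.lt_succ_iff_lt_or_eq.1 h with h | rfl
      · exact hpos l' h
      · omega
    · rw [hl.len, hl'.len]
      have := sampleCard_succ_le N l
      simp only [cost_reg]
      omega
  rintro s2 t2 hF2 hB2 ⟨L, hL, hpos⟩ hz ht2
  rw [ev_reg, hL.len] at hz
  rw [h1.len, hL.len, hz, sampleCard_zero] at ht2
  have hr2 : s2.mem aRnk = s.mem aRnk := by rw [hF2.mem _ (by decide), hr1]
  rw [wp_seq]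
  -- level `L` is empty, hence sorted; each step then sorts the level above
  refine wp_while (fun s' => ∃ l ≤ L, SortedLevel N (N + 1) S (8 * N + 8) l s')
    (fun s' => 10010 * ∑ i ∈ Finset.range (s'.reg rLev), sampleCard N i) hB2
    ⟨L, le_rfl, hL, ⟨by simp [hz], by simp [hz]⟩, fun p _ => by rw [hr2]; exact hrnk p⟩ ?_ ?_
  · rintro s' hF hB' ⟨l, hl, h⟩ hne
    rw [ev_reg, h.lev] at hne
    obtain ⟨l, rfl⟩ : ∃ k, l = k + 1 := ⟨l - 1, by omega⟩
    refine (ascendStep_spec hB' hS (by omega) hNB h (hpos l hl)).mono ?_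
    rintro s'' t ⟨ht, h'⟩
    refine ⟨⟨l, by omega, h'⟩, ?_⟩
    have := hpos l hl
    rw [h.lev, h'.lev, Finset.sum_range_succ]
    simp only [cost_reg]
    omega
  rintro s3 t3 hF3 hB3 ⟨l, hl, h3⟩ hz3 ht3
  rw [ev_reg, h3.lev] at hz3
  subst hz3
  have hsum := sum_sampleCard_le N L
  rw [hL.lev, h3.lev] at ht3
  simp only [Finset.range_zero, Finset.sum_empty, cost_reg] at ht3
  have hsam := h3.sam
  refine (storeRanks_spec (l := 0) hB3 hS h3.len rfl hsam h3.rnk (by omega)).call hB3 ?_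
  rintro s4 t4 hF4 hB4 ⟨ht4, -, hrank, -⟩
  rw [sampleCard_zero] at ht4 hrank hsam
  have e1 : s4.mem aSam = s3.mem aSam := by rw [hF4.mem _ (by decide)]
  have e2 : s4.mem aLl = s3.mem aLl := by rw [hF4.mem _ (by decide)]
  rw [e1, e2]
  refine ⟨?_, S, hS, hSK, h3.letters, hsam, hrank⟩
  have k1 : 2000 * (N + 2) * (c + 1) ≤ 6000 * N * (c + 1) :=
    Nat.mul_le_mul_right _ (by omega)
  have k2 : 100000 * N * (c + 1) = 6000 * N * (c + 1) + 94000 * N * (c + 1) := by ring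
  have k3 := Nat.le_mul_of_pos_right (94000 * N) (by omega : 0 < c + 1)
  simp only [cost_reg] at ht2
  omega

/-! ### Longest common prefixes of adjacent suffixes -/

notation "rH" => (34 : ℕ)
notation "rBs" => (35 : ℕ)
notation "rNb" => (36 : ℕ)
notation "rFst" => (37 : ℕ)
notation "rSnd" => (38 : ℕ)
notation "aG" => (21 : ℕ)
notation "aLg" => (22 : ℕ)
notation "aPw" => (23 : ℕ)
notation "aMk" => (24 : ℕ)
notation "aDp" => (25 : ℕ)
notation "aPsv" => (26 : ℕ)
notation "aSp" => (27 : ℕ)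

section
variable {N X : ℕ} {S : ℕ → ℕ}

/-- Distinct suffixes that agree on `h + 1` letters have more than `h` letters. -/
theorem IsPadded.add_lt (hS : IsPadded N X S) {p q h : ℕ} (hp : p < N) (hq : q < N) (hne : p ≠ q)
    (e : ∀ t ≤ h, S (p + t) = S (q + t)) : p + h < N ∧ q + h < N := by
  have key : ∀ p q, p < q → q < N → (∀ t ≤ h, S (p + t) = S (q + t)) → q + h < N := by
    intro p q hpq hq e
    by_contra hc
    have h1 := e (N - q) (by omega)
    rw [hS.zero (q + (N - q)) (by omega)] at h1
    have h2 := hS.pos (p + (N - q)) (by omega)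
    omega
  rcases Nat.lt_or_gt_of_ne hne with h1 | h1
  · have := key p q h1 hq e
    omega
  · have := key q p h1 hp fun t ht => (e t ht).symm
    omega

/-- Deleting the first letter of two adjacent suffixes with a common prefix of length at least `h`
leaves a suffix which shares at least `h - 1` letters with its predecessor. -/
theorem SufList.shift {f : ℕ → ℕ} (hf : SufList N X S 0 N f) (hS : IsPadded N X S) {t u h : ℕ}
    (ht : t + 1 < N) (hu : u < N) (hfu : f u = f (t + 1) + 1) (hh : 2 ≤ h)
    (e : ∀ i < h, S (f (t + 1) + i) = S (f t + i)) :
    0 < u ∧ ∀ i < h - 1, S (f u + i) = S (f (u - 1) + i) := by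
  have hp := (hf.prop (t + 1) ht).1
  have hq := (hf.prop t (by omega)).1
  have hlt := hf.mono t (t + 1) (by omega) ht
  have hne : f (t + 1) ≠ f t := fun e => by rw [e] at hlt; omega
  obtain ⟨h1, h2⟩ := hS.add_lt (h := 1) hp hq hne fun i hi => e i (by omega)
  have hlt' : sufVal N X S (f t + 1) < sufVal N X S (f (t + 1) + 1) := by
    rcases (hS.sufVal_lt_iff 1 _ _).1 hlt with h3 | h3
    · have := e 0 (by omega)
      simp [blockVal] at h3 this
      omega
    · exact h3.2
  have hb : blockVal S X (f t + 1) (h - 1) = blockVal S X (f (t + 1) + 1) (h - 1) := by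
    rw [hS.blockVal_eq_iff]
    intro i hi
    have := e (i + 1) (by omega)
    rw [add_assoc, add_assoc, add_comm 1 i, this]
  have hcard := sampleCard_zero N
  obtain ⟨v, hv, hfv⟩ := SufList.surj (f := f) (l := 0) (by rwa [hcard])
    (⟨h2, by simp [Good]⟩ : Sample N 0 (f t + 1))
  rw [hcard] at hv
  rw [← hfv, ← hfu] at hlt' hb
  have hvu : v < u := by
    by_contra hc
    rcases (not_lt.1 hc).lt_or_eq with h3 | h3
    · have := hf.mono u v h3 hv; omega
    · subst h3; omega
  refine ⟨by omega, ?_⟩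
  rw [← hS.blockVal_eq_iff (X := X)]
  have hle1 : sufVal N X S (f v) ≤ sufVal N X S (f (u - 1)) := by
    rcases (by omega : v ≤ u - 1).lt_or_eq with h3 | h3
    · exact (hf.mono v (u - 1) h3 (by omega)).le
    · rw [h3]
  have hle2 := (hf.mono (u - 1) u (by omega) hu).le
  have k1 := hS.blockVal_le hle1 (h - 1)
  have k2 := hS.blockVal_le hle2 (h - 1)
  omega

/-- `v` is the length of the longest common prefix of the suffixes at `p` and `q`. -/
def IsLcp (S : ℕ → ℕ) (p q v : ℕ) : Prop := ∀ h, h ≤ v ↔ ∀ i < h, S (p + i) = S (q + i)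

theorem IsLcp.intro {p q v : ℕ} (h : ∀ i < v, S (p + i) = S (q + i)) (hv : S (p + v) ≠ S (q + v)) :
    IsLcp S p q v := fun k =>
  ⟨fun hk i hi => h i (by omega), fun hk => by
    by_contra hc
    exact hv (hk v (by omega))⟩

theorem IsLcp.symm {p q v : ℕ} (h : IsLcp S p q v) : IsLcp S q p v := fun k =>
  (h k).trans (forall₂_congr fun _ _ => eq_comm)

/-- The longest common prefix of two suffixes is the minimum over the adjacent pairs between them
in sorted order. -/
theorem SufList.isLcp_of_min {f g : ℕ → ℕ} (hf : SufList N X S 0 N f) (hS : IsPadded N X S)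
    (hg : ∀ t, t + 1 < N → IsLcp S (f t) (f (t + 1)) (g t)) {t u v : ℕ} (htu : t < u) (hu : u < N)
    (hv : ∀ h, h ≤ v ↔ ∀ y, t ≤ y → y < u → h ≤ g y) : IsLcp S (f t) (f u) v := by
  intro h
  rw [hv]
  constructor
  · intro hh
    have key : ∀ k, t + k ≤ u → ∀ i < h, S (f t + i) = S (f (t + k) + i) := by
      intro k
      induction k with
      | zero => intro _ i _; rfl
      | succ k ih =>
        intro hk i hi
        rw [ih (by omega) i hi]
        exact (hg (t + k) (by omega) h).1 (hh (t + k) (by omega) (by omega)) i hi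
    have := key (u - t) (by omega)
    rwa [show t + (u - t) = u by omega] at this
  · intro hh y hty hyu
    rw [hg y (by omega), ← hS.blockVal_eq_iff (X := X)]
    rw [← hS.blockVal_eq_iff (X := X)] at hh
    have mono : ∀ a b, a ≤ b → b < N → blockVal S X (f a) h ≤ blockVal S X (f b) h := by
      intro a b hab hb
      refine hS.blockVal_le ?_ h
      rcases hab.lt_or_eq with h3 | h3
      · exact (hf.mono a b h3 hb).le
      · rw [h3]
    have k1 := mono t y hty (by omega)
    have k2 := mono y (y + 1) (by omega) (by omega)
    have k3 := mono (y + 1) u (by omega) hu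
    omega

end

/-- Kasai's algorithm: visits the positions from left to right and stores in `aG[t]` the length of
the longest common prefix of the suffixes `t` and `t + 1` in sorted order. -/
def kasai : Program :=
  rI ≔ 0 ;;
  rH ≔ 0 ;;
  .loop (rg rI <! rg rN)
    (rX ≔ ld aRnk (rg rI) ;;
      .cond (1 <! rg rX)
        (rY ≔ ld aSam (rg rX - 2) ;;
          .cond (ld aLl (rg rI + rg rH) =! ld aLl (rg rY + rg rH))
            (rH ≔ rg rH + 1)
            (.store aG (rg rX - 2) (rg rH) ;; rI ≔ rg rI + 1 ;; rH ≔ rg rH - 1))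
        (rI ≔ rg rI + 1))

theorem kasai_spec {B N X : ℕ} {S f : ℕ → ℕ} {s : State} (hB : Bdd B s) (hS : IsPadded N X S)
    (hN : s.reg rN = N) (hll : ∀ p < 8 * N + 8, s.mem aLl p = S p) (hsam : s.mem aSam = f)
    (hf : SufList N X S 0 N f) (hrnk : ∀ t < N, s.mem aRnk (f t) = t + 1) (hNB : N + 1 < B) :
    wp B kasai s fun s' t => t ≤ 100 * N + 100 ∧
      ∀ t, t + 1 < N → IsLcp S (f t) (f (t + 1)) (s'.mem aG t) := by
  rw [kasai, wp_seq, wp_assign]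
  refine ⟨by simp; omega, ?_⟩
  rw [wp_seq, wp_assign]
  refine ⟨by simp; omega, ?_⟩
  simp only [ev_ofNat]
  have hcard := sampleCard_zero N
  have surj : ∀ p < N, ∃ t < N, f t = p := fun p hp => by
    have := SufList.surj (f := f) (l := 0) (by rwa [hcard]) (⟨hp, by simp [Good]⟩ : Sample N 0 p)
    rwa [hcard] at this
  -- `rH` is a lower bound on the common prefix of suffix `rI` and its predecessor. A matching letter
  -- increases it; otherwise `rI` increases by one, and `rH` drops by at most one.
  refine wp_while (fun s' => s'.reg rI + s'.reg rH ≤ N ∧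
      (∀ t < N, f t = s'.reg rI → (t = 0 → s'.reg rH = 0) ∧
        (0 < t → ∀ i < s'.reg rH, S (f t + i) = S (f (t - 1) + i))) ∧
      ∀ t, t + 1 < N → f (t + 1) < s'.reg rI → IsLcp S (f t) (f (t + 1)) (s'.mem aG t))
    (fun s' => 50 * (2 * (N - s'.reg rI) - s'.reg rH))
    ((hB.setReg (by omega)).setReg (by omega)) (by simp) ?_ ?_
  · rintro s' hF hB' ⟨h1, h2, h3⟩ hne
    have e1 : s'.mem aRnk = s.mem aRnk := by rw [hF.mem _ (by decide)]; simp
    have e2 : s'.mem aSam = f := by rw [hF.mem _ (by decide)]; simp [hsam]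
    have e3 : s'.mem aLl = s.mem aLl := by rw [hF.mem _ (by decide)]; simp
    have e4 : s'.reg rN = N := by rw [hF.reg _ (by decide)]; simp [hN]
    have hlt : s'.reg rI < N := by
      by_contra hc; simp [e4, hc] at hne
    obtain ⟨t, ht, hft⟩ := surj _ hlt
    obtain ⟨h4, h5⟩ := h2 t ht hft
    have e5 : s.mem aRnk (s'.reg rI) = t + 1 := by rw [← hft, hrnk t ht]
    set p := s'.reg rI with hp
    set h := s'.reg rH with hh
    simp [e1, e2, e3, e5, ← hp, ← hh]
    refine ⟨by omega, fun ht0 => ?_, fun ht0 => ?_⟩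
    · obtain ⟨t, rfl⟩ : ∃ k, t = k + 1 := ⟨t - 1, by omega⟩
      have hq := (hf.prop t (by omega)).1
      have e6 : t + 1 - 1 = t := by omega
      have h5' := h5 (by omega)
      simp only [Nat.add_sub_cancel] at h5'
      rw [hft] at h5'
      have hne : p ≠ f t := fun e => by
        have := hf.inj ht (by omega : t < N) (by rw [hft, e])
        omega
      rw [e6, hll _ (by omega), hll _ (by omega)]
      refine ⟨by omega, fun heq => ?_, fun hneq => ?_⟩
      · obtain ⟨k1, k2⟩ := hS.add_lt (h := h) hlt hq hne fun i hi => by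
          rcases hi.lt_or_eq with hi | rfl
          · exact h5' i hi
          · exact heq
        refine ⟨by omega, ⟨by omega, fun t' ht' hft' => ?_, h3⟩, by omega⟩
        have : t' = t + 1 := hf.inj ht' ht (by rw [hft, hft'])
        subst this
        refine ⟨by omega, fun _ i hi => ?_⟩
        rw [hft, Nat.add_sub_cancel]
        rcases hi.lt_or_eq with hi | rfl
        · exact h5' i hi
        · exact heq
      · have hlcp : IsLcp S p (f t) h := IsLcp.intro h5' hneq
        refine ⟨by omega, by omega, by omega, ⟨by omega, fun u hu hfu => ?_, fun u hu hfu => ?_⟩,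
          by omega⟩
        · rcases Nat.lt_or_ge h 2 with h6 | h6
          · refine ⟨by omega, fun _ i hi => by omega⟩
          · obtain ⟨k1, k2⟩ := hf.shift hS ht hu (by rw [hft, hfu]) h6 (by rwa [hft])
            exact ⟨by omega, fun _ => k2⟩
        · by_cases hut : u = t
          · subst hut
            rw [Function.update_self, hft]
            exact hlcp.symm
          · rw [Function.update_of_ne hut]
            refine h3 u hu (lt_of_le_of_ne (by omega) fun e => hut ?_)
            have := hf.inj hu ht (by rw [hft, e])
            omega
    · have hh0 := h4 ht0
      refine ⟨by omega, ⟨by omega, fun u hu hfu => ⟨fun _ => hh0, fun _ i hi => by omega⟩,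
        fun u hu hfu => ?_⟩, by omega⟩
      refine h3 u hu (lt_of_le_of_ne (by omega) fun e => ?_)
      have := hf.inj hu ht (by rw [hft, e])
      omega
  · rintro s' t hF hB' ⟨h1, h2, h3⟩ he ht
    have e4 : s'.reg rN = N := by rw [hF.reg _ (by decide)]; simp [hN]
    have hge : N ≤ s'.reg rI := by
      by_contra hc; simp [e4, not_lt] at he; omega
    simp at ht
    refine ⟨by simp; omega, fun t ht => h3 t ht ?_⟩
    have := (hf.prop (t + 1) ht).1
    omega

/-! ### Range minimum queries -/

section
variable {g : ℕ → ℕ} {b : ℕ}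

/-- `v` is the minimum of `g` on `[l, r)`. -/
def MinOn (g : ℕ → ℕ) (l r v : ℕ) : Prop := ∀ h, h ≤ v ↔ ∀ y, l ≤ y → y < r → h ≤ g y

theorem MinOn.of_mem {l r x : ℕ} (h1 : l ≤ x) (h2 : x < r) (h : ∀ y, l ≤ y → y < r → g x ≤ g y) :
    MinOn g l r (g x) := fun _ =>
  ⟨fun hh y hy hy' => hh.trans (h y hy hy'), fun hh => hh x h1 h2⟩

theorem MinOn.union {l m l' r v w : ℕ} (h1 : MinOn g l m v) (h2 : MinOn g l' r w) (hl : l ≤ l')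
    (hm : l' ≤ m) (hr : m ≤ r) : MinOn g l r (min v w) := by
  intro h
  rw [le_min_iff, h1, h2]
  constructor
  · rintro ⟨h3, h4⟩ y hy hy'
    rcases Nat.lt_or_ge y m with h5 | h5
    · exact h3 y hy h5
    · exact h4 y (by omega) hy'
  · exact fun h3 => ⟨fun y _ _ => h3 y (by omega) (by omega), fun y _ _ => h3 y (by omega) (by omega)⟩

/-- The number `m < 2 ^ b` describes the stack of suffix minima of `g` on `[s, s + o]`, offset `x`
being represented by bit `b - 1 - x`: for every `l ≤ o`, the highest bit of `m` among those of the
offsets `≥ l` belongs to the position of a minimum of `g` on `[s + l, s + o]`. -/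
structure StackMask (b : ℕ) (g : ℕ → ℕ) (s o m : ℕ) : Prop where
  dvd : 2 ^ (b - 1 - o) ∣ m
  lt : m < 2 ^ b
  min : ∀ l ≤ o, ∃ x, l ≤ x ∧ x ≤ o ∧ m % 2 ^ (b - l) ≠ 0 ∧
    Nat.log 2 (m % 2 ^ (b - l)) = b - 1 - x ∧ ∀ y, l ≤ y → y ≤ o → g (s + x) ≤ g (s + y)

theorem add_lt_of_dvd {d e u v : ℕ} (hu : d ∣ u) (hv : d ∣ v) (huv : u < v) (he : e < d) :
    u + e < v := by
  obtain ⟨x, rfl⟩ := hu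
  obtain ⟨y, rfl⟩ := hv
  have h1 : x < y := lt_of_mul_lt_mul_left huv (Nat.zero_le d)
  have h2 : d * (x + 1) ≤ d * y := Nat.mul_le_mul le_rfl h1
  rw [Nat.mul_add, mul_one] at h2
  omega

/-- A block element that lies below everything before it. -/
theorem StackMask.single {s o : ℕ} (ho : o < b) (h : ∀ y < o, g (s + o) ≤ g (s + y)) :
    StackMask b g s o (2 ^ (b - 1 - o)) := by
  refine ⟨dvd_rfl, Nat.pow_lt_pow_right (by omega) (by omega), fun l hl => ⟨o, hl, le_rfl, ?_⟩⟩
  rw [Nat.mod_eq_of_lt (Nat.pow_lt_pow_right (by omega) (by omega))]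
  refine ⟨by positivity, Nat.log_pow (by omega) _, fun y _ hy => ?_⟩
  rcases hy.lt_or_eq with h1 | rfl
  · exact h y h1
  · exact le_rfl

/-- Pushing offset `o` on top of offset `p`. -/
theorem StackMask.push {s o p m : ℕ} (h : StackMask b g s p m) (hp : p < o) (ho : o < b)
    (hg : g (s + p) ≤ g (s + o)) (hy : ∀ y, p < y → y < o → g (s + o) ≤ g (s + y)) :
    StackMask b g s o (m + 2 ^ (b - 1 - o)) := by
  have hlt : 2 ^ (b - 1 - o) < 2 ^ (b - 1 - p) := Nat.pow_lt_pow_right (by omega) (by omega)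
  have hadd : ∀ l ≤ p, (m + 2 ^ (b - 1 - o)) % 2 ^ (b - l) =
      m % 2 ^ (b - l) + 2 ^ (b - 1 - o) := by
    intro l hl
    have hd : 2 ^ (b - 1 - p) ∣ 2 ^ (b - l) := pow_dvd_pow 2 (by omega)
    have h1 := add_lt_of_dvd ((Nat.dvd_mod_iff hd).2 h.dvd) hd
      (Nat.mod_lt m (by positivity : 0 < 2 ^ (b - l))) hlt
    rw [Nat.add_mod, Nat.mod_eq_of_lt (Nat.pow_lt_pow_right (by omega) (by omega) :
      2 ^ (b - 1 - o) < 2 ^ (b - l)), Nat.mod_eq_of_lt h1]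
  refine ⟨(Nat.dvd_add_left dvd_rfl).2 ((pow_dvd_pow 2 (by omega)).trans h.dvd),
    add_lt_of_dvd h.dvd (pow_dvd_pow 2 (by omega)) h.lt hlt, fun l hl => ?_⟩
  rcases Nat.lt_or_ge p l with hl' | hl'
  · refine ⟨o, hl, le_rfl, ?_⟩
    have h0 : m % 2 ^ (b - l) = 0 :=
      Nat.mod_eq_zero_of_dvd ((pow_dvd_pow 2 (by omega)).trans h.dvd)
    rw [Nat.add_mod, h0, Nat.zero_add, Nat.mod_mod,
      Nat.mod_eq_of_lt (Nat.pow_lt_pow_right (by omega) (by omega))]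
    refine ⟨by positivity, Nat.log_pow (by omega) _, fun y hy1 hy2 => ?_⟩
    rcases hy2.lt_or_eq with h1 | rfl
    · exact hy y (by omega) h1
    · exact le_rfl
  · obtain ⟨x, h1, h2, h3, h4, h5⟩ := h.min l hl'
    refine ⟨x, h1, by omega, ?_⟩
    rw [hadd l hl']
    have hne : m % 2 ^ (b - l) + 2 ^ (b - 1 - o) ≠ 0 := by positivity
    refine ⟨hne, ?_, fun y hy1 hy2 => ?_⟩
    · have hv1 := Nat.pow_log_le_self 2 h3
      have hv2 := Nat.lt_pow_succ_log_self (b := 2) (by omega) (m % 2 ^ (b - l))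
      rw [h4] at hv1 hv2
      refine (Nat.log_eq_iff (Or.inr ⟨by omega, hne⟩)).2 ⟨hv1.trans (Nat.le_add_right _ _), ?_⟩
      exact add_lt_of_dvd ((Nat.dvd_mod_iff (pow_dvd_pow 2 (by omega))).2 h.dvd)
        (pow_dvd_pow 2 (by omega)) hv2 hlt
    · rcases Nat.lt_or_ge p y with h6 | h6
      · refine (h5 p (by omega) le_rfl).trans (hg.trans ?_)
        rcases hy2.lt_or_eq with h7 | rfl
        · exact hy y h6 h7
        · exact le_rfl
      · exact h5 y hy1 h6

end

/-- Tabulates binary logarithms up to `rN` and powers of two up to `rBs`, the binary logarithm of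
`rN`. -/
def logTables : Program :=
  .store aLg 1 0 ;;
  forLoop rI 2 (rg rN + 1) (.store aLg (rg rI) (ld aLg (rg rI / 2) + 1)) ;;
  rBs ≔ ld aLg (rg rN) ;;
  .store aPw 0 1 ;;
  forLoop rI 0 (rg rBs) (.store aPw (rg rI + 1) (ld aPw (rg rI) * 2))

/-- The block length `rBs` is the binary logarithm of `N`, so that a mask is at most `N`. -/
theorem logTables_spec {B N : ℕ} {s : State} (hB : Bdd B s) (hN : s.reg rN = N) (hN2 : 2 ≤ N)
    (hNB : 2 * N + 2 < B) :
    wp B logTables s fun s' t => t ≤ 100 * N + 100 ∧ s'.reg rBs = Nat.log 2 N ∧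
      (∀ x, 1 ≤ x → x ≤ N → s'.mem aLg x = Nat.log 2 x) ∧
      ∀ t ≤ Nat.log 2 N, s'.mem aPw t = 2 ^ t := by
  have hlogN : ∀ x ≤ N, Nat.log 2 x ≤ N := fun x hx => (Nat.log_le_self 2 x).trans hx
  rw [logTables, wp_seq, wp_store]
  refine ⟨by simp; omega, ?_⟩
  have hB1 : Bdd B (s.setMem aLg (Expr.ev s 1) (Expr.ev s 0)) := hB.setMem (by simp; omega)
  rw [wp_seq]
  refine wp_for 2 (N + 1) 20
    (fun q s' => ∀ x, 1 ≤ x → x < q → s'.mem aLg x = Nat.log 2 x) hB1 (by decide) (by omega)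
    (by simp) (by omega) ?_ ?_ ?_ ?_
  · intro s' hF
    simp [hF.reg rN (by decide), hN]
  · intro x h1 h2
    obtain rfl : x = 1 := by omega
    simp
  · intro q s' hq1 hq2 hi hF hB' hI
    have e := hI (q / 2) (by omega) (by omega)
    have e2 : Nat.log 2 q = Nat.log 2 (q / 2) + 1 := Nat.log_of_one_lt_of_le (by omega) hq1
    have := hlogN q (by omega)
    obtain ⟨d, hd⟩ : ∃ d, d = Nat.log 2 (q / 2) := ⟨_, rfl⟩
    rw [← hd] at e e2
    simp [hi, e]
    refine ⟨by omega, fun x h1 h2 => ?_⟩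
    rcases h2.lt_or_eq with h3 | rfl
    · rw [Function.update_of_ne (by omega)]; exact hI x h1 h3
    · simp [e2]
  · intro s1 t1 ht1 _ hF1 hB1 hI1
    have e1 : s1.reg rN = N := by rw [hF1.reg _ (by decide)]; simp [hN]
    have e2 := hI1 N (by omega) (by omega)
    have h3 := hlogN N le_rfl
    rw [wp_seq, wp_assign]
    simp only [ev_load, ev_reg, e1, e2]
    refine ⟨by omega, ?_⟩
    rw [wp_seq, wp_store]
    refine ⟨by simp; omega, ?_⟩
    have hpow : 2 ^ Nat.log 2 N ≤ N := Nat.pow_log_le_self 2 (by omega)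
    refine wp_for 0 (Nat.log 2 N) 20
      (fun q s' => ∀ t ≤ q, s'.mem aPw t = 2 ^ t) ((hB1.setReg (by omega)).setMem (by simp; omega))
      (by decide) (by omega) (by simp) (by omega) ?_ ?_ ?_ ?_
    · intro s' hF
      simp [hF.reg rBs (by decide)]
    · intro t ht
      obtain rfl : t = 0 := by omega
      simp
    · intro q s' hq1 hq2 hi hF hB' hI
      have e := hI q le_rfl
      have h4 : 2 ^ (q + 1) ≤ 2 ^ Nat.log 2 N := Nat.pow_le_pow_right (by omega) (by omega)
      rw [pow_succ] at h4
      simp [hi, e]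
      refine ⟨by omega, fun x h1 => ?_⟩
      rcases h1.lt_or_eq with h3 | rfl
      · rw [Function.update_of_ne (by omega)]; exact hI x (by omega)
      · simp [pow_succ]
    · intro s2 t2 ht2 _ hF2 hB2 hI2
      simp at ht1 ht2
      refine ⟨by simp; omega, ?_, ?_, hI2⟩
      · rw [hF2.reg _ (by decide)]; simp
      · rw [hF2.mem _ (by decide)]
        simpa using fun x h1 h2 => hI1 x h1 (by omega)

/-- Computes the stack of suffix minima of every prefix of every block of `rBs` numbers. The
pointer `rX` runs down the current stack; pointers are positions plus one, and `0` is the bottom.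
-/
def stackMasks : Program :=
  .store aMk 0 0 ;;
  .store aDp 0 0 ;;
  rI ≔ 0 ;;
  rX ≔ 0 ;;
  .loop (rg rI <! rg rN)
    (.cond ((0 <! rg rX) * (ld aG (rg rI) <! ld aG (rg rX - 1) + 1))
      (rX ≔ ld aPsv (rg rX))
      (.store aPsv (rg rI + 1) (rg rX) ;;
        .store aMk (rg rI + 1) (ld aMk (rg rX) + ld aPw (rg rBs - 1 - rg rI % rg rBs)) ;;
        .store aDp (rg rI + 1) (ld aDp (rg rX) + 1) ;;
        rI ≔ rg rI + 1 ;;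
        .cond (rg rI % rg rBs) (rX ≔ rg rI) (rX ≔ 0)))

theorem succ_mod_cases {b : ℕ} (hb : 0 < b) (r : ℕ) :
    ((r + 1) % b = 0 ∧ (r + 1) / b * b = r + 1) ∨
      ((r + 1) % b = r % b + 1 ∧ (r + 1) / b = r / b) := by
  have h1 := Nat.div_add_mod r b
  have h2 := Nat.mod_lt r hb
  rcases (by omega : r % b + 1 ≤ b).lt_or_eq with h | h
  · right
    have := (Nat.div_mod_unique (a := r + 1) (c := r % b + 1) (d := r / b) hb).2 ⟨by omega, h⟩
    exact ⟨this.2, this.1⟩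
  · left
    have := (Nat.div_mod_unique (a := r + 1) (c := 0) (d := r / b + 1) hb).2
      ⟨by rw [Nat.mul_add, mul_one]; omega, hb⟩
    exact ⟨this.2, by rw [this.1, Nat.add_mul, mul_comm, one_mul]; omega⟩

/-- `p` points into the block of `r`, and on the block between `p` and `r` no value is less than
that at `r`. -/
def StackPtr (b : ℕ) (g : ℕ → ℕ) (r p : ℕ) : Prop :=
  (0 < p → r / b * b < p ∧ p ≤ r) ∧ ∀ y, r / b * b ≤ y → p ≤ y → y < r → g r ≤ g y

theorem stackMasks_spec {B N b : ℕ} {g : ℕ → ℕ} {s : State} (hB : Bdd B s) (hN : s.reg rN = N)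
    (hb : 0 < b) (hbs : s.reg rBs = b) (hpw : ∀ t ≤ b, s.mem aPw t = 2 ^ t) (hg : s.mem aG = g)
    (hNB : N + 2 < B) (hbB : 2 ^ b < B) :
    wp B stackMasks s fun s' t => t ≤ 200 * N + 200 ∧
      ∀ r < N, StackMask b g (r / b * b) (r % b) (s'.mem aMk (r + 1)) := by
  have h0 : ∀ {s : State}, Bdd B (s : State) → ∀ a i, Bdd B (s.setMem a i 0) := fun h a i =>
    h.setMem (by omega)
  rw [stackMasks, wp_seq, wp_store, wp_seq, wp_store, wp_seq, wp_assign, wp_seq, wp_assign]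
  simp only [ev_ofNat]
  refine ⟨by omega, by omega, by omega, by omega, ?_⟩
  -- `aDp` is the height of the stack: every position is pushed once, and popped at most once
  refine wp_while (fun s' => s'.reg rI ≤ N ∧ s'.mem aMk 0 = 0 ∧ s'.mem aDp 0 = 0 ∧
      (s'.reg rI < N → StackPtr b g (s'.reg rI) (s'.reg rX)) ∧ s'.reg rX ≤ s'.reg rI ∧
      ∀ r < s'.reg rI, StackMask b g (r / b * b) (r % b) (s'.mem aMk (r + 1)) ∧
        s'.mem aDp (r + 1) = s'.mem aDp (s'.mem aPsv (r + 1)) + 1 ∧ s'.mem aDp (r + 1) ≤ r + 1 ∧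
        s'.mem aPsv (r + 1) ≤ r ∧
        StackPtr b g r (s'.mem aPsv (r + 1)))
    (fun s' => 80 * (2 * (N - s'.reg rI) + s'.mem aDp (s'.reg rX)))
    (((h0 (h0 hB _ _) _ _).setReg (by omega)).setReg (by omega)) ?_ ?_ ?_
  · simp [StackPtr]
  · rintro s' hF hB' ⟨h1, h2, h3, h4, h5, h6⟩ hne
    have e1 : s'.mem aPw = s.mem aPw := by rw [hF.mem _ (by decide)]; simp
    have e2 : s'.mem aG = g := by rw [hF.mem _ (by decide)]; simp [hg]
    have e3 : s'.reg rBs = b := by rw [hF.reg _ (by decide)]; simp [hbs]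
    have e4 : s'.reg rN = N := by rw [hF.reg _ (by decide)]; simp [hN]
    have hlt : s'.reg rI < N := by
      by_contra hc; simp [e4, hc] at hne
    have h4 := h4 hlt
    set r := s'.reg rI with hr
    set p := s'.reg rX with hp
    have hmod := Nat.mod_lt r hb
    have hdm := Nat.div_add_mod' r b
    by_cases hpop : 0 < p ∧ g r < g (p - 1) + 1
    · obtain ⟨p, hp'⟩ : ∃ q, p = q + 1 := ⟨p - 1, by omega⟩
      rw [hp'] at hpop h4 h5
      simp at hpop
      obtain ⟨k1, k2, k3, k4, k5⟩ := h6 p (by omega)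
      simp [e2, ← hr, ← hp, hp', hpop]
      obtain ⟨j1, j2⟩ := h4.1 (by omega)
      have hblk : p / b = r / b := by
        refine le_antisymm (Nat.div_le_div_right (by omega)) ?_
        rw [Nat.le_div_iff_mul_le hb]; omega
      refine ⟨(hB'.2 _ _), ⟨by omega, h2, h3, fun _ => ⟨fun q => ?_, fun y hy1 hy2 hy3 => ?_⟩,
        by omega, h6⟩, by omega⟩
      · have := k5.1 q
        rw [hblk] at this
        omega
      · rcases Nat.lt_trichotomy y p with h7 | rfl | h7
        · exact hpop.trans (k5.2 y (by rwa [hblk]) hy2 h7)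
        · exact hpop
        · exact h4.2 y hy1 (by omega) hy3
    · have hmask : StackMask b g (r / b * b) (r % b) (s'.mem aMk p + 2 ^ (b - 1 - r % b)) := by
        have er : r / b * b + r % b = r := hdm
        rcases Nat.eq_zero_or_pos p with hp0 | hp0
        · rw [hp0, h2, Nat.zero_add]
          refine StackMask.single hmod fun y hy => ?_
          rw [er]
          exact h4.2 _ (by omega) (by omega) (by omega)
        · obtain ⟨j1, j2⟩ := h4.1 hp0
          have hq : (p - 1) / b = r / b := by
            refine le_antisymm (Nat.div_le_div_right (by omega)) ?_
            rw [Nat.le_div_iff_mul_le hb]; omega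
          have hdm' := Nat.div_add_mod' (p - 1) b
          have hm := (h6 (p - 1) (by omega)).1
          rw [hq] at hm hdm'
          rw [show p - 1 + 1 = p by omega] at hm
          refine hm.push (by omega) hmod ?_ fun y hy1 hy2 => ?_
          · rw [er, hdm']
            by_contra hc
            exact hpop ⟨hp0, by omega⟩
          · rw [er]
            exact h4.2 _ (by omega) (by omega) (by omega)
      have hdp : s'.mem aDp p ≤ r := by
        rcases Nat.eq_zero_or_pos p with hp0 | hp0
        · rw [hp0, h3]; omega
        · have := (h6 (p - 1) (by omega)).2.2.1
          rw [show p - 1 + 1 = p by omega] at this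
          omega
      have hpr : p ≠ r + 1 := by omega
      have hpop' : p = 0 ∨ g (p - 1) + 1 ≤ g r := by
        rcases Nat.eq_zero_or_pos p with h | h
        · exact Or.inl h
        · exact Or.inr (by by_contra hc; exact hpop ⟨h, by omega⟩)
      have hpw' := hpw (b - 1 - r % b) (by omega)
      have key : ∀ r' ≤ r, StackMask b g (r' / b * b) (r' % b)
          (Function.update (s'.mem aMk) (r + 1) (s'.mem aMk p + 2 ^ (b - 1 - r % b)) (r' + 1)) ∧
          Function.update (s'.mem aDp) (r + 1) (s'.mem aDp p + 1) (r' + 1) =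
            Function.update (s'.mem aDp) (r + 1) (s'.mem aDp p + 1)
              (Function.update (s'.mem aPsv) (r + 1) p (r' + 1)) + 1 ∧
          Function.update (s'.mem aDp) (r + 1) (s'.mem aDp p + 1) (r' + 1) ≤ r' + 1 ∧
          Function.update (s'.mem aPsv) (r + 1) p (r' + 1) ≤ r' ∧
          StackPtr b g r' (Function.update (s'.mem aPsv) (r + 1) p (r' + 1)) := by
        intro r' hr'
        by_cases hrr : r' = r
        · subst hrr
          simp only [Function.update_self, Function.update_of_ne hpr]
          exact ⟨hmask, trivial, by omega, h5, h4⟩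
        · obtain ⟨k1, k2, k3, k4, k5⟩ := h6 r' (by omega)
          have j1 : r' + 1 ≠ r + 1 := by omega
          have j2 : s'.mem aPsv (r' + 1) ≠ r + 1 := by omega
          simp only [Function.update_of_ne j1, Function.update_of_ne j2]
          exact ⟨k1, k2, k3, k4, k5⟩
      have hcond : ¬ ((0 < p) ∧ g r < g (p - 1) + 1) := hpop
      rw [wp_cond]
      refine ⟨fun hc => absurd hc ?_, fun _ => ?_⟩
      · simp [e2, ← hr, ← hp]
        rcases hpop' with h | h <;> intros <;> omega
      have hml := hmask.lt
      rcases succ_mod_cases hb r with ⟨m1, m2⟩ | ⟨m1, m2⟩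
      · simp [e1, e3, ← hr, ← hp, hpw', m1, h2, h3]
        refine ⟨by omega, by omega, by omega, by omega, by omega, ⟨by omega,
          fun _ => ⟨fun h => by omega, fun y _ _ _ => by omega⟩, ?_⟩, by omega⟩
        exact key
      · simp [e1, e3, ← hr, ← hp, hpw', m1, h2, h3]
        refine ⟨by omega, by omega, by omega, by omega, ⟨by omega,
          fun _ => ⟨fun _ => by rw [m2]; omega, fun y _ _ _ => by omega⟩, ?_⟩, by omega⟩
        exact key
  · rintro s' t hF hB' ⟨h1, h2, h3, h4, h5, h6⟩ he ht
    have e4 : s'.reg rN = N := by rw [hF.reg _ (by decide)]; simp [hN]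
    have hge : N ≤ s'.reg rI := by
      by_contra hc; simp [e4, not_lt] at he; omega
    simp at ht
    exact ⟨by simp; omega, fun r hr => (h6 r (by omega)).1⟩

/-- Minimum over positions `l` to `r` of the same block. Reducing the mask of `r` removes the bits of
the positions before `l`; the highest of the others belongs to a minimum. -/
def inBlock (l r : Expr) : Expr :=
  ld aG (r / rg rBs * rg rBs + (rg rBs - 1 -
    ld aLg (ld aMk (r + 1) % ld aPw (rg rBs - l % rg rBs))))

/-- Computes the minima over all unions of `2 ^ t` consecutive blocks, for all `t ≤ rBs`; they are
stored in `aSp` with stride `rNb`, the number of blocks. -/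
def sparseTable : Program :=
  rNb ≔ rg rN / rg rBs ;;
  forLoop rI 0 (rg rNb)
    (.store aSp (rg rI) (inBlock (rg rI * rg rBs) (rg rI * rg rBs + (rg rBs - 1)))) ;;
  forLoop rI (rg rNb) ((rg rBs + 1) * rg rNb)
    (rY ≔ ld aSp (rg rI - rg rNb + ld aPw (rg rI / rg rNb - 1)) ;;
      .cond (ld aSp (rg rI - rg rNb) <! rg rY)
        (.store aSp (rg rI) (ld aSp (rg rI - rg rNb)))
        (.store aSp (rg rI) (rg rY)))

/-- Everything that the in-block queries use. -/
structure BlocksReady (N b : ℕ) (g : ℕ → ℕ) (s : State) : Prop where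
  pos : 0 < b
  pow_le : 2 ^ b ≤ N
  lt_pow : N < 2 ^ (b + 1)
  bs : s.reg rBs = b
  vals : s.mem aG = g
  lg : ∀ x, 1 ≤ x → x ≤ N → s.mem aLg x = Nat.log 2 x
  pw : ∀ t ≤ b, s.mem aPw t = 2 ^ t
  mask : ∀ r < N, StackMask b g (r / b * b) (r % b) (s.mem aMk (r + 1))

/-- Everything that range minimum queries use. -/
structure RangesReady (N b : ℕ) (g : ℕ → ℕ) (s : State) : Prop extends BlocksReady N b g s where
  nb : s.reg rNb = N / b
  sp : ∀ t ≤ b, ∀ q, q + 2 ^ t ≤ N / b →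
    MinOn g (q * b) ((q + 2 ^ t) * b) (s.mem aSp (t * (N / b) + q))

section
variable {N b : ℕ} {g : ℕ → ℕ} {s s' : State}

theorem div_last_of_block (hb : 0 < b) (q : ℕ) : (q * b + (b - 1)) / b = q := by
  rw [Nat.mul_comm, Nat.mul_add_div hb, Nat.div_eq_of_lt (by omega), Nat.add_zero]

theorem BlocksReady.congr (h : BlocksReady N b g s) (h1 : s'.reg rBs = s.reg rBs)
    (h2 : s'.mem aG = s.mem aG) (h3 : s'.mem aLg = s.mem aLg) (h4 : s'.mem aPw = s.mem aPw)
    (h5 : s'.mem aMk = s.mem aMk) : BlocksReady N b g s' where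
  pos := h.pos
  pow_le := h.pow_le
  lt_pow := h.lt_pow
  bs := h1.trans h.bs
  vals := h2.trans h.vals
  lg := by rw [h3]; exact h.lg
  pw := by rw [h4]; exact h.pw
  mask := by rw [h5]; exact h.mask

theorem RangesReady.congr (h : RangesReady N b g s) (h1 : s'.reg rBs = s.reg rBs)
    (h2 : s'.mem aG = s.mem aG) (h3 : s'.mem aLg = s.mem aLg) (h4 : s'.mem aPw = s.mem aPw)
    (h5 : s'.mem aMk = s.mem aMk) (h6 : s'.reg rNb = s.reg rNb) (h7 : s'.mem aSp = s.mem aSp) :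
    RangesReady N b g s' where
  toBlocksReady := h.toBlocksReady.congr h1 h2 h3 h4 h5
  nb := h6.trans h.nb
  sp := by rw [h7]; exact h.sp

theorem BlocksReady.ev_inBlock (h : BlocksReady N b g s) {e₁ e₂ : Expr} {l r : ℕ}
    (h1 : e₁.ev s = l) (h2 : e₂.ev s = r) (hl : r / b * b ≤ l) (hlr : l ≤ r) (hr : r < N) :
    MinOn g l (r + 1) ((inBlock e₁ e₂).ev s) := by
  have hb := h.pos
  have hdm := Nat.div_add_mod' r b
  have hdm' := Nat.div_add_mod' l b
  have hdiv : l / b = r / b := by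
    refine le_antisymm (Nat.div_le_div_right hlr) ?_
    rw [Nat.le_div_iff_mul_le hb]; exact hl
  rw [hdiv] at hdm'
  have hm := h.mask r hr
  obtain ⟨x, x1, x2, x3, x4, x5⟩ := hm.min (l % b) (by omega)
  have hmod := Nat.mod_lt r hb
  have hle : s.mem aMk (r + 1) % 2 ^ (b - l % b) ≤ N :=
    (Nat.mod_le _ _).trans (hm.lt.le.trans h.pow_le)
  have e3 := h.lg _ (Nat.pos_of_ne_zero x3) hle
  rw [x4] at e3
  have e4 := h.pw (b - l % b) (by omega)
  have e5 : b - 1 - (b - 1 - x) = x := by omega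
  simp only [inBlock, ev_load, ev_add, ev_sub, ev_mul, ev_div, ev_mod, ev_reg, ev_ofNat, h1, h2,
    h.bs, h.vals, e4, e3, e5]
  refine MinOn.of_mem (by omega) (by omega) fun y hy1 hy2 => ?_
  have := x5 (y - r / b * b) (by omega) (by omega)
  rwa [Nat.add_sub_cancel' (by omega)] at this

theorem sparseTable_spec {B : ℕ} (hB : Bdd B s) (h : BlocksReady N b g s) (hN : s.reg rN = N)
    (hNB : 4 * N + 2 < B) :
    wp B sparseTable s fun s' t => t ≤ 400 * N + 400 ∧ RangesReady N b g s' := by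
  have hb := h.pos
  have hbN : b ≤ N := (Nat.lt_two_pow_self).le.trans h.pow_le
  obtain ⟨M, hM⟩ : ∃ M, M = N / b := ⟨_, rfl⟩
  have hMb : M * b ≤ N := by rw [hM]; exact Nat.div_mul_le_self N b
  have hMN : M ≤ N := by rw [hM]; exact Nat.div_le_self N b
  have hM0 : 0 < M := by rw [hM]; exact Nat.div_pos hbN hb
  rw [sparseTable, wp_seq, wp_assign]
  simp only [ev_div, ev_reg, hN, h.bs, ← hM]
  refine ⟨by omega, ?_⟩
  have hB1 : Bdd B (s.setReg rNb M) := hB.setReg (by omega)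
  rw [wp_seq]
  refine wp_for 0 M 60
    (fun q s' => ∀ x < q, MinOn g (x * b) ((x + 1) * b) (s'.mem aSp x)) hB1 (by decide) (by omega)
    (by simp) (by omega) ?_ ?_ ?_ ?_
  · intro s' hF
    simp [hF.reg rNb (by decide)]
  · intro x hx; omega
  · intro q s' hq1 hq2 hi hF hB' hI
    have hr : BlocksReady N b g s' := h.congr (by rw [hF.reg _ (by decide)]; simp)
      (by rw [hF.mem _ (by decide)]; simp) (by rw [hF.mem _ (by decide)]; simp)
      (by rw [hF.mem _ (by decide)]; simp) (by rw [hF.mem _ (by decide)]; simp)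
    have hqb : (q + 1) * b ≤ M * b := Nat.mul_le_mul (by omega) le_rfl
    rw [Nat.add_mul, one_mul] at hqb
    have hdiv := div_last_of_block hb q
    have hmin := hr.ev_inBlock (e₁ := rg rI * rg rBs) (e₂ := rg rI * rg rBs + (rg rBs - 1))
      (l := q * b) (r := q * b + (b - 1)) (by simp [hi, hr.bs]) (by simp [hi, hr.bs])
      (by rw [hdiv]) (by omega) (by omega)
    rw [show q * b + (b - 1) + 1 = (q + 1) * b by rw [Nat.add_mul]; omega] at hmin
    have hlt : (inBlock (rg rI * rg rBs) (rg rI * rg rBs + (rg rBs - 1))).ev s' < B := hB'.2 _ _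
    rw [wp_store]
    refine ⟨hlt, by simp [inBlock], fun x hx => ?_⟩
    simp only [mem_setReg, mem_setMem, if_true, ev_reg, hi]
    by_cases hxq : x = q
    · subst hxq
      rwa [Function.update_self]
    · rw [Function.update_of_ne hxq]
      exact hI x (by omega)
  · intro s1 t1 ht1 _ hF1 hB1 hI1
    have hr1 : BlocksReady N b g s1 := h.congr (by rw [hF1.reg _ (by decide)]; simp)
      (by rw [hF1.mem _ (by decide)]; simp) (by rw [hF1.mem _ (by decide)]; simp)
      (by rw [hF1.mem _ (by decide)]; simp) (by rw [hF1.mem _ (by decide)]; simp)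
    have hnb1 : s1.reg rNb = M := by rw [hF1.reg _ (by decide)]; simp
    have hbM : (b + 1) * M ≤ 2 * N := by
      rw [Nat.add_mul, Nat.mul_comm b M]; omega
    refine wp_for M ((b + 1) * M) 60
      (fun z s' => ∀ t q, t * M + q < z → q + 2 ^ t ≤ M →
        MinOn g (q * b) ((q + 2 ^ t) * b) (s'.mem aSp (t * M + q))) hB1 (by decide) (by omega)
      (by simp [hnb1]) (by rw [Nat.add_mul]; omega) ?_ ?_ ?_ ?_
    · intro s' hF
      simp [hF.reg rNb (by decide), hF.reg rBs (by decide), hnb1, hr1.bs]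
    · intro t q htq hq
      obtain rfl : t = 0 := by
        by_contra hc
        have : 1 * M ≤ t * M := Nat.mul_le_mul (by omega) le_rfl
        omega
      simp only [Nat.zero_mul, Nat.zero_add, pow_zero, mem_setReg] at *
      exact hI1 q htq
    · intro z s' hz1 hz2 hi hF hB' hI
      have e1 : s'.reg rNb = M := by rw [hF.reg _ (by decide), hnb1]
      have e2 : s'.mem aPw = s1.mem aPw := hF.mem _ (by decide)
      have hzM : 1 ≤ z / M := by rw [Nat.le_div_iff_mul_le hM0]; omega
      have hzb : z / M ≤ b := by
        have : z / M < b + 1 := by rw [Nat.div_lt_iff_lt_mul hM0]; exact hz2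
        omega
      have e3 := hr1.pw (z / M - 1) (by omega)
      have hmin : ∀ t q, t * M + q < z + 1 → q + 2 ^ t ≤ M →
          MinOn g (q * b) ((q + 2 ^ t) * b) (Function.update (s'.mem aSp) z
            (min (s'.mem aSp (z - M)) (s'.mem aSp (z - M + 2 ^ (z / M - 1)))) (t * M + q)) := by
        intro t q htq hq
        have h2t : 0 < 2 ^ t := by positivity
        by_cases hz : t * M + q = z
        · rw [hz, Function.update_self]
          have ht : z / M = t := by
            rw [← hz, Nat.mul_comm, Nat.mul_add_div hM0, Nat.div_eq_of_lt (by omega), Nat.add_zero]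
          obtain ⟨t, rfl⟩ : ∃ k, t = k + 1 := ⟨t - 1, by omega⟩
          rw [ht, Nat.add_sub_cancel]
          rw [pow_succ] at hq h2t
          have hz' : z - M = t * M + q := by rw [← hz, Nat.add_mul]; omega
          have hzz : z = t * M + q + M := by rw [← hz, Nat.add_mul]; omega
          have m1 := hI t q (by omega) (by omega)
          have m2 := hI t (q + 2 ^ t) (by omega) (by omega)
          rw [hz', add_assoc]
          rw [show q + 2 ^ t + 2 ^ t = q + 2 ^ (t + 1) by rw [pow_succ]; ring] at m2
          exact m1.union m2 (Nat.mul_le_mul (by omega) le_rfl) le_rfl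
            (Nat.mul_le_mul (Nat.add_le_add le_rfl (Nat.pow_le_pow_right (by omega) (by omega)))
              le_rfl)
        · rw [Function.update_of_ne hz]
          exact hI t q (by omega) hq
      have hb1 := hB'.2 aSp (z - M)
      have hb2 := hB'.2 aSp (z - M + 2 ^ (z / M - 1))
      simp [hi, e1, e2, e3]
      refine ⟨hb2, fun hlt => ⟨hb1, ?_⟩, fun hlt => ⟨hb2, ?_⟩⟩
      · rw [min_eq_left hlt.le] at hmin
        exact fun t q h1 h2 => hmin t q (by omega) h2
      · rw [min_eq_right hlt] at hmin
        exact fun t q h1 h2 => hmin t q (by omega) h2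
    · intro s2 t2 ht2 _ hF2 hB2 hI2
      refine ⟨?_, ?_⟩
      · simp at ht1 ht2
        have : (b + 1) * M - M ≤ N := by rw [Nat.add_mul, Nat.mul_comm b M]; omega
        simp
        omega
      · refine ⟨hr1.congr (hF2.reg _ (by decide)) (hF2.mem _ (by decide)) (hF2.mem _ (by decide))
          (hF2.mem _ (by decide)) (hF2.mem _ (by decide)), ?_, ?_⟩
        · rw [hF2.reg _ (by decide), hnb1, hM]
        · rw [← hM]
          intro t ht q hq
          have h2t : 0 < 2 ^ t := by positivity
          refine hI2 t q ?_ hq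
          have : t * M ≤ b * M := Nat.mul_le_mul ht le_rfl
          rw [Nat.add_mul]; omega

/-- Replaces `rD` by the value of `e` if that is smaller. -/
def minD (e : Expr) : Program := rY ≔ e ;; ifThen (rg rY <! rg rD) (rD ≔ rg rY)

/-- Stores in `rD` the minimum over the positions from `rA` to `rB`. If these lie in different blocks,
the range consists of a final part of one block, an initial part of another, and of the blocks
between, which are covered by two overlapping unions of `2 ^ t` blocks. -/
def rangeMin : Program :=
  rU ≔ rg rA / rg rBs ;;
  rX ≔ rg rB / rg rBs ;;
  .cond (rg rU =! rg rX) (rD ≔ inBlock (rg rA) (rg rB))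
    (rZ ≔ rg rU * rg rBs + (rg rBs - 1) ;;
      rD ≔ inBlock (rg rA) (rg rZ) ;;
      rZ ≔ rg rX * rg rBs ;;
      minD (inBlock (rg rZ) (rg rB)) ;;
      ifThen (rg rU + 1 <! rg rX)
        (rZ ≔ ld aLg (rg rX - rg rU - 1) ;;
          minD (ld aSp (rg rZ * rg rNb + (rg rU + 1))) ;;
          minD (ld aSp (rg rZ * rg rNb + (rg rX - ld aPw (rg rZ))))))

theorem minD_spec {B v w : ℕ} {e : Expr} (h1 : e.ev s = v) (h2 : s.reg rD = w) (hv : v < B) :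
    wp B (minD e) s fun s' t => t ≤ e.cost + 10 ∧ s'.reg rD = min w v := by
  simp [minD, h1, h2]
  exact ⟨hv, fun h => ⟨hv, h.le⟩⟩

theorem rangeMin_spec {B l r : ℕ} (hB : Bdd B s) (h : RangesReady N b g s) (hl : s.reg rA = l)
    (hr : s.reg rB = r) (hlr : l ≤ r) (hrN : r < N) (hNB : 2 * N < B) :
    wp B rangeMin s fun s' t => t ≤ 500 ∧ MinOn g l (r + 1) (s'.reg rD) := by
  have hb := h.pos
  have hready : ∀ {s' : State}, Frame rangeMin s s' → RangesReady N b g s' := fun hF =>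
    h.congr (hF.reg _ (by decide)) (hF.mem _ (by decide)) (hF.mem _ (by decide))
      (hF.mem _ (by decide)) (hF.mem _ (by decide)) (hF.reg _ (by decide)) (hF.mem _ (by decide))
  have hl1 : l / b ≤ l := Nat.div_le_self _ _
  have hr1 : r / b ≤ r := Nat.div_le_self _ _
  have hlr1 : l / b ≤ r / b := Nat.div_le_div_right hlr
  have hdl := Nat.div_add_mod' l b
  have hdr := Nat.div_add_mod' r b
  have hml := Nat.mod_lt l hb
  have hmr := Nat.mod_lt r hb
  rw [rangeMin, wp_seq, wp_assign]
  simp only [ev_div, ev_reg, hl, h.bs]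
  refine ⟨by omega, ?_⟩
  rw [wp_seq, wp_assign]
  have ex : (rg rB / rg rBs).ev (s.setReg rU (l / b)) = r / b := by simp [hr, h.bs]
  rw [ex]
  refine ⟨by omega, ?_⟩
  set s1 := (s.setReg rU (l / b)).setReg rX (r / b) with hs1
  have hB1 : Bdd B s1 := (hB.setReg (by omega)).setReg (by omega)
  have h1 : RangesReady N b g s1 := h.congr (by simp [hs1]) (by simp [hs1]) (by simp [hs1])
    (by simp [hs1]) (by simp [hs1]) (by simp [hs1]) (by simp [hs1])
  have a1 : s1.reg rA = l := by simp [hs1, hl]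
  have a2 : s1.reg rB = r := by simp [hs1, hr]
  have a3 : s1.reg rU = l / b := by simp [hs1]
  have a4 : s1.reg rX = r / b := by simp [hs1]
  clear_value s1
  rw [wp_cond, wp_assign]
  refine ⟨fun heq => ⟨hB1.2 _ _, by simp [inBlock], ?_⟩, fun hne => ?_⟩
  · have heq : l / b = r / b := by
      by_contra hc; simp [a3, a4, hc] at heq
    rw [reg_setReg, if_pos rfl]
    exact h1.ev_inBlock (by simp [a1]) (by simp [a2]) (by rw [← heq]; omega) hlr hrN
  · have hne : l / b ≠ r / b := fun hc => by simp [a3, a4, hc] at hne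
    have hlt : l / b < r / b := by omega
    have hmul : (l / b + 1) * b ≤ r / b * b := Nat.mul_le_mul hlt le_rfl
    have hmul' := hmul
    rw [Nat.add_mul, one_mul] at hmul'
    have hle : l ≤ (l / b + 1) * b := by rw [Nat.add_mul]; omega
    rw [wp_seq, wp_assign]
    have ez : (rg rU * rg rBs + (rg rBs - 1)).ev s1 = l / b * b + (b - 1) := by simp [a3, h1.bs]
    rw [ez]
    refine ⟨by omega, ?_⟩
    have hdiv := div_last_of_block hb (l / b)
    have h2 : RangesReady N b g (s1.setReg rZ (l / b * b + (b - 1))) :=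
      h1.congr (by simp) (by simp) (by simp) (by simp) (by simp) (by simp) (by simp)
    have m1 := h2.ev_inBlock (e₁ := rg rA) (e₂ := rg rZ) (l := l) (r := l / b * b + (b - 1))
      (by simp [a1]) (by simp) (by rw [hdiv]; omega) (by omega) (by omega)
    rw [show l / b * b + (b - 1) + 1 = (l / b + 1) * b by rw [Nat.add_mul]; omega] at m1
    have hB2 : Bdd B (s1.setReg rZ (l / b * b + (b - 1))) := hB1.setReg (by omega)
    rw [wp_seq, wp_assign]
    have hv1 : (inBlock (rg rA) (rg rZ)).ev (s1.setReg rZ (l / b * b + (b - 1))) < B := hB2.2 _ _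
    set v1 := (inBlock (rg rA) (rg rZ)).ev (s1.setReg rZ (l / b * b + (b - 1)))
    refine ⟨hv1, ?_⟩
    rw [wp_seq, wp_assign]
    have ey : (rg rX * rg rBs).ev ((s1.setReg rZ (l / b * b + (b - 1))).setReg rD v1) =
        r / b * b := by simp [a4, h1.bs]
    rw [ey]
    refine ⟨by omega, ?_⟩
    simp
    set s2 := (((s1.setReg rZ (l / b * b + (b - 1))).setReg rD v1).setReg rZ (r / b * b)) with hs2
    have hB3 : Bdd B s2 := (hB2.setReg hv1).setReg (by omega)
    have h3 : RangesReady N b g s2 := h1.congr (by simp [hs2]) (by simp [hs2]) (by simp [hs2])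
      (by simp [hs2]) (by simp [hs2]) (by simp [hs2]) (by simp [hs2])
    have m2 := h3.ev_inBlock (e₁ := rg rZ) (e₂ := rg rB) (l := r / b * b) (r := r)
      (by simp [hs2]) (by simp [hs2, a2]) le_rfl (by omega) hrN
    have hv2 : (inBlock (rg rZ) (rg rB)).ev s2 < B := hB3.2 _ _
    have b1 : s2.reg rU = l / b := by simp [hs2, a3]
    have b2 : s2.reg rX = r / b := by simp [hs2, a4]
    have b3 : s2.reg rD = v1 := by simp [hs2]
    clear_value s2
    refine (minD_spec rfl b3 hv2).call hB3 ?_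
    rintro s3 t3 hF3 hB3' ⟨ht3, hD3⟩
    have h4 : RangesReady N b g s3 := h3.congr (hF3.reg _ (by decide)) (hF3.mem _ (by decide))
      (hF3.mem _ (by decide)) (hF3.mem _ (by decide)) (hF3.mem _ (by decide))
      (hF3.reg _ (by decide)) (hF3.mem _ (by decide))
    have c1 : s3.reg rU = l / b := by rw [hF3.reg _ (by decide), b1]
    have c2 : s3.reg rX = r / b := by rw [hF3.reg _ (by decide), b2]
    simp [inBlock] at ht3
    generalize (inBlock (rg rZ) (rg rB)).ev s2 = v2 at *
    refine ⟨fun hmid => ?_, fun hmid => ?_⟩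
    · simp [c1, c2] at hmid
      have hNb : r / b ≤ N / b := Nat.div_le_div_right (by omega)
      have hbN : b ≤ N := Nat.lt_two_pow_self.le.trans h.pow_le
      have hrb : (r / b) * b ≤ N := by omega
      obtain ⟨d, hd⟩ : ∃ d, d = r / b - l / b - 1 := ⟨_, rfl⟩
      have hlog := h4.lg d (by omega) (by omega)
      have hlog1 := Nat.pow_log_le_self 2 (by omega : d ≠ 0)
      have hlog2 := Nat.lt_pow_succ_log_self (b := 2) (by omega) d
      rw [pow_succ] at hlog2
      have hlogb : Nat.log 2 d ≤ b := by
        have : Nat.log 2 d < b + 1 := Nat.log_lt_of_lt_pow (by omega) (by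
          have := h.lt_pow; omega)
        omega
      have hpw := h4.pw _ hlogb
      have hlogd : Nat.log 2 d ≤ d := Nat.log_le_self 2 d
      simp only [c1, c2, ← hd, hlog]
      set L := Nat.log 2 d
      refine ⟨by omega, ?_⟩
      have hB4 : Bdd B (s3.setReg rZ L) := hB3'.setReg (by omega)
      have w1 := h4.sp L hlogb (l / b + 1) (by omega)
      have w2 := h4.sp L hlogb (r / b - 2 ^ L) (by omega)
      rw [show r / b - 2 ^ L + 2 ^ L = r / b by omega] at w2
      have w := w1.union w2 (Nat.mul_le_mul (by omega) le_rfl) (Nat.mul_le_mul (by omega) le_rfl)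
        (Nat.mul_le_mul (by omega) le_rfl)
      set u1 := s3.mem aSp (L * (N / b) + (l / b + 1)) with hu1
      set u2 := s3.mem aSp (L * (N / b) + (r / b - 2 ^ L)) with hu2
      refine (minD_spec (v := u1) (w := min v1 v2) (by simp [h4.nb, c1, hu1]) (by simp [hD3])
        (hB3'.2 _ _)).call hB4 ?_
      rintro s5 t5 hF5 hB5 ⟨ht5, hD5⟩
      refine (minD_spec (v := u2) (w := min (min v1 v2) u1) ?_ hD5 (hB3'.2 _ _)).call hB5 ?_
      · simp [hF5.reg rZ (by decide), hF5.reg rNb (by decide), hF5.reg rX (by decide),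
          hF5.mem aSp (by decide), hF5.mem aPw (by decide), hpw, h4.nb, c2, hu2]
      rintro s6 t6 hF6 hB6 ⟨ht6, hD6⟩
      simp at ht5 ht6
      simp [inBlock]
      refine ⟨by omega, ?_⟩
      rw [hD6, show min (min (min v1 v2) u1) u2 = min (min v1 (min u1 u2)) v2 by omega]
      refine (m1.union w (by omega) le_rfl hmul).union m2 (by omega) le_rfl (by omega)
    · simp [c1, c2] at hmid
      simp [inBlock]
      refine ⟨by omega, ?_⟩
      rw [hD3]
      have : r / b = l / b + 1 := by omega
      rw [this] at m2
      exact m1.union m2 (by omega) le_rfl (by rw [← this]; omega)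

/-- The longest common prefixes of two different suffixes of `S` can be computed in constant time. -/
def LceReady (N : ℕ) (S : ℕ → ℕ) (s : State) : Prop :=
  ∃ (b X : ℕ) (g f : ℕ → ℕ), RangesReady N b g s ∧ IsPadded N X S ∧ SufList N X S 0 N f ∧
    (∀ t, t + 1 < N → IsLcp S (f t) (f (t + 1)) (g t)) ∧ ∀ t < N, s.mem aRnk (f t) = t + 1

theorem LceReady.congr {S : ℕ → ℕ} (h : LceReady N S s) (h1 : s'.reg rBs = s.reg rBs)
    (h2 : s'.mem aG = s.mem aG) (h3 : s'.mem aLg = s.mem aLg) (h4 : s'.mem aPw = s.mem aPw)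
    (h5 : s'.mem aMk = s.mem aMk) (h6 : s'.reg rNb = s.reg rNb) (h7 : s'.mem aSp = s.mem aSp)
    (h8 : s'.mem aRnk = s.mem aRnk) : LceReady N S s' := by
  obtain ⟨b, X, g, f, k1, k2, k3, k4, k5⟩ := h
  exact ⟨b, X, g, f, k1.congr h1 h2 h3 h4 h5 h6 h7, k2, k3, k4, by rwa [h8]⟩

/-- Stores in `rD` the length of the longest common prefix of the suffixes at `rFst` and `rSnd`: the
minimum over the adjacent pairs between their ranks, of which the larger one is excluded. -/
def lce : Program :=
  rA ≔ ld aRnk (rg rFst) - 1 ;;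
  rB ≔ ld aRnk (rg rSnd) - 1 ;;
  .cond (rg rA <! rg rB) (rB ≔ rg rB - 1) (rY ≔ rg rA ;; rA ≔ rg rB ;; rB ≔ rg rY - 1) ;;
  rangeMin

theorem lce_spec {B p q : ℕ} {S : ℕ → ℕ} (hB : Bdd B s) (h : LceReady N S s) (hp : s.reg rFst = p)
    (hq : s.reg rSnd = q) (hpN : p < N) (hqN : q < N) (hpq : p ≠ q) (hNB : 2 * N < B) :
    wp B lce s fun s' t => t ≤ 600 ∧ IsLcp S p q (s'.reg rD) := by
  obtain ⟨b, X, g, f, h1, hS, hf, hg, hr⟩ := h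
  have hcard := sampleCard_zero N
  have surj : ∀ p < N, ∃ t < N, f t = p := fun p hp => by
    have := SufList.surj (f := f) (l := 0) (by rwa [hcard]) (⟨hp, by simp [Good]⟩ : Sample N 0 p)
    rwa [hcard] at this
  obtain ⟨t, ht, rfl⟩ := surj p hpN
  obtain ⟨u, hu, rfl⟩ := surj q hqN
  have e1 := hr t ht
  have e2 := hr u hu
  have htu : t ≠ u := fun e => hpq (by rw [e])
  have key : ∀ {s₁ : State} {a c : ℕ}, RangesReady N b g s₁ → Bdd B s₁ → s₁.reg rA = a →
      s₁.reg rB = c - 1 → a < c → c < N →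
      wp B rangeMin s₁ fun s' t => t ≤ 500 ∧ IsLcp S (f a) (f c) (s'.reg rD) := by
    intro s₁ a c hF hB₁ ha hc hac hcN
    refine (rangeMin_spec hB₁ hF ha hc (by omega) (by omega) hNB).mono ?_
    rintro s' t ⟨k1, k2⟩
    rw [Nat.sub_add_cancel (by omega)] at k2
    exact ⟨k1, hf.isLcp_of_min hS hg hac hcN k2⟩
  rw [lce, wp_seq, wp_assign]
  simp only [ev_sub, ev_load, ev_reg, ev_ofNat, hp, e1, Nat.add_sub_cancel]
  refine ⟨by omega, ?_⟩
  rw [wp_seq, wp_assign]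
  simp only [ev_sub, ev_load, ev_reg, ev_ofNat, reg_setReg, mem_setReg]
  simp only [show (rSnd = rA) = False by simp, if_false, hq, e2, Nat.add_sub_cancel]
  refine ⟨by omega, ?_⟩
  rw [wp_seq, wp_cond]
  constructor
  · intro hlt
    have hlt : t < u := by
      by_contra hc; simp [hc] at hlt
    simp
    refine ⟨by omega, (key (h1.congr ?_ ?_ ?_ ?_ ?_ ?_ ?_)
      (((hB.setReg (by omega)).setReg (by omega)).setReg (by omega)) ?_ ?_ hlt hu).mono ?_⟩
    any_goals simp
    intro s' t' h1 h2
    exact ⟨by omega, h2⟩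
  · intro hlt
    have hlt : u < t := by
      by_contra hc
      simp [(by omega : t < u)] at hlt
    simp
    refine ⟨by omega, by omega, by omega, (key (h1.congr ?_ ?_ ?_ ?_ ?_ ?_ ?_)
      (((((hB.setReg (by omega)).setReg (by omega)).setReg (by omega)).setReg (by omega)).setReg
        (by omega)) ?_ ?_ hlt ht).mono ?_⟩
    any_goals simp
    intro s' t' h1 h2
    exact ⟨by omega, h2.symm⟩

end

end WordRAM

namespace CircularMatching

/-! ### Edit distance -/

/-- `Align d U V`: there is an alignment of `U` and `V` of cost `d`, given column by column. -/
inductive Align : ℕ → List ℕ → List ℕ → Prop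
  | nil : Align 0 [] []
  | keep {d : ℕ} {U V : List ℕ} (a : ℕ) : Align d U V → Align d (a :: U) (a :: V)
  | subst {d : ℕ} {U V : List ℕ} (a b : ℕ) : Align d U V → Align (d + 1) (a :: U) (b :: V)
  | delete {d : ℕ} {U V : List ℕ} (a : ℕ) : Align d U V → Align (d + 1) (a :: U) V
  | insert {d : ℕ} {U V : List ℕ} (b : ℕ) : Align d U V → Align (d + 1) U (b :: V)

theorem Align.refl : ∀ U : List ℕ, Align 0 U U
  | [] => .nil
  | a :: U => .keep a (Align.refl U)

theorem Align.symm {d : ℕ} {U V : List ℕ} (h : Align d U V) : Align d V U := by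
  induction h with
  | nil => exact .nil
  | keep a _ ih => exact .keep a ih
  | subst a b _ ih => exact .subst b a ih
  | delete a _ ih => exact .insert a ih
  | insert b _ ih => exact .delete b ih

theorem Align.append {d e : ℕ} {U V U' V' : List ℕ} (h : Align d U V) (h' : Align e U' V') :
    Align (d + e) (U ++ U') (V ++ V') := by
  induction h with
  | nil => simpa using h'
  | keep a _ ih => exact .keep a ih
  | subst a b _ ih => rw [Nat.add_right_comm]; exact .subst a b ih
  | delete a _ ih => rw [Nat.add_right_comm]; exact .delete a ih
  | insert b _ ih => rw [Nat.add_right_comm]; exact .insert b ih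

theorem Align.reverse {d : ℕ} {U V : List ℕ} (h : Align d U V) :
    Align d U.reverse V.reverse := by
  induction h with
  | nil => exact .nil
  | keep a _ ih => simpa using ih.append (.keep a .nil)
  | subst a b _ ih => simpa using ih.append (.subst a b .nil)
  | delete a _ ih => simpa using ih.append (.delete a .nil)
  | insert b _ ih => simpa using ih.append (.insert b .nil)

/-- An alignment of `A ++ B` is cut where `A` ends. -/
theorem Align.split {d : ℕ} {A B W : List ℕ} (h : Align d (A ++ B) W) :
    ∃ d₁ d₂ W₁ W₂, d = d₁ + d₂ ∧ W = W₁ ++ W₂ ∧ Align d₁ A W₁ ∧ Align d₂ B W₂ := by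
  generalize hU : A ++ B = U at h
  induction h generalizing A with
  | nil =>
    obtain ⟨rfl, rfl⟩ := List.append_eq_nil_iff.1 hU
    exact ⟨0, 0, [], [], rfl, rfl, .nil, .nil⟩
  | @keep d U V a h ih =>
    rcases A with - | ⟨a', A⟩
    · exact ⟨0, d, [], a :: V, by omega, rfl, .nil, by simp at hU; subst hU; exact .keep a h⟩
    · simp at hU
      obtain ⟨rfl, rfl⟩ := hU
      obtain ⟨d₁, d₂, W₁, W₂, rfl, rfl, h1, h2⟩ := ih rfl
      exact ⟨d₁, d₂, a' :: W₁, W₂, rfl, rfl, .keep a' h1, h2⟩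
  | @subst d U V a b h ih =>
    rcases A with - | ⟨a', A⟩
    · exact ⟨0, d + 1, [], b :: V, by omega, rfl, .nil, by simp at hU; subst hU; exact .subst a b h⟩
    · simp at hU
      obtain ⟨rfl, rfl⟩ := hU
      obtain ⟨d₁, d₂, W₁, W₂, rfl, rfl, h1, h2⟩ := ih rfl
      exact ⟨d₁ + 1, d₂, b :: W₁, W₂, by omega, rfl, .subst a' b h1, h2⟩
  | @delete d U V a h ih =>
    rcases A with - | ⟨a', A⟩
    · exact ⟨0, d + 1, [], V, by omega, rfl, .nil, by simp at hU; subst hU; exact .delete a h⟩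
    · simp at hU
      obtain ⟨rfl, rfl⟩ := hU
      obtain ⟨d₁, d₂, W₁, W₂, rfl, rfl, h1, h2⟩ := ih rfl
      exact ⟨d₁ + 1, d₂, W₁, W₂, by omega, rfl, .delete a' h1, h2⟩
  | @insert d U V b h ih =>
    obtain ⟨d₁, d₂, W₁, W₂, rfl, rfl, h1, h2⟩ := ih hU
    exact ⟨d₁ + 1, d₂, b :: W₁, W₂, by omega, rfl, .insert b h1, h2⟩

theorem Align.of_cons_left {d a : ℕ} {U V : List ℕ} (h : Align d (a :: U) V) :
    ∃ d' ≤ d + 1, Align d' U V := by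
  generalize hU : a :: U = U' at h
  induction h with
  | nil => cases hU
  | keep b h => cases hU; exact ⟨_, le_rfl, .insert _ h⟩
  | subst b c h => cases hU; exact ⟨_, by omega, .insert _ h⟩
  | delete b h => cases hU; exact ⟨_, by omega, h⟩
  | insert b h ih =>
    obtain ⟨d', h1, h2⟩ := ih hU
    exact ⟨d' + 1, by omega, .insert b h2⟩

theorem Align.replace_head {d a b : ℕ} {U V : List ℕ} (h : Align d (a :: U) V) :
    ∃ d' ≤ d + 1, Align d' (b :: U) V := by
  generalize hU : a :: U = U' at h
  induction h with
  | nil => cases hU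
  | keep c h => cases hU; exact ⟨_, le_rfl, .subst _ _ h⟩
  | subst c e h => cases hU; exact ⟨_, by omega, .subst _ _ h⟩
  | delete c h => cases hU; exact ⟨_, by omega, .delete _ h⟩
  | insert c h ih =>
    obtain ⟨d', h1, h2⟩ := ih hU
    exact ⟨d' + 1, by omega, .insert c h2⟩

/-- An edit in front of an alignment increases its cost by at most one. -/
theorem EditStep.align {d : ℕ} {U V W : List ℕ} (h : EditStep U V) (h' : Align d V W) :
    ∃ d' ≤ d + 1, Align d' U W := by
  cases h with
  | insert A B x =>
    obtain ⟨d₁, d₂, W₁, W₂, rfl, rfl, h1, h2⟩ := h'.split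
    obtain ⟨d', h3, h4⟩ := h2.of_cons_left
    exact ⟨_, by omega, h1.append h4⟩
  | delete A B x =>
    obtain ⟨d₁, d₂, W₁, W₂, rfl, rfl, h1, h2⟩ := h'.split
    exact ⟨_, le_rfl, h1.append (.delete x h2)⟩
  | subst A B x y =>
    obtain ⟨d₁, d₂, W₁, W₂, rfl, rfl, h1, h2⟩ := h'.split
    obtain ⟨d', h3, h4⟩ := h2.replace_head (b := x)
    exact ⟨_, by omega, h1.append h4⟩

theorem Edits.align {d : ℕ} {U V : List ℕ} (h : Edits d U V) : ∃ d' ≤ d, Align d' U V := by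
  induction h with
  | refl U => exact ⟨0, le_rfl, .refl U⟩
  | step h1 _ ih =>
    obtain ⟨d', h2, h3⟩ := ih
    obtain ⟨d'', h4, h5⟩ := h1.align h3
    exact ⟨d'', by omega, h5⟩

theorem EditStep.cons {U V : List ℕ} (h : EditStep U V) (a : ℕ) : EditStep (a :: U) (a :: V) := by
  cases h with
  | insert A B x => exact .insert (a :: A) B x
  | delete A B x => exact .delete (a :: A) B x
  | subst A B x y => exact .subst (a :: A) B x y

theorem Edits.cons {d : ℕ} {U V : List ℕ} (h : Edits d U V) (a : ℕ) :
    Edits d (a :: U) (a :: V) := by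
  induction h with
  | refl U => exact .refl _
  | step h1 _ ih => exact .step (h1.cons a) ih

theorem Align.edits {d : ℕ} {U V : List ℕ} (h : Align d U V) : Edits d U V := by
  induction h with
  | nil => exact .refl _
  | keep a _ ih => exact ih.cons a
  | subst a b _ ih => exact .step (.subst [] _ a b) (ih.cons b)
  | delete a _ ih => exact .step (.delete [] _ a) ih
  | insert b _ ih => exact .step (.insert [] _ b) (ih.cons b)

theorem editDist_le_iff {U V : List ℕ} {k : ℕ} : editDist U V ≤ k ↔ ∃ d ≤ k, Align d U V := by
  constructor
  · intro h
    obtain ⟨d, h1, h2⟩ := (Nat.sInf_mem (exists_edits U V) : Edits (editDist U V) U V).align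
    exact ⟨d, h1.trans h, h2⟩
  · rintro ⟨d, h1, h2⟩
    exact (Nat.sInf_le h2.edits).trans h1

theorem exists_align (U V : List ℕ) : ∃ d ≤ editDist U V, Align d U V :=
  editDist_le_iff.1 le_rfl

theorem Align.editDist_le {d : ℕ} {U V : List ℕ} (h : Align d U V) : editDist U V ≤ d :=
  editDist_le_iff.2 ⟨d, le_rfl, h⟩

theorem editDist_comm (U V : List ℕ) : editDist U V = editDist V U := by
  have key : ∀ U V, editDist U V ≤ editDist V U := fun U V => by
    obtain ⟨d, h1, h2⟩ := exists_align V U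
    exact h2.symm.editDist_le.trans h1
  exact le_antisymm (key U V) (key V U)

theorem editDist_reverse (U V : List ℕ) : editDist U.reverse V.reverse = editDist U V := by
  have key : ∀ U V, editDist (List.reverse U) (List.reverse V) ≤ editDist U V := fun U V => by
    obtain ⟨d, h1, h2⟩ := exists_align U V
    exact h2.reverse.editDist_le.trans h1
  refine le_antisymm (key U V) ?_
  simpa using key U.reverse V.reverse

theorem editDist_append_le (U V U' V' : List ℕ) :
    editDist (U ++ U') (V ++ V') ≤ editDist U V + editDist U' V' := by
  obtain ⟨d, h1, h2⟩ := exists_align U V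
  obtain ⟨e, h3, h4⟩ := exists_align U' V'
  exact (h2.append h4).editDist_le.trans (Nat.add_le_add h1 h3)

theorem exists_editDist_append_le (A B W : List ℕ) :
    ∃ W₁ W₂, W = W₁ ++ W₂ ∧ editDist A W₁ + editDist B W₂ ≤ editDist (A ++ B) W := by
  obtain ⟨d, h1, h2⟩ := exists_align (A ++ B) W
  obtain ⟨d₁, d₂, W₁, W₂, rfl, rfl, h3, h4⟩ := h2.split
  exact ⟨W₁, W₂, rfl, (Nat.add_le_add h3.editDist_le h4.editDist_le).trans h1⟩

theorem Align.length_le {d : ℕ} {U V : List ℕ} (h : Align d U V) : U.length ≤ d + V.length := by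
  induction h with
  | nil => simp
  | keep => simp; omega
  | subst => simp; omega
  | delete => simp; omega
  | insert => simp; omega

theorem editDist_nil_right (U : List ℕ) : editDist U [] = U.length := by
  refine le_antisymm (Align.editDist_le ?_) ?_
  · induction U with
    | nil => exact .nil
    | cons a U ih => exact .delete a ih
  · obtain ⟨d, h1, h2⟩ := exists_align U []
    have := h2.length_le
    simp at this
    omega

theorem editDist_nil_left (U : List ℕ) : editDist [] U = U.length := by
  rw [editDist_comm, editDist_nil_right]

/-- The first column of an alignment is a match, a substitution, a deletion or an insertion. -/
theorem editDist_cons_cons_le_iff {a b e : ℕ} {U V : List ℕ} :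
    editDist (a :: U) (b :: V) ≤ e ↔ (a = b ∧ editDist U V ≤ e) ∨ editDist U V + 1 ≤ e ∨
      editDist U (b :: V) + 1 ≤ e ∨ editDist (a :: U) V + 1 ≤ e := by
  constructor
  · intro h
    obtain ⟨d, h1, h2⟩ := editDist_le_iff.1 h
    cases h2 with
    | keep _ h => exact .inl ⟨rfl, h.editDist_le.trans h1⟩
    | subst _ _ h => have := h.editDist_le; exact .inr (.inl (by omega))
    | delete _ h => have := h.editDist_le; exact .inr (.inr (.inl (by omega)))
    | insert _ h => have := h.editDist_le; exact .inr (.inr (.inr (by omega)))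
  · rintro (⟨rfl, h⟩ | h | h | h)
    · obtain ⟨d, h1, h2⟩ := editDist_le_iff.1 h
      exact editDist_le_iff.2 ⟨d, h1, .keep a h2⟩
    · obtain ⟨d, h1, h2⟩ := exists_align U V
      exact editDist_le_iff.2 ⟨d + 1, by omega, .subst a b h2⟩
    · obtain ⟨d, h1, h2⟩ := exists_align U (b :: V)
      exact editDist_le_iff.2 ⟨d + 1, by omega, .delete a h2⟩
    · obtain ⟨d, h1, h2⟩ := exists_align (a :: U) V
      exact editDist_le_iff.2 ⟨d + 1, by omega, .insert b h2⟩

theorem editDist_concat_concat_le_iff {a b e : ℕ} {U V : List ℕ} :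
    editDist (U ++ [a]) (V ++ [b]) ≤ e ↔ (a = b ∧ editDist U V ≤ e) ∨ editDist U V + 1 ≤ e ∨
      editDist U (V ++ [b]) + 1 ≤ e ∨ editDist (U ++ [a]) V + 1 ≤ e := by
  rw [← editDist_reverse (U ++ [a]) (V ++ [b]), ← editDist_reverse U V,
    ← editDist_reverse U (V ++ [b]), ← editDist_reverse (U ++ [a]) V]
  simpa using editDist_cons_cons_le_iff

/-- The recursion for the table of the edit distances of the prefixes of two strings; `mt` tells
which letters are equal. -/
structure EditTable (mt : ℕ → ℕ → Prop) (lx ly : ℕ) (D : ℕ → ℕ → ℕ) : Prop where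
  left : ∀ x ≤ lx, D x 0 = x
  top : ∀ y ≤ ly, D 0 y = y
  step : ∀ x < lx, ∀ y < ly, ∀ e, D (x + 1) (y + 1) ≤ e ↔ (mt x y ∧ D x y ≤ e) ∨
    D x y + 1 ≤ e ∨ D x (y + 1) + 1 ≤ e ∨ D (x + 1) y + 1 ≤ e

theorem editTable_take {U V : List ℕ} {mt : ℕ → ℕ → Prop}
    (h : ∀ x < U.length, ∀ y < V.length, mt x y ↔ U.getD x 0 = V.getD y 0) :
    EditTable mt U.length V.length fun x y => editDist (U.take x) (V.take y) where
  left x hx := by simp [editDist_nil_right, hx]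
  top y hy := by simp [editDist_nil_left, hy]
  step x hx y hy e := by
    rw [h x hx y hy, List.getD_eq_getElem _ _ hx, List.getD_eq_getElem _ _ hy,
      ← List.take_concat_get' U x hx, ← List.take_concat_get' V y hy]
    exact editDist_concat_concat_le_iff

/-! ### Splitting occurrences -/

theorem length_fragment {T : List ℕ} {i j : ℕ} (hj : j ≤ T.length) :
    (fragment T i j).length = j - i := by
  simp [fragment]; omega

theorem fragment_append {T : List ℕ} {i j r : ℕ} (hij : i ≤ j) (hjr : j ≤ r) :
    fragment T i j ++ fragment T j r = fragment T i r := by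
  unfold fragment
  rw [show r - i = (j - i) + (r - j) by omega, List.take_add, List.drop_drop,
    Nat.add_sub_cancel' hij]

/-- The alignment of a rotation with a fragment is cut where the end of the pattern meets its
beginning. -/
theorem circEditOcc_eq (k : ℕ) (T P : List ℕ) : circEditOcc k P T =
    ⋃ j ∈ Finset.range (T.length + 1), anchoredOcc k P T j := by
  ext i
  simp only [Set.mem_iUnion, Finset.mem_range, exists_prop]
  constructor
  · rintro ⟨r, h1, h2, P', ⟨n, rfl⟩, h3⟩
    rw [List.rotate_eq_drop_append_take_mod] at h3
    obtain ⟨W₁, W₂, h4, h5⟩ := exists_editDist_append_le (P.drop (n % P.length))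
      (P.take (n % P.length)) (fragment T i r)
    have hlen := congrArg List.length h4
    rw [length_fragment h2, List.length_append] at hlen
    have h6 := fragment_append (T := T) (i := i) (j := i + W₁.length) (r := r) (by omega) (by omega)
    rw [h4] at h6
    obtain ⟨h7, h8⟩ := List.append_inj h6 (by rw [length_fragment (by omega)]; omega)
    refine ⟨i + W₁.length, by omega, by omega, r, by omega, h2, P.take (n % P.length),
      P.drop (n % P.length), (List.take_append_drop _ _).symm, ?_⟩
    rw [h7, h8, editDist_comm W₁, editDist_comm W₂]
    exact h5.trans h3
  · rintro ⟨j, hj, hij, r, hjr, hr, P₁, P₂, rfl, h⟩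
    refine ⟨r, by omega, hr, P₂ ++ P₁, List.isRotated_append, ?_⟩
    rw [← fragment_append hij hjr]
    refine (editDist_append_le _ _ _ _).trans ?_
    rwa [editDist_comm P₂, editDist_comm P₁]

/-- Membership in `anchoredOcc` in terms of prefixes of the text after the split position and of
prefixes of the reversed strings. -/
theorem mem_anchoredOcc_iff {k j i : ℕ} {T P : List ℕ} (hj : j ≤ T.length) :
    i ∈ anchoredOcc k P T j ↔ i ≤ j ∧ ∃ e ≤ k, ∃ z ≤ P.length,
      editDist ((T.take j).reverse.take (j - i)) (P.reverse.take z) ≤ e ∧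
      ∃ x ≤ T.length - j, editDist ((T.drop j).take x) (P.take (P.length - z)) ≤ k - e := by
  have hfr : i ≤ j → ∀ z ≤ P.length,
      editDist ((T.take j).reverse.take (j - i)) (P.reverse.take z) =
      editDist (fragment T i j) (P.drop (P.length - z)) := by
    intro hij z hz
    rw [List.take_reverse, List.take_reverse, editDist_reverse, fragment, List.length_take,
      List.drop_take, Nat.min_eq_left hj, Nat.sub_sub_self hij]
  constructor
  · rintro ⟨hij, r, hjr, hr, P₁, P₂, rfl, h⟩
    refine ⟨hij, editDist (fragment T i j) P₂, by omega, P₂.length, by simp, ?_, r - j, by omega, ?_⟩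
    · rw [hfr hij _ (by simp)]
      simp
    · simp [fragment] at h ⊢
      omega
  · rintro ⟨hij, e, he, z, hz, h1, x, hx, h2⟩
    refine ⟨hij, j + x, by omega, by omega, P.take (P.length - z), P.drop (P.length - z),
      (List.take_append_drop _ _).symm, ?_⟩
    rw [hfr hij z hz] at h1
    rw [fragment, fragment, Nat.add_sub_cancel_left] at *
    omega

/-! ### Furthest-reaching points on the diagonals -/

section
variable {mt : ℕ → ℕ → Prop} {lx ly k e : ℕ} {D : ℕ → ℕ → ℕ} {Z Z' : ℕ → ℕ}

/-- The value of a cell is at least its distance from the main diagonal. -/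
theorem EditTable.diff_le (h : EditTable mt lx ly D) : ∀ {x y : ℕ}, x ≤ lx → y ≤ ly →
    x ≤ D x y + y ∧ y ≤ D x y + x := by
  intro x
  induction x with
  | zero => intro y _ hy; rw [h.top y hy]; omega
  | succ x ihx =>
    intro y hx hy
    induction y with
    | zero => rw [h.left _ hx]; omega
    | succ y ihy =>
      have h1 := ihx (y := y) (by omega) (by omega)
      have h2 := ihx (y := y + 1) (by omega) hy
      have h3 := ihy (by omega)
      rcases (h.step x hx y hy _).1 le_rfl with ⟨-, h4⟩ | h4 | h4 | h4 <;> omega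

/-- `Z` describes, for every diagonal `δ`, the furthest cell of the table with value at most `e`.
Diagonal `δ` consists of the cells `(x, y)` with `y + k + 1 = x + δ`, and a furthest cell in column
`x` is encoded as `x + (k + 2)`. The offset leaves room for increments: a diagonal without such a
cell has an entry of at most `e`. By `valid`, every other entry stands for a cell with nonnegative
coordinates, possibly beyond the table, that is at most `e` diagonals away from the main one. -/
structure Furthest (lx ly k : ℕ) (D : ℕ → ℕ → ℕ) (e : ℕ) (Z : ℕ → ℕ) : Prop where
  cell : ∀ δ ≤ 2 * k + 2, ∀ x ≤ lx, ∀ y ≤ ly, y + k + 1 = x + δ →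
    (D x y ≤ e ↔ x + (k + 2) ≤ Z δ)
  valid : ∀ δ ≤ 2 * k + 2, Z δ ≤ e ∨
    k + 2 ≤ Z δ ∧ (k + 2) + (k + 1) ≤ Z δ + δ ∧ k + 1 ≤ δ + e ∧ δ ≤ k + 1 + e

theorem Furthest.congr (h : Furthest lx ly k D e Z) (hZ : ∀ δ < 2 * k + 3, Z' δ = Z δ) :
    Furthest lx ly k D e Z' where
  cell δ hδ := by rw [hZ δ (by omega)]; exact h.cell δ hδ
  valid δ hδ := by rw [hZ δ (by omega)]; exact h.valid δ hδ

/-- `v` is the number of consecutive matches from cell `(x, y)` down the diagonal. -/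
def IsSlide (mt : ℕ → ℕ → Prop) (lx ly x y v : ℕ) : Prop :=
  ∀ h, h ≤ v ↔ h ≤ lx - x ∧ h ≤ ly - y ∧ ∀ i < h, mt (x + i) (y + i)

/-- The entry `v` arises from `c` by sliding down diagonal `δ`. -/
def Slides (mt : ℕ → ℕ → Prop) (lx ly k δ c v : ℕ) : Prop :=
  (c < k + 2 → v = c) ∧ (k + 2 ≤ c → ∃ l, v = c + l ∧
    IsSlide mt lx ly (c - (k + 2)) (c - (k + 2) + δ - (k + 1)) l)

theorem Slides.le {δ c v : ℕ} (h : Slides mt lx ly k δ c v) :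
    v ≤ max c (lx + k + 2) := by
  rcases Nat.lt_or_ge c (k + 2) with h1 | h1
  · rw [h.1 h1]; exact le_max_left _ _
  · obtain ⟨l, rfl, h2⟩ := h.2 h1
    have := (h2 l).1 le_rfl
    omega

/-- Matches do not increase the distance. -/
theorem EditTable.slide (h : EditTable mt lx ly D) {x y v l : ℕ} (hv : IsSlide mt lx ly x y v)
    (hx : x ≤ lx) (hy : y ≤ ly) (hD : D x y ≤ e) (hl : l ≤ v) : D (x + l) (y + l) ≤ e := by
  have h1 := (hv v).1 le_rfl
  induction l with
  | zero => exact hD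
  | succ l ih =>
    rw [← add_assoc, ← add_assoc, h.step _ (by omega) _ (by omega)]
    exact .inl ⟨h1.2.2 l (by omega), ih (by omega)⟩

/-- Without edits one slides down the main diagonal. -/
theorem EditTable.furthest_zero (h : EditTable mt lx ly D) (h0 : ∀ δ, δ ≠ k + 1 → Z δ = 0)
    (hk : Slides mt lx ly k (k + 1) (k + 2) (Z (k + 1))) : Furthest lx ly k D 0 Z := by
  obtain ⟨v, hv, hs⟩ := hk.2 le_rfl
  rw [Nat.sub_self, Nat.zero_add, Nat.sub_self] at hs
  refine ⟨fun δ hδ x hx y hy hxy => ?_, fun δ hδ => ?_⟩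
  · by_cases hδk : δ = k + 1
    · subst hδk
      obtain rfl : y = x := by omega
      rw [hv, show y + (k + 2) ≤ k + 2 + v ↔ y ≤ v by omega]
      constructor
      · intro hD
        rw [hs]
        refine ⟨by omega, by omega, fun i hi => ?_⟩
        have key : ∀ t ≤ y, D (y - t) (y - t) ≤ 0 := by
          intro t ht
          induction t with
          | zero => exact hD
          | succ t ih =>
            have := ih (by omega)
            rw [show y - t = y - (t + 1) + 1 by omega,
              h.step _ (by omega) _ (by omega)] at this
            rcases this with h1 | h1 | h1 | h1
            · exact h1.2
            all_goals omega
        have := key (y - (i + 1)) (by omega)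
        rw [show y - (y - (i + 1)) = i + 1 by omega, h.step _ (by omega) _ (by omega)] at this
        rcases this with h1 | h1 | h1 | h1
        · simpa using h1.1
        all_goals omega
      · intro hy
        have := h.slide hs (Nat.zero_le _) (Nat.zero_le _) (e := 0) (by rw [h.top 0 (by omega)]) hy
        simpa using this
    · rw [h0 δ hδk]
      have := h.diff_le hx hy
      omega
  · by_cases hδk : δ = k + 1
    · subst hδk
      exact .inr (by omega)
    · exact .inl (by rw [h0 δ hδk])

/-- The candidate for the furthest cell on diagonal `δ`, before sliding, from the furthest cells
with one error less. -/
def candidate (Z : ℕ → ℕ) (δ : ℕ) : ℕ := max (Z δ + 1) (max (Z (δ - 1)) (Z (δ + 1) + 1))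

/-- The step from `e` to `e + 1` edits. The two border diagonals hold no cell with value at most
`k`; they save a case distinction. -/
theorem EditTable.furthest_succ (h : EditTable mt lx ly D) (hZ : Furthest lx ly k D e Z)
    (he : e + 1 ≤ k) (hfirst : Z' 0 = 0) (hlast : Z' (2 * k + 2) = 0)
    (hstep : ∀ δ, 0 < δ → δ < 2 * k + 2 → Slides mt lx ly k δ (candidate Z δ) (Z' δ)) :
    Furthest lx ly k D (e + 1) Z' := by
  have hborder : ∀ δ, δ = 0 ∨ δ = 2 * k + 2 → Z' δ = 0 := by
    rintro δ (rfl | rfl) <;> assumption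
  -- the invariant on entries holds already before sliding
  have hc : ∀ δ, 0 < δ → δ < 2 * k + 2 → candidate Z δ ≤ e + 1 ∨
      k + 2 ≤ candidate Z δ ∧ (k + 2) + (k + 1) ≤ candidate Z δ + δ ∧ k + 1 ≤ δ + (e + 1) ∧
        δ ≤ k + 1 + (e + 1) := by
    intro δ h1 h2
    have v1 := hZ.valid δ (by omega)
    have v2 := hZ.valid (δ - 1) (by omega)
    have v3 := hZ.valid (δ + 1) (by omega)
    unfold candidate
    omega
  have hZ' : ∀ δ, 0 < δ → δ < 2 * k + 2 → candidate Z δ ≤ Z' δ := by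
    intro δ h1 h2
    rcases Nat.lt_or_ge (candidate Z δ) (k + 2) with h3 | h3
    · exact ((hstep δ h1 h2).1 h3).ge
    · obtain ⟨l, h4, -⟩ := (hstep δ h1 h2).2 h3
      omega
  -- cells up to the candidate are reached
  have hreach : ∀ δ, 0 < δ → δ < 2 * k + 2 → ∀ x ≤ lx, ∀ y ≤ ly, y + k + 1 = x + δ →
      x + (k + 2) ≤ candidate Z δ → D x y ≤ e + 1 := by
    intro δ h1 h2 x hx y hy hxy hxc
    have := hc δ h1 h2
    rcases Nat.eq_zero_or_pos x with rfl | hx0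
    · rw [h.top y hy]; omega
    rcases Nat.eq_zero_or_pos y with rfl | hy0
    · rw [h.left x hx]; omega
    obtain ⟨x, rfl⟩ : ∃ t, x = t + 1 := ⟨x - 1, by omega⟩
    obtain ⟨y, rfl⟩ : ∃ t, y = t + 1 := ⟨y - 1, by omega⟩
    rw [h.step x hx y hy]
    simp only [candidate, le_max_iff] at hxc
    rcases hxc with h3 | h3 | h3
    · have := (hZ.cell δ (by omega) x (by omega) y (by omega) (by omega)).2 (by omega)
      omega
    · have := (hZ.cell (δ - 1) (by omega) (x + 1) hx y (by omega) (by omega)).2 (by omega)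
      omega
    · have := (hZ.cell (δ + 1) (by omega) x (by omega) (y + 1) hy (by omega)).2 (by omega)
      omega
  refine ⟨fun δ hδ x hx y hy hxy => ?_, fun δ hδ => ?_⟩
  · have hdiff := h.diff_le hx hy
    by_cases hδ0 : δ = 0 ∨ δ = 2 * k + 2
    · rw [hborder δ hδ0]
      omega
    have h1 : 0 < δ := by omega
    have h2 : δ < 2 * k + 2 := by omega
    constructor
    · intro hD
      clear hdiff
      induction x generalizing y with
      | zero =>
        rw [h.top y hy] at hD
        have hle := hZ' δ h1 h2
        simp only [candidate, max_le_iff] at hle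
        rcases Nat.eq_zero_or_pos y with rfl | hy0
        · have := (hZ.cell δ hδ 0 hx 0 hy hxy).1 (by rw [h.top 0 hy]; omega)
          omega
        · have := (hZ.cell (δ - 1) (by omega) 0 hx (y - 1) (by omega) (by omega)).1
            (by rw [h.top _ (by omega)]; omega)
          omega
      | succ x ih =>
        have hle := hZ' δ h1 h2
        simp only [candidate, max_le_iff] at hle
        rcases Nat.eq_zero_or_pos y with rfl | hy0
        · rw [h.left _ hx] at hD
          have := (hZ.cell (δ + 1) (by omega) x (by omega) 0 hy (by omega)).1
            (by rw [h.left _ (by omega)]; omega)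
          omega
        obtain ⟨y, rfl⟩ : ∃ t, y = t + 1 := ⟨y - 1, by omega⟩
        rcases (h.step x hx y hy _).1 hD with ⟨hm, h3⟩ | h3 | h3 | h3
        · have h4 := ih (by omega) y (by omega) (by omega) h3
          by_contra hcon
          rcases Nat.lt_or_ge (candidate Z δ) (k + 2) with h5 | h5
          · have := (hstep δ h1 h2).1 h5
            omega
          · obtain ⟨l, h6, h7⟩ := (hstep δ h1 h2).2 h5
            have h8 := (h7 l).1 le_rfl
            have h11 := hc δ h1 h2
            have h9 := (h7 (l + 1)).2 ⟨by omega, by omega, fun i hi => by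
              rcases (Nat.lt_succ_iff.1 hi).lt_or_eq with h10 | rfl
              · exact h8.2.2 i h10
              · have e1 : candidate Z δ - (k + 2) + i = x := by omega
                have e2 : candidate Z δ - (k + 2) + δ - (k + 1) + i = y := by omega
                rwa [e1, e2]⟩
            omega
        · have := (hZ.cell δ (by omega) x (by omega) y (by omega) (by omega)).1 (by omega)
          omega
        · have := (hZ.cell (δ + 1) (by omega) x (by omega) (y + 1) hy (by omega)).1 (by omega)
          omega
        · have := (hZ.cell (δ - 1) (by omega) (x + 1) hx y (by omega) (by omega)).1 (by omega)
          omega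
    · intro hxZ
      rcases Nat.lt_or_ge (candidate Z δ) (x + (k + 2)) with h3 | h3
      · have h4 := hc δ h1 h2
        rcases Nat.lt_or_ge (candidate Z δ) (k + 2) with h5 | h5
        · have := (hstep δ h1 h2).1 h5
          omega
        · obtain ⟨l, h6, h7⟩ := (hstep δ h1 h2).2 h5
          have h8 := (h7 l).1 le_rfl
          have h9 := hreach δ h1 h2 (candidate Z δ - (k + 2)) (by omega)
            (candidate Z δ - (k + 2) + δ - (k + 1)) (by omega) (by omega) (by omega)
          have h10 := h.slide h7 (by omega) (by omega) h9
            (by omega : x - (candidate Z δ - (k + 2)) ≤ l)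
          rwa [show candidate Z δ - (k + 2) + (x - (candidate Z δ - (k + 2))) = x by omega,
            show candidate Z δ - (k + 2) + δ - (k + 1) + (x - (candidate Z δ - (k + 2))) = y by
              omega] at h10
      · exact hreach δ h1 h2 x hx y hy hxy h3
  · by_cases hδ0 : δ = 0 ∨ δ = 2 * k + 2
    · exact .inl (by rw [hborder δ hδ0]; omega)
    have h1 : 0 < δ := by omega
    have h2 : δ < 2 * k + 2 := by omega
    have h3 := hc δ h1 h2
    rcases Nat.lt_or_ge (candidate Z δ) (k + 2) with h5 | h5
    · have := (hstep δ h1 h2).1 h5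
      omega
    · obtain ⟨l, h6, -⟩ := (hstep δ h1 h2).2 h5
      omega

/-- The longest prefix within distance `e`, read off from the furthest cells on all diagonals. -/
theorem EditTable.exists_le_iff (h : EditTable mt lx ly D) (hZ : Furthest lx ly k D e Z)
    (he : e ≤ k) {L : ℕ} (hL : ∀ v, v ≤ L ↔ v = 0 ∨ ∃ δ < 2 * k + 3, k + 2 ≤ Z δ ∧
      v ≤ min (Z δ - (k + 2)) lx + δ - (k + 1)) {y : ℕ} (hy : y ≤ ly) :
    (∃ x ≤ lx, D x y ≤ e) ↔ y ≤ L := by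
  rw [hL]
  constructor
  · rintro ⟨x, hx, hD⟩
    have hdiff := h.diff_le hx hy
    have := (hZ.cell (y + k + 1 - x) (by omega) x hx y hy (by omega)).1 hD
    exact .inr ⟨y + k + 1 - x, by omega, by omega, by omega⟩
  · rintro h0
    rcases Nat.eq_zero_or_pos y with rfl | hy0
    · exact ⟨0, Nat.zero_le _, by rw [h.top 0 hy]; omega⟩
    rcases h0 with rfl | ⟨δ, hδ, h1, h2⟩
    · omega
    · rcases Nat.lt_or_ge (y + k + 1) δ with h3 | h3
      · have := hZ.valid δ (by omega)
        exact ⟨0, Nat.zero_le _, by rw [h.top y hy]; omega⟩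
      · exact ⟨y + k + 1 - δ, by omega,
          (hZ.cell δ (by omega) _ (by omega) y hy (by omega)).2 (by omega)⟩

end

end CircularMatching

namespace WordRAM

open CircularMatching

/-! ### Computing the furthest-reaching points -/

notation "rC" => (39 : ℕ)
notation "rDl" => (40 : ℕ)
notation "rXx" => (41 : ℕ)
notation "rYy" => (42 : ℕ)
notation "rLx" => (43 : ℕ)
notation "rLy" => (44 : ℕ)
notation "rUo" => (45 : ℕ)
notation "rVo" => (46 : ℕ)
notation "rE" => (47 : ℕ)
notation "rRow" => (48 : ℕ)
notation "rPos" => (49 : ℕ)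
notation "aZ" => (28 : ℕ)

theorem LceReady.frame {N : ℕ} {S : ℕ → ℕ} {s s' : State} {p : Program} (h : LceReady N S s)
    (hF : Frame p s s') (hr : ∀ x ∈ [rBs, rNb], x ∉ p.wr)
    (hm : ∀ a ∈ [aG, aLg, aPw, aMk, aSp, aRnk], a ∉ p.wm) : LceReady N S s' := by
  simp only [List.mem_cons, List.not_mem_nil, or_false, forall_eq_or_imp, forall_eq] at hr hm
  obtain ⟨r1, r2⟩ := hr
  obtain ⟨m1, m2, m3, m4, m5, m6⟩ := hm
  exact h.congr (hF.reg _ r1) (hF.mem _ m1) (hF.mem _ m2) (hF.mem _ m3) (hF.mem _ m4)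
    (hF.reg _ r2) (hF.mem _ m5) (hF.mem _ m6)

/-- The strings `S[u .. u + lx)` and `S[v .. v + ly)` are to be compared with up to `k` edits. -/
structure Comparison (N k lx ly u v : ℕ) (S : ℕ → ℕ) (s : State) : Prop where
  lce : LceReady N S s
  regk : s.reg 2 = k
  reglx : s.reg rLx = lx
  regly : s.reg rLy = ly
  regu : s.reg rUo = u
  regv : s.reg rVo = v
  sep : ∀ x < lx, ∀ y < ly, u + x < N ∧ v + y < N ∧ u + x ≠ v + y

section
variable {N k lx ly u v B : ℕ} {S : ℕ → ℕ} {s s' : State}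

theorem Comparison.frame {p : Program} (h : Comparison N k lx ly u v S s)
    (hF : Frame p s s') (hr : ∀ x ∈ [2, rLx, rLy, rUo, rVo, rBs, rNb], x ∉ p.wr)
    (hm : ∀ a ∈ [aG, aLg, aPw, aMk, aSp, aRnk], a ∉ p.wm) :
    Comparison N k lx ly u v S s' where
  lce := h.lce.frame hF (fun x hx => hr x (by simp at hx ⊢; omega)) hm
  regk := (hF.reg _ (hr _ (by simp))).trans h.regk
  reglx := (hF.reg _ (hr _ (by simp))).trans h.reglx
  regly := (hF.reg _ (hr _ (by simp))).trans h.regly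
  regu := (hF.reg _ (hr _ (by simp))).trans h.regu
  regv := (hF.reg _ (hr _ (by simp))).trans h.regv
  sep := h.sep

theorem Comparison.setReg (h : Comparison N k lx ly u v S s) {x w : ℕ}
    (hx : x ∉ [2, rLx, rLy, rUo, rVo, rBs, rNb]) :
    Comparison N k lx ly u v S (s.setReg x w) := by
  have hne : ∀ y ∈ [2, rLx, rLy, rUo, rVo, rBs, rNb], (s.setReg x w).reg y = s.reg y :=
    fun y hy => by rw [reg_setReg, if_neg (fun e => hx (e ▸ hy) : y ≠ x)]
  exact ⟨h.lce.congr (hne _ (by simp)) rfl rfl rfl rfl (hne _ (by simp)) rfl rfl,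
    (hne _ (by simp)).trans h.regk, (hne _ (by simp)).trans h.reglx,
    (hne _ (by simp)).trans h.regly, (hne _ (by simp)).trans h.regu,
    (hne _ (by simp)).trans h.regv, h.sep⟩

theorem Comparison.setMem (h : Comparison N k lx ly u v S s) {a i w : ℕ}
    (ha : a ∉ [aG, aLg, aPw, aMk, aSp, aRnk]) : Comparison N k lx ly u v S (s.setMem a i w) := by
  have hne : ∀ b ∈ [aG, aLg, aPw, aMk, aSp, aRnk], (s.setMem a i w).mem b = s.mem b :=
    fun b hb => by rw [mem_setMem, if_neg (fun e => ha (e ▸ hb) : b ≠ a)]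
  exact ⟨h.lce.congr rfl (hne _ (by simp)) (hne _ (by simp)) (hne _ (by simp)) (hne _ (by simp))
    rfl (hne _ (by simp)) (hne _ (by simp)), h.regk, h.reglx, h.regly, h.regu, h.regv, h.sep⟩

/-- Slides down diagonal `rDl` from the encoded cell in `rC`. -/
def slide : Program :=
  ifThen (rg 2 + 1 <! rg rC)
    (rXx ≔ rg rC - (rg 2 + 2) ;;
      rYy ≔ rg rXx + rg rDl - (rg 2 + 1) ;;
      ifThen ((rg rXx <! rg rLx) * (rg rYy <! rg rLy))
        (rFst ≔ rg rUo + rg rXx ;;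
          rSnd ≔ rg rVo + rg rYy ;;
          lce ;;
          minD (rg rLx - rg rXx) ;;
          minD (rg rLy - rg rYy) ;;
          rC ≔ rg rC + rg rD))

theorem slide_spec {δ c : ℕ} (hB : Bdd B s) (h : Comparison N k lx ly u v S s)
    (hδ : s.reg rDl = δ) (hc : s.reg rC = c) (hcB : c + δ < B) (hxB : lx + k + 2 < B)
    (hyB : ly < B) (hNB : 2 * N < B) :
    wp B slide s fun s' t => t ≤ 700 ∧
      Slides (fun x y => S (u + x) = S (v + y)) lx ly k δ c (s'.reg rC) := by
  rw [slide, wp_cond]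
  simp only [ev_lt, ev_add, ev_reg, ev_ofNat, h.regk, hc]
  refine ⟨fun hk => ?_, fun hk => ?_⟩
  · have hk : k + 1 < c := by by_contra hcon; simp [hcon] at hk
    rw [wp_seq, wp_assign]
    simp only [ev_sub, ev_add, ev_reg, ev_ofNat, h.regk, hc]
    obtain ⟨x, hx⟩ : ∃ x, x = c - (k + 2) := ⟨_, rfl⟩
    rw [← hx]
    refine ⟨by omega, ?_⟩
    rw [wp_seq, wp_assign]
    have e1 : (rg rXx + rg rDl - (rg 2 + 1)).ev (s.setReg rXx x) = x + δ - (k + 1) := by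
      simp [h.regk, hδ]
    obtain ⟨y, hy⟩ : ∃ y, y = x + δ - (k + 1) := ⟨_, rfl⟩
    rw [e1, ← hy]
    refine ⟨by omega, ?_⟩
    have hB1 : Bdd B ((s.setReg rXx x).setReg rYy y) := (hB.setReg (by omega)).setReg (by omega)
    rw [wp_cond]
    simp [h.reglx, h.regly]
    refine ⟨fun hyl hxl => ?_, fun hxy => ?_⟩
    · obtain ⟨k1, k2, k3⟩ := h.sep x hxl y hyl
      simp only [h.regu, h.regv]
      refine ⟨by omega, by omega, ?_⟩
      set s1 := (((s.setReg rXx x).setReg rYy y).setReg rFst (u + x)).setReg rSnd (v + y) with hs1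
      have hB2 : Bdd B s1 := (hB1.setReg (by omega)).setReg (by omega)
      have h1 : LceReady N S s1 := h.lce.congr (by simp [hs1]) (by simp [hs1]) (by simp [hs1])
        (by simp [hs1]) (by simp [hs1]) (by simp [hs1]) (by simp [hs1]) (by simp [hs1])
      have b1 : s1.reg rC = c := by simp [hs1, hc]
      have b2 : s1.reg rLx = lx := by simp [hs1, h.reglx]
      have b3 : s1.reg rLy = ly := by simp [hs1, h.regly]
      have b4 : s1.reg rXx = x := by simp [hs1]
      have b5 : s1.reg rYy = y := by simp [hs1]
      refine (lce_spec hB2 h1 (by simp [hs1]) (by simp [hs1]) k1 k2 k3 hNB).call hB2 ?_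
      clear_value s1
      rintro s2 t2 hF2 hB3 ⟨ht2, hl⟩
      refine (minD_spec (e := rg rLx - rg rXx) (v := lx - x) (w := s2.reg rD) ?_ rfl
        (by omega)).call hB3 ?_
      · simp [hF2.reg rLx (by decide), hF2.reg rXx (by decide), b2, b4]
      rintro s3 t3 hF3 hB4 ⟨ht3, hD3⟩
      refine (minD_spec (e := rg rLy - rg rYy) (v := ly - y) ?_ hD3 (by omega)).call hB4 ?_
      · simp [hF3.reg rLy (by decide), hF3.reg rYy (by decide), hF2.reg rLy (by decide),
          hF2.reg rYy (by decide), b3, b5]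
      rintro s4 t4 hF4 hB5 ⟨ht4, hD4⟩
      have b6 : s4.reg rC = c := by
        rw [hF4.reg _ (by decide), hF3.reg _ (by decide), hF2.reg _ (by decide), b1]
      rw [b6, hD4]
      simp at ht3 ht4
      refine ⟨by omega, by omega, fun hc' => by omega, fun _ => ⟨_, rfl, ?_⟩⟩
      rw [← hx, ← hy]
      intro l
      rw [le_min_iff, le_min_iff, hl l]
      simp only [add_assoc]
      tauto
    · refine ⟨fun hc' => by simp [hc], fun _ => ⟨0, by simp [hc], ?_⟩⟩
      rw [← hx, ← hy]
      intro l
      constructor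
      · intro hl
        obtain rfl : l = 0 := by omega
        simp
      · rintro ⟨h1, h2, -⟩
        rcases Nat.lt_or_ge y ly with h3 | h3
        · have := hxy h3
          omega
        · omega
  · have hk : ¬ k + 1 < c := by
      intro hcon; simp [hcon] at hk
    simp [hc]
    exact ⟨fun _ => rfl, fun h => by omega⟩

/-- Replaces `rC` by the value of `e` if that is larger. -/
def maxC (e : Expr) : Program := rY ≔ e ;; ifThen (rg rC <! rg rY) (rC ≔ rg rY)

theorem maxC_spec {v w : ℕ} {e : Expr} (h1 : e.ev s = v) (h2 : s.reg rC = w) (hv : v < B) :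
    wp B (maxC e) s fun s' t => t ≤ e.cost + 10 ∧ s'.reg rC = max w v := by
  simp [maxC, h1, h2]
  exact ⟨hv, fun h => ⟨hv, h.le⟩⟩

/-- The furthest cells with value `0`. -/
def furthestZero : Program :=
  forLoop rDl 0 (2 * rg 2 + 3) (.store aZ (rg rDl) 0) ;;
  rDl ≔ rg 2 + 1 ;;
  rC ≔ rg 2 + 2 ;;
  slide ;;
  .store aZ (rg 2 + 1) (rg rC)

/-- The furthest cells with value at most `rE`, from those with value at most `rE - 1`. -/
def furthestSucc : Program :=
  rRow ≔ rg rE * (2 * rg 2 + 3) ;;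
  .store aZ (rg rRow) 0 ;;
  .store aZ (rg rRow + (2 * rg 2 + 2)) 0 ;;
  forLoop rDl 1 (2 * rg 2 + 2)
    (rPos ≔ rg rRow - (2 * rg 2 + 3) + rg rDl ;;
      rC ≔ ld aZ (rg rPos) + 1 ;;
      maxC (ld aZ (rg rPos - 1)) ;;
      maxC (ld aZ (rg rPos + 1) + 1) ;;
      slide ;;
      .store aZ (rg rRow + rg rDl) (rg rC))

/-- The furthest cells with value at most `e`, for all `e ≤ k`; row `e` is stored in `aZ` with stride
`2 * k + 3`. -/
def furthest : Program :=
  furthestZero ;; forLoop rE 1 (rg 2 + 1) furthestSucc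

theorem furthestZero_spec {D : ℕ → ℕ → ℕ} (hB : Bdd B s) (h : Comparison N k lx ly u v S s)
    (hD : EditTable (fun x y => S (u + x) = S (v + y)) lx ly D) (hxB : lx + 4 * k + 10 < B)
    (hyB : ly < B) (hNB : 2 * N < B) :
    wp B furthestZero s fun s' t => t ≤ 100 * (2 * k + 3) + 800 ∧
      Furthest lx ly k D 0 (s'.mem aZ) ∧ ∀ δ < 2 * k + 3, s'.mem aZ δ ≤ lx + k + 2 := by
  rw [furthestZero, wp_seq]
  refine wp_for 0 (2 * k + 3) 20 (fun q s' => ∀ δ < q, s'.mem aZ δ = 0) hB (by decide) (by omega)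
    (by simp) (by omega) ?_ ?_ ?_ ?_
  · intro s' hF
    simp [hF.reg 2 (by decide), h.regk]
  · intro δ hδ; omega
  · intro q s' _ hq hi hF hB' hI
    simp [hi]
    refine ⟨by omega, fun δ hδ => ?_⟩
    by_cases hδq : δ = q
    · subst hδq; simp
    · rw [Function.update_of_ne hδq]
      exact hI δ (by omega)
  · intro s1 t1 ht1 _ hF1 hB1 hI1
    have h1 := h.frame hF1 (by decide) (by decide)
    have e1 : (rg 2 + 1).ev s1 = k + 1 := by simp [h1.regk]
    have e2 : (rg 2 + 2).ev (s1.setReg rDl (k + 1)) = k + 2 := by simp [h1.regk]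
    rw [wp_seq, wp_assign, e1]
    refine ⟨by omega, ?_⟩
    rw [wp_seq, wp_assign, e2]
    refine ⟨by omega, ?_⟩
    have hB2 : Bdd B ((s1.setReg rDl (k + 1)).setReg rC (k + 2)) :=
      (hB1.setReg (by omega)).setReg (by omega)
    rw [wp_seq]
    refine (slide_spec (δ := k + 1) (c := k + 2) hB2
      ((h1.setReg (by decide)).setReg (by decide)) (by simp) (by simp) (by omega) (by omega) hyB
      hNB).call hB2 ?_
    rintro s2 t2 hF2 hB3 ⟨ht2, hs2⟩
    have e3 : s2.reg 2 = k := by rw [hF2.reg _ (by decide)]; simp [h1.regk]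
    have e4 : s2.mem aZ = s1.mem aZ := by rw [hF2.mem _ (by decide)]; simp
    have hle := hs2.le
    rw [wp_store]
    simp only [ev_add, ev_reg, ev_ofNat, e3, e4, mem_setMem, if_true]
    have hval : ∀ δ < 2 * k + 3, δ ≠ k + 1 →
        Function.update (s1.mem aZ) (k + 1) (s2.reg rC) δ = 0 := fun δ hδ hne => by
      rw [Function.update_of_ne hne]
      exact hI1 δ hδ
    simp at ht1
    refine ⟨by omega, by simp; omega, ?_, fun δ hδ => ?_⟩
    · have key := hD.furthest_zero (k := k)
        (Z := fun δ => if δ = k + 1 then s2.reg rC else 0) (fun δ hδ => by simp [hδ])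
        (by simpa using hs2)
      refine key.congr fun δ hδ => ?_
      by_cases hne : δ = k + 1
      · subst hne; simp
      · rw [hval δ (by omega) hne, if_neg hne]
    · by_cases hne : δ = k + 1
      · subst hne
        rw [Function.update_self]
        omega
      · rw [hval δ hδ hne]
        omega

theorem furthestSucc_spec {e : ℕ} {D : ℕ → ℕ → ℕ} (hB : Bdd B s)
    (h : Comparison N k lx ly u v S s)
    (hD : EditTable (fun x y => S (u + x) = S (v + y)) lx ly D) (hxB : lx + 4 * k + 10 < B)
    (hyB : ly < B) (hNB : 2 * N < B) (hkB : (k + 2) * (2 * k + 3) < B) (hek : e + 1 ≤ k)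
    (he : s.reg rE = e + 1)
    (hZ : Furthest lx ly k D e fun δ => s.mem aZ (e * (2 * k + 3) + δ))
    (hZB : ∀ δ < 2 * k + 3, s.mem aZ (e * (2 * k + 3) + δ) ≤ lx + k + 2 + e) :
    wp B furthestSucc s fun s' t => t ≤ 900 * (2 * k + 3) ∧
      (∀ i < (e + 1) * (2 * k + 3), s'.mem aZ i = s.mem aZ i) ∧
      (Furthest lx ly k D (e + 1) fun δ => s'.mem aZ ((e + 1) * (2 * k + 3) + δ)) ∧
      ∀ δ < 2 * k + 3, s'.mem aZ ((e + 1) * (2 * k + 3) + δ) ≤ lx + k + 2 + (e + 1) := by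
  obtain ⟨R, hR⟩ : ∃ R, R = (e + 1) * (2 * k + 3) := ⟨_, rfl⟩
  obtain ⟨R', hR'⟩ : ∃ R', R' = e * (2 * k + 3) := ⟨_, rfl⟩
  have hRR : R = R' + (2 * k + 3) := by rw [hR, hR', Nat.add_mul, one_mul]
  have hRB : R + (2 * k + 3) < B := by
    have : (e + 2) * (2 * k + 3) ≤ (k + 2) * (2 * k + 3) := Nat.mul_le_mul (by omega) le_rfl
    rw [Nat.add_mul] at this
    omega
  simp only [← hR, ← hR'] at hZ hZB ⊢
  have e1 : (rg rE * (2 * rg 2 + 3)).ev s = R := by simp [he, h.regk, hR]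
  rw [furthestSucc, wp_seq, wp_assign, e1]
  refine ⟨by omega, ?_⟩
  rw [wp_seq, wp_store, wp_seq, wp_store]
  simp only [ev_reg, ev_add, ev_mul, ev_ofNat, reg_setReg, reg_setMem, if_true,
    show (2 = rRow) = False by simp, if_false, h.regk]
  refine ⟨by omega, by omega, ?_⟩
  set s1 := ((s.setReg rRow R).setMem aZ R 0).setMem aZ (R + (2 * k + 2)) 0 with hs1
  have hB1 : Bdd B s1 := ((hB.setReg (by omega)).setMem (by omega)).setMem (by omega)
  have h1 : Comparison N k lx ly u v S s1 :=
    ((h.setReg (by decide)).setMem (by decide)).setMem (by decide)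
  have hrow1 : s1.reg rRow = R := by simp [hs1]
  have hold1 : ∀ i < R, s1.mem aZ i = s.mem aZ i := fun i hi => by
    simp only [hs1, mem_setMem, if_true, mem_setReg]
    rw [Function.update_of_ne (by omega), Function.update_of_ne (by omega)]
  have hl1 : s1.mem aZ (R + (2 * k + 2)) = 0 := by simp [hs1]
  have hf1 : s1.mem aZ R = 0 := by
    simp only [hs1, mem_setMem, if_true, mem_setReg]
    rw [Function.update_of_ne (by omega), Function.update_self]
  clear_value s1
  refine wp_for 1 (2 * k + 2) 800 (fun q s' => (∀ i < R, s'.mem aZ i = s.mem aZ i) ∧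
    s'.mem aZ (R + (2 * k + 2)) = 0 ∧ s'.mem aZ R = 0 ∧
    ∀ δ, 0 < δ → δ < q → Slides (fun x y => S (u + x) = S (v + y)) lx ly k δ
      (candidate (fun δ => s.mem aZ (R' + δ)) δ) (s'.mem aZ (R + δ))) hB1 (by decide) (by omega)
    (by simp) (by omega) ?_ ?_ ?_ ?_
  · intro s' hF
    simp [hF.reg 2 (by decide), h1.regk]
  · exact ⟨hold1, hl1, hf1, fun δ h2 h3 => by omega⟩
  · rintro δ s' hδ1 hδ2 hi hF hB' ⟨i1, i2, i3, i4⟩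
    have h2 := h1.frame hF (by decide) (by decide)
    have hrow : s'.reg rRow = R := by rw [hF.reg _ (by decide), hrow1]
    have e2 : (rg rRow - (2 * rg 2 + 3) + rg rDl).ev s' = R' + δ := by
      simp [hrow, h2.regk, hi]; omega
    rw [wp_seq, wp_assign, e2]
    refine ⟨by omega, ?_⟩
    have v1 : s'.mem aZ (R' + δ) = s.mem aZ (R' + δ) := i1 _ (by omega)
    have v2 : s'.mem aZ (R' + δ - 1) = s.mem aZ (R' + (δ - 1)) := by
      rw [i1 _ (by omega), Nat.add_sub_assoc hδ1]
    have v3 : s'.mem aZ (R' + δ + 1) = s.mem aZ (R' + (δ + 1)) := by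
      rcases (by omega : δ + 1 ≤ 2 * k + 2).lt_or_eq with h3 | h3
      · rw [i1 _ (by omega)]; rfl
      · rw [i1 _ (by omega)]; rfl
    have b1 := hZB δ (by omega)
    have b2 := hZB (δ - 1) (by omega)
    have b3 := hZB (δ + 1) (by omega)
    have hcand : candidate (fun δ => s.mem aZ (R' + δ)) δ ≤ lx + k + 2 + (e + 1) := by
      simp only [candidate]; omega
    rw [wp_seq, wp_assign]
    have e3 : (ld aZ (rg rPos) + 1).ev (s'.setReg rPos (R' + δ)) = s.mem aZ (R' + δ) + 1 := by
      simp [v1]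
    rw [e3]
    refine ⟨by omega, ?_⟩
    have hB2 : Bdd B ((s'.setReg rPos (R' + δ)).setReg rC (s.mem aZ (R' + δ) + 1)) :=
      (hB'.setReg (by omega)).setReg (by omega)
    rw [wp_seq]
    refine (maxC_spec (v := s.mem aZ (R' + (δ - 1))) (w := s.mem aZ (R' + δ) + 1) (by simp [v2])
      (by simp) (hB.2 _ _)).call hB2 ?_
    rintro s2 t2 hF2 hB3 ⟨ht2, hc2⟩
    rw [wp_seq]
    refine (maxC_spec (v := s.mem aZ (R' + (δ + 1)) + 1) ?_ hc2 (by omega)).call hB3 ?_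
    · simp [hF2.reg rPos (by decide), hF2.mem aZ (by decide), v3]
    rintro s3 t3 hF3 hB4 ⟨ht3, hc3⟩
    have hc3' : s3.reg rC = candidate (fun δ => s.mem aZ (R' + δ)) δ := by
      rw [hc3, candidate, max_assoc]
    have h3 := (((h2.setReg (w := R' + δ) (x := rPos) (by decide)).setReg
      (w := s.mem aZ (R' + δ) + 1) (x := rC) (by decide)).frame hF2 (by decide) (by decide)).frame
        hF3 (by decide) (by decide)
    have hd3 : s3.reg rDl = δ := by
      rw [hF3.reg _ (by decide), hF2.reg _ (by decide)]; simp [hi]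
    have hr3 : s3.reg rRow = R := by
      rw [hF3.reg _ (by decide), hF2.reg _ (by decide)]; simp [hrow]
    have hm3 : s3.mem aZ = s'.mem aZ := by
      rw [hF3.mem _ (by decide), hF2.mem _ (by decide)]; simp
    rw [wp_seq]
    refine (slide_spec hB4 h3 hd3 hc3' (by omega) (by omega) hyB hNB).call hB4 ?_
    rintro s4 t4 hF4 hB5 ⟨ht4, hs4⟩
    rw [wp_store]
    simp at ht2 ht3
    refine ⟨hB5.1 _, by simp; omega, ?_⟩
    have hd4 : s4.reg rDl = δ := by rw [hF4.reg _ (by decide), hd3]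
    have hr4 : s4.reg rRow = R := by rw [hF4.reg _ (by decide), hr3]
    have hm4 : s4.mem aZ = s'.mem aZ := by rw [hF4.mem _ (by decide), hm3]
    simp only [ev_add, ev_reg, hd4, hr4, hm4, mem_setReg, mem_setMem, if_true]
    refine ⟨fun i hi => ?_, ?_, ?_, fun δ' h5 h6 => ?_⟩
    · rw [Function.update_of_ne (by omega)]; exact i1 i hi
    · rw [Function.update_of_ne (by omega)]; exact i2
    · rw [Function.update_of_ne (by omega)]; exact i3
    · by_cases hne : δ' = δ
      · subst hne
        rw [Function.update_self]; exact hs4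
      · rw [Function.update_of_ne (by omega)]; exact i4 δ' h5 (by omega)
  · rintro s2 t2 ht2 _ hF2 hB2 ⟨i1, i2, i3, i4⟩
    have key := hD.furthest_succ (Z' := fun δ => s2.mem aZ (R + δ)) hZ hek i3 i2 i4
    simp at ht2
    refine ⟨by simp; omega, i1, key, fun δ hδ => ?_⟩
    rcases Nat.eq_zero_or_pos δ with rfl | h5
    · rw [Nat.add_zero, i3]; omega
    rcases (by omega : δ ≤ 2 * k + 2).lt_or_eq with h6 | rfl
    · have h7 := (i4 δ h5 h6).le
      have b1 := hZB δ (by omega)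
      have b2 := hZB (δ - 1) (by omega)
      have b3 := hZB (δ + 1) (by omega)
      simp only [candidate] at h7
      omega
    · rw [i2]; omega

/-- The `(k + 1) * (2 * k + 3)` entries take constant time each. -/
theorem furthest_spec {D : ℕ → ℕ → ℕ} (hB : Bdd B s) (h : Comparison N k lx ly u v S s)
    (hD : EditTable (fun x y => S (u + x) = S (v + y)) lx ly D) (hxB : lx + 4 * k + 10 < B)
    (hyB : ly < B) (hNB : 2 * N < B) (hkB : (k + 2) * (2 * k + 3) < B) :
    wp B furthest s fun s' t => t ≤ 2000 * ((k + 1) * (2 * k + 3)) ∧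
      ∀ e ≤ k, Furthest lx ly k D e fun δ => s'.mem aZ (e * (2 * k + 3) + δ) := by
  rw [furthest, wp_seq]
  refine (furthestZero_spec hB h hD hxB hyB hNB).call hB ?_
  rintro s1 t1 hF1 hB1 ⟨ht1, hZ1, hb1⟩
  have h1 := h.frame hF1 (by decide) (by decide)
  refine wp_for 1 (k + 1) (900 * (2 * k + 3)) (fun q s' =>
    (∀ e < q, Furthest lx ly k D e fun δ => s'.mem aZ (e * (2 * k + 3) + δ)) ∧
      ∀ δ < 2 * k + 3, s'.mem aZ ((q - 1) * (2 * k + 3) + δ) ≤ lx + k + 2 + (q - 1)) hB1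
    (by decide) (by omega) (by simp) (by omega) ?_ ?_ ?_ ?_
  · intro s' hF
    simp [hF.reg 2 (by decide), h1.regk]
  · refine ⟨fun e he => ?_, ?_⟩
    · obtain rfl : e = 0 := by omega
      simpa using hZ1
    · simpa using hb1
  · rintro q s' hq1 hq2 hi hF hB' ⟨i1, i2⟩
    obtain ⟨e, rfl⟩ : ∃ e, q = e + 1 := ⟨q - 1, by omega⟩
    rw [Nat.add_sub_cancel] at i2
    refine (furthestSucc_spec hB' (h1.frame hF (by decide) (by decide)) hD hxB hyB hNB hkB (by omega)
      hi (i1 e (by omega)) i2).mono ?_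
    rintro s2 t2 ⟨ht2, j1, j2, j3⟩
    refine ⟨ht2, fun e' he' => ?_, j3⟩
    rcases (by omega : e' ≤ e + 1).lt_or_eq with h3 | rfl
    · refine (i1 e' h3).congr fun δ hδ => j1 _ ?_
      have : (e' + 1) * (2 * k + 3) ≤ (e + 1) * (2 * k + 3) := Nat.mul_le_mul (by omega) le_rfl
      rw [Nat.add_mul] at this
      omega
    · exact j2
  · rintro s2 t2 ht2 _ hF2 hB2 ⟨i1, -⟩
    refine ⟨?_, fun e he => i1 e (by omega)⟩
    simp at ht2
    have e1 : (900 * (2 * k + 3) + 3 + 9) * k = 900 * (k * (2 * k + 3)) + 12 * k := by ring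
    have e2 : (k + 1) * (2 * k + 3) = k * (2 * k + 3) + (2 * k + 3) := by ring
    rw [e1] at ht2
    rw [e2]
    have : k ≤ k * (2 * k + 3) := Nat.le_mul_of_pos_right _ (by omega)
    omega

end

open CircularMatching

/-! ### Reporting the starting positions for one split position -/

notation "aLe" => (29 : ℕ)

/-- Replaces register `x` by the value of `e` if that is smaller. -/
def capReg (x : ℕ) (e : Expr) : Program := ifThen (e <! rg x) (x ≔ e)

theorem capReg_spec {B x v w : ℕ} {e : Expr} {s : State} (h1 : e.ev s = v) (h2 : s.reg x = w)
    (hv : v < B) :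
    wp B (capReg x e) s fun s' t => t ≤ 2 * e.cost + 10 ∧ s'.reg x = min w v := by
  simp [capReg, h1, h2]
  exact ⟨fun h => ⟨hv, by omega, h.le⟩, fun h => ⟨by omega, h⟩⟩

/-- For every `e ≤ k`, the length of the longest prefix of the second string within distance `e` of a
prefix of the first string. Points beyond the first string are moved back to its end. -/
def prefixLengths : Program :=
  forLoop rE 0 (rg 2 + 1)
    (rC ≔ 0 ;;
      rRow ≔ rg rE * (2 * rg 2 + 3) ;;
      forLoop rDl 0 (2 * rg 2 + 3)
        (rXx ≔ ld aZ (rg rRow + rg rDl) ;;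
          ifThen (rg 2 + 1 <! rg rXx)
            (rXx ≔ rg rXx - (rg 2 + 2) ;;
              capReg rXx (rg rLx) ;;
              maxC (rg rXx + rg rDl - (rg 2 + 1)))) ;;
      .store aLe (rg rE) (rg rC))

section
variable {N k lx ly u v B : ℕ} {S : ℕ → ℕ} {s : State}

theorem prefixLengths_spec {D : ℕ → ℕ → ℕ} {mt : ℕ → ℕ → Prop} (hB : Bdd B s) (hk : s.reg 2 = k)
    (hlx : s.reg rLx = lx) (hD : EditTable mt lx ly D)
    (hZ : ∀ e ≤ k, Furthest lx ly k D e fun δ => s.mem aZ (e * (2 * k + 3) + δ))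
    (hxB : lx + 4 * k + 10 < B) (hkB : (k + 2) * (2 * k + 3) < B) :
    wp B prefixLengths s fun s' t => t ≤ 300 * ((k + 1) * (2 * k + 3)) ∧
      ∀ e ≤ k, ∀ y ≤ ly, (∃ x ≤ lx, D x y ≤ e) ↔ y ≤ s'.mem aLe e := by
  refine wp_for 0 (k + 1) (160 * (2 * k + 3)) (fun q s' => ∀ e < q, ∀ y ≤ ly,
    (∃ x ≤ lx, D x y ≤ e) ↔ y ≤ s'.mem aLe e) hB (by decide) (by omega) (by simp) (by omega)
    ?_ ?_ ?_ ?_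
  · intro s' hF
    simp [hF.reg 2 (by decide), hk]
  · intro e he; omega
  · intro e s' _ he hi hF hB' hI
    have a1 : s'.reg 2 = k := by rw [hF.reg _ (by decide), hk]
    have a2 : s'.reg rLx = lx := by rw [hF.reg _ (by decide), hlx]
    have a3 : s'.mem aZ = s.mem aZ := hF.mem _ (by decide)
    obtain ⟨R, hR⟩ : ∃ R, R = e * (2 * k + 3) := ⟨_, rfl⟩
    have hRB : R < B := by
      have : e * (2 * k + 3) ≤ (k + 2) * (2 * k + 3) := Nat.mul_le_mul (by omega) le_rfl
      omega
    have hZe := hZ e (by omega)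
    rw [← hR] at hZe
    rw [wp_seq, wp_assign]
    refine ⟨by simp; omega, ?_⟩
    have e1 : (rg rE * (2 * rg 2 + 3)).ev (s'.setReg rC ((0 : Expr).ev s')) = R := by
      simp [hi, a1, hR]
    rw [wp_seq, wp_assign, e1]
    refine ⟨hRB, ?_⟩
    have hB1 : Bdd B ((s'.setReg rC ((0 : Expr).ev s')).setReg rRow R) :=
      (hB'.setReg (by simp; omega)).setReg hRB
    rw [wp_seq]
    refine wp_for 0 (2 * k + 3) 100 (fun q s'' => ∀ v, v ≤ s''.reg rC ↔ v = 0 ∨ ∃ δ < q,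
      k + 2 ≤ s.mem aZ (R + δ) ∧ v ≤ min (s.mem aZ (R + δ) - (k + 2)) lx + δ - (k + 1)) hB1
      (by decide) (by omega) (by simp) (by omega) ?_ ?_ ?_ ?_
    · intro s'' hF'
      simp [hF'.reg 2 (by decide), a1]
    · simp
    · intro δ s2 _ hδ hi2 hF2 hB2 hI2
      have b1 : s2.reg 2 = k := by rw [hF2.reg _ (by decide)]; simp [a1]
      have b2 : s2.reg rLx = lx := by rw [hF2.reg _ (by decide)]; simp [a2]
      have b3 : s2.mem aZ = s.mem aZ := by rw [hF2.mem _ (by decide)]; simp [a3]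
      have b4 : s2.reg rRow = R := by rw [hF2.reg _ (by decide)]; simp
      have hzB := hB.2 aZ (R + δ)
      set z := s.mem aZ (R + δ) with hz
      have e2 : (ld aZ (rg rRow + rg rDl)).ev s2 = z := by simp [b3, b4, hi2, hz]
      rw [wp_seq, wp_assign, e2]
      refine ⟨hzB, ?_⟩
      rw [wp_cond]
      simp only [ev_lt, ev_add, ev_reg, ev_ofNat, reg_setReg, if_true,
        show (2 = rXx) = False by simp, if_false, b1]
      have hlt : ∀ v, (∃ δ' < δ + 1, k + 2 ≤ s.mem aZ (R + δ') ∧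
          v ≤ min (s.mem aZ (R + δ') - (k + 2)) lx + δ' - (k + 1)) ↔
          (∃ δ' < δ, k + 2 ≤ s.mem aZ (R + δ') ∧
            v ≤ min (s.mem aZ (R + δ') - (k + 2)) lx + δ' - (k + 1)) ∨
          (k + 2 ≤ z ∧ v ≤ min (z - (k + 2)) lx + δ - (k + 1)) := by
        intro v
        constructor
        · rintro ⟨δ', h1, h2⟩
          rcases (Nat.lt_succ_iff.1 h1).lt_or_eq with h3 | rfl
          · exact .inl ⟨δ', h3, h2⟩
          · exact .inr h2
        · rintro (⟨δ', h1, h2⟩ | h2)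
          · exact ⟨δ', by omega, h2⟩
          · exact ⟨δ, by omega, h2⟩
      refine ⟨fun hc => ?_, fun hc => ?_⟩
      · have hc : k + 1 < z := by by_contra hcon; simp [hcon] at hc
        rw [wp_seq, wp_assign]
        have e3 : (rg rXx - (rg 2 + 2)).ev (s2.setReg rXx z) = z - (k + 2) := by simp [b1]
        rw [e3]
        refine ⟨by omega, ?_⟩
        have hB3 : Bdd B ((s2.setReg rXx z).setReg rXx (z - (k + 2))) :=
          (hB2.setReg hzB).setReg (by omega)
        rw [wp_seq]
        refine (capReg_spec (v := lx) (w := z - (k + 2)) (by simp [b2]) (by simp)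
          (by omega)).call hB3 ?_
        rintro s3 t3 hF3 hB4 ⟨ht3, hx3⟩
        refine (maxC_spec (v := min (z - (k + 2)) lx + δ - (k + 1)) (w := s2.reg rC) ?_ ?_
          (by omega)).mono ?_
        · simp [hx3, hF3.reg rDl (by decide), hF3.reg 2 (by decide), hi2, b1]
        · rw [hF3.reg _ (by decide)]; simp
        rintro s4 t4 ⟨ht4, hc4⟩
        simp at ht3 ht4
        refine ⟨by simp; omega, fun v => ?_⟩
        rw [if_neg (by decide), hc4, le_max_iff, hI2, hlt, or_assoc]
        have : k + 2 ≤ z := hc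
        simp [this]
      · have hc : ¬ k + 1 < z := by
          intro hcon; simp [hcon] at hc
        simp only [wp_skip]
        refine ⟨by simp, fun v => ?_⟩
        simp only [reg_setReg, show (rC = rDl) = False by simp, show (rC = rXx) = False by simp,
          if_false]
        rw [hI2, hlt]
        have : ¬ k + 2 ≤ z := hc
        simp [this]
    · intro s2 t2 ht2 _ hF2 hB2 hI2
      have b1 : s2.reg rE = e := by rw [hF2.reg _ (by decide)]; simp [hi]
      have b2 : s2.mem aLe = s'.mem aLe := by rw [hF2.mem _ (by decide)]; simp
      rw [wp_store]
      simp only [ev_reg, b1, b2, mem_setReg, mem_setMem, if_true]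
      simp at ht2
      refine ⟨hB2.1 _, by simp; omega, fun e' he' y hy => ?_⟩
      by_cases hee : e' = e
      · subst hee
        rw [Function.update_self]
        exact hD.exists_le_iff hZe (by omega) hI2 hy
      · rw [Function.update_of_ne hee]
        exact hI e' (by omega) y hy
  · intro s' t ht _ hF hB' hI
    refine ⟨?_, fun e he => hI e (by omega)⟩
    simp at ht
    have e1 : (160 * (2 * k + 3) + 3 + 9) * (k + 1) = 160 * ((k + 1) * (2 * k + 3)) + 12 * (k + 1) := by
      ring
    have : (k + 1) * 3 ≤ (k + 1) * (2 * k + 3) := Nat.mul_le_mul le_rfl (by omega)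
    rw [e1] at ht
    omega

/-- Appends to the output the interval of starting positions whose cell on diagonal `rDl` lies above
the furthest cell and in a row that leaves at most `rC` letters. -/
def pushDiagonal : Program :=
  rXx ≔ ld aZ (rg rRow + rg rDl) ;;
  ifThen ((rg 2 + 1 <! rg rXx) * (rg rDl <! rg rLy + (rg 2 + 2)))
    (rXx ≔ rg rXx - (rg 2 + 2) ;;
      capReg rXx (rg rLx) ;;
      capReg rXx (rg rLy + (rg 2 + 1) - rg rDl) ;;
      rYy ≔ rg rLy - rg rC + (rg 2 + 1) - rg rDl ;;
      ifThen (rg rYy <! rg rXx + 1)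
        (.store 2 (rg 0) (rg rLx - rg rXx) ;;
          .store 3 (rg 0) (rg rLx - rg rYy) ;;
          0 ≔ rg 0 + 1))

/-- Appends the intervals of starting positions for all diagonals and all numbers of edits on the
left-hand side of the split position. -/
def pushIntervals : Program :=
  0 ≔ 0 ;;
  forLoop rE 0 (rg 2 + 1)
    (rC ≔ ld aLe (rg 2 - rg rE) ;;
      rRow ≔ rg rE * (2 * rg 2 + 3) ;;
      forLoop rDl 0 (2 * rg 2 + 3) pushDiagonal)

/-- `i` lies in one of the intervals reported so far. -/
def Covered (s : State) (i : ℕ) : Prop := ∃ q < s.reg 0, s.mem 2 q ≤ i ∧ i ≤ s.mem 3 q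

theorem pushDiagonal_spec {R δ L z : ℕ} (hB : Bdd B s) (hk : s.reg 2 = k) (hlx : s.reg rLx = lx)
    (hly : s.reg rLy = ly) (hR : s.reg rRow = R) (hδ : s.reg rDl = δ) (hL : s.reg rC = L)
    (hz : s.mem aZ (R + δ) = z) (hxB : ly + k + 1 < B) (hq : s.reg 0 + 1 < B) :
    wp B pushDiagonal s fun s' t => t ≤ 200 ∧ s'.reg 0 ≤ s.reg 0 + 1 ∧
      ∀ i, Covered s' i ↔ Covered s i ∨ (i ≤ lx ∧ lx - i + (k + 2) ≤ z ∧
        lx - i + δ ≤ ly + k + 1 ∧ ly - L + (k + 1) ≤ lx - i + δ) := by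
  have hlxB : lx < B := hlx ▸ hB.1 _
  have hzB : z < B := hz ▸ hB.2 _ _
  rw [pushDiagonal, wp_seq, wp_assign]
  have e1 : (ld aZ (rg rRow + rg rDl)).ev s = z := by simp [hR, hδ, hz]
  rw [e1]
  refine ⟨hzB, ?_⟩
  have hcov : ∀ i, Covered (s.setReg rXx z) i ↔ Covered s i := fun i => by simp [Covered]
  rw [wp_cond]
  have e2 : ((rg 2 + 1 <! rg rXx) * (rg rDl <! rg rLy + (rg 2 + 2))).ev (s.setReg rXx z) =
      if k + 2 ≤ z ∧ δ ≤ ly + k + 1 then 1 else 0 := by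
    simp only [ev_mul, ev_lt, ev_add, ev_reg, ev_ofNat, reg_setReg]
    simp only [hk, hδ, hly, if_true, Nat.reduceEqDiff, if_false]
    split_ifs <;> omega
  rw [e2]
  refine ⟨fun hc => ?_, fun hc => ?_⟩
  · have hc : k + 2 ≤ z ∧ δ ≤ ly + k + 1 := by by_contra hcon; simp [hcon] at hc
    rw [wp_seq, wp_assign]
    have e3 : (rg rXx - (rg 2 + 2)).ev (s.setReg rXx z) = z - (k + 2) := by simp [hk]
    rw [e3]
    refine ⟨by omega, ?_⟩
    have hB3 : Bdd B ((s.setReg rXx z).setReg rXx (z - (k + 2))) :=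
      (hB.setReg hzB).setReg (by omega)
    rw [wp_seq]
    refine (capReg_spec (v := lx) (w := z - (k + 2)) (by simp [hlx]) (by simp)
      (by omega)).call hB3 ?_
    rintro s3 t3 hF3 hB4 ⟨ht3, hx3⟩
    rw [wp_seq]
    refine (capReg_spec (v := ly + (k + 1) - δ) ?_ hx3 (by omega)).call hB4 ?_
    · simp [hF3.reg rLy (by decide), hF3.reg 2 (by decide), hF3.reg rDl (by decide), hly, hk, hδ]
    rintro s4 t4 hF4 hB5 ⟨ht4, hx4⟩
    obtain ⟨x, hx⟩ : ∃ x, x = min (min (z - (k + 2)) lx) (ly + (k + 1) - δ) := ⟨_, rfl⟩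
    obtain ⟨y, hy⟩ : ∃ y, y = ly - L + (k + 1) - δ := ⟨_, rfl⟩
    rw [← hx] at hx4
    rw [wp_seq, wp_assign]
    have r4 : ∀ x, x ≠ rXx → s4.reg x = s.reg x := fun x hx => by
      rw [hF4.reg _ (by simpa [capReg, Program.wr] using hx),
        hF3.reg _ (by simpa [capReg, Program.wr] using hx)]
      simp [hx]
    have m4 : s4.mem = s.mem := by
      funext a
      rw [hF4.mem _ (by simp [capReg, Program.wm]), hF3.mem _ (by simp [capReg, Program.wm])]
      simp
    have e4 : (rg rLy - rg rC + (rg 2 + 1) - rg rDl).ev s4 = y := by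
      simp [r4, hly, hL, hk, hδ, hy]
    rw [e4]
    refine ⟨by omega, ?_⟩
    simp [r4, m4, hx4, hlx, Covered]
    simp at ht3 ht4
    refine ⟨fun hyx => ⟨by omega, by omega, by omega, by omega, fun i => ?_⟩,
      fun hyx => ⟨by omega, fun i hi => by omega⟩⟩
    constructor
    · rintro ⟨q, hq, h1, h2⟩
      rcases hq.lt_or_eq with h3 | rfl
      · rw [Function.update_of_ne (by omega)] at h1 h2
        exact .inl ⟨q, h3, h1, h2⟩
      · rw [Function.update_self] at h1 h2
        right
        omega
    · rintro (⟨q, hq, h1, h2⟩ | h)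
      · refine ⟨q, by omega, ?_⟩
        rw [Function.update_of_ne (by omega), Function.update_of_ne (by omega)]
        exact ⟨h1, h2⟩
      · refine ⟨s.reg 0, le_rfl, ?_⟩
        rw [Function.update_self, Function.update_self]
        omega
  · have hc : ¬ (k + 2 ≤ z ∧ δ ≤ ly + k + 1) := by
      intro hcon; simp [hcon] at hc
    simp [hcov]
    omega

/-- The starting position `i` comes from a cell on diagonal `δ` with value at most `e` in a row that
leaves at most `L` letters. -/
def Hit (D : ℕ → ℕ → ℕ) (lx ly k e L δ i : ℕ) : Prop :=
  i ≤ lx ∧ ∃ z ≤ ly, z + k + 1 = lx - i + δ ∧ D (lx - i) z ≤ e ∧ ly - z ≤ L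

theorem pushIntervals_spec {D : ℕ → ℕ → ℕ} {mt : ℕ → ℕ → Prop} (hB : Bdd B s) (hk : s.reg 2 = k)
    (hlx : s.reg rLx = lx) (hly : s.reg rLy = ly) (hD : EditTable mt lx ly D)
    (hZ : ∀ e ≤ k, Furthest lx ly k D e fun δ => s.mem aZ (e * (2 * k + 3) + δ))
    (hxB : ly + k + 2 < B) (hkB : (k + 2) * (2 * k + 3) < B) :
    wp B pushIntervals s fun s' t => t ≤ 400 * ((k + 1) * (2 * k + 3)) ∧
      s'.reg 0 ≤ (k + 1) * (2 * k + 3) ∧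
      ∀ i, Covered s' i ↔ i ≤ lx ∧ ∃ e ≤ k, ∃ z ≤ ly, D (lx - i) z ≤ e ∧
        ly - z ≤ s.mem aLe (k - e) := by
  have hW : ∀ e ≤ k, (e + 1) * (2 * k + 3) ≤ (k + 1) * (2 * k + 3) := fun e he =>
    Nat.mul_le_mul (by omega) le_rfl
  have hkB' : (k + 2) * (2 * k + 3) = (k + 1) * (2 * k + 3) + (2 * k + 3) := by ring
  rw [pushIntervals, wp_seq, wp_assign]
  refine ⟨by simp; omega, ?_⟩
  have hB0 : Bdd B (s.setReg 0 ((0 : Expr).ev s)) := hB.setReg (by simp; omega)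
  refine wp_for 0 (k + 1) (250 * (2 * k + 3)) (fun q s' => s'.reg 0 ≤ q * (2 * k + 3) ∧
    ∀ i, Covered s' i ↔ ∃ e < q, ∃ δ < 2 * k + 3, Hit D lx ly k e (s.mem aLe (k - e)) δ i) hB0
    (by decide) (by omega) (by simp) (by omega) ?_ ?_ ?_ ?_
  · intro s' hF
    simp [hF.reg 2 (by decide), hk]
  · simp [Covered]
  · rintro e s' _ he hi hF hB' ⟨hn, hI⟩
    have a1 : s'.reg 2 = k := by rw [hF.reg _ (by decide)]; simp [hk]
    have a2 : s'.reg rLx = lx := by rw [hF.reg _ (by decide)]; simp [hlx]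
    have a3 : s'.reg rLy = ly := by rw [hF.reg _ (by decide)]; simp [hly]
    have a4 : s'.mem aZ = s.mem aZ := by rw [hF.mem _ (by decide)]; simp
    have a5 : s'.mem aLe = s.mem aLe := by rw [hF.mem _ (by decide)]; simp
    have hWe := hW e (by omega)
    obtain ⟨R, hR⟩ : ∃ R, R = e * (2 * k + 3) := ⟨_, rfl⟩
    have hRR : (e + 1) * (2 * k + 3) = R + (2 * k + 3) := by rw [hR]; ring
    have hZe := hZ e (by omega)
    rw [← hR] at hZe hn
    set L := s.mem aLe (k - e) with hL
    rw [wp_seq, wp_assign]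
    have e1 : (ld aLe (rg 2 - rg rE)).ev s' = L := by simp [a1, a5, hi, hL]
    rw [e1]
    refine ⟨hB.2 _ _, ?_⟩
    rw [wp_seq, wp_assign]
    have e2 : (rg rE * (2 * rg 2 + 3)).ev (s'.setReg rC L) = R := by simp [hi, a1, hR]
    rw [e2]
    refine ⟨by omega, ?_⟩
    have hB1 : Bdd B ((s'.setReg rC L).setReg rRow R) := (hB'.setReg (hB.2 _ _)).setReg (by omega)
    refine wp_for 0 (2 * k + 3) 200 (fun q s'' => s''.reg 0 ≤ R + q ∧
      ∀ i, Covered s'' i ↔ Covered s' i ∨ ∃ δ < q, Hit D lx ly k e L δ i) hB1 (by decide) (by omega)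
      (by simp) (by omega) ?_ ?_ ?_ ?_
    · intro s'' hF'
      simp [hF'.reg 2 (by decide), a1]
    · simpa [Covered] using hn
    · rintro δ s2 _ hδ hi2 hF2 hB2 ⟨hn2, hI2⟩
      have hcell := hZe.cell δ (by omega)
      refine (pushDiagonal_spec (k := k) (lx := lx) (ly := ly) (R := R) (δ := δ) (L := L)
        (z := s.mem aZ (R + δ)) hB2 (by rw [hF2.reg _ (by decide)]; simp [a1])
        (by rw [hF2.reg _ (by decide)]; simp [a2]) (by rw [hF2.reg _ (by decide)]; simp [a3])
        (by rw [hF2.reg _ (by decide)]; simp) hi2 (by rw [hF2.reg _ (by decide)]; simp)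
        (by rw [hF2.mem _ (by decide)]; simp [a4]) (by omega) (by omega)).mono ?_
      rintro s3 t3 ⟨ht3, hn3, hI3⟩
      refine ⟨ht3, by simp; omega, fun i => ?_⟩
      have : Covered (s3.setReg rDl (δ + 1)) i ↔ Covered s3 i := by simp [Covered]
      rw [this, hI3, hI2, or_assoc]
      refine or_congr_right ?_
      have hhit : (i ≤ lx ∧ lx - i + (k + 2) ≤ s.mem aZ (R + δ) ∧ lx - i + δ ≤ ly + k + 1 ∧
          ly - L + (k + 1) ≤ lx - i + δ) ↔ Hit D lx ly k e L δ i := by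
        constructor
        · rintro ⟨h1, h2, h3, h4⟩
          refine ⟨h1, lx - i + δ - (k + 1), by omega, by omega, ?_, by omega⟩
          exact (hcell _ (by omega) _ (by omega) (by omega)).2 h2
        · rintro ⟨h1, z, h2, h3, h4, h5⟩
          exact ⟨h1, (hcell _ (by omega) _ h2 h3).1 h4, by omega, by omega⟩
      rw [hhit]
      constructor
      · rintro (⟨δ', h1, h2⟩ | h2)
        · exact ⟨δ', by omega, h2⟩
        · exact ⟨δ, by omega, h2⟩
      · rintro ⟨δ', h1, h2⟩
        rcases (Nat.lt_succ_iff.1 h1).lt_or_eq with h3 | rfl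
        · exact .inl ⟨δ', h3, h2⟩
        · exact .inr h2
    · rintro s2 t2 ht2 _ hF2 hB2 ⟨hn2, hI2⟩
      simp at ht2
      refine ⟨by simp; omega, by simp; omega, fun i => ?_⟩
      have : Covered (s2.setReg rE (e + 1)) i ↔ Covered s2 i := by simp [Covered]
      rw [this, hI2, hI]
      constructor
      · rintro (⟨e', h1, h2⟩ | h2)
        · exact ⟨e', by omega, h2⟩
        · exact ⟨e, by omega, h2⟩
      · rintro ⟨e', h1, h2⟩
        rcases (Nat.lt_succ_iff.1 h1).lt_or_eq with h3 | rfl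
        · exact .inl ⟨e', h3, h2⟩
        · exact .inr h2
  · rintro s' t ht _ hF hB' ⟨hn, hI⟩
    refine ⟨?_, hn, fun i => ?_⟩
    · simp at ht
      have e1 : (250 * (2 * k + 3) + 3 + 9) * (k + 1) =
        250 * ((k + 1) * (2 * k + 3)) + 12 * (k + 1) := by ring
      have : (k + 1) * 3 ≤ (k + 1) * (2 * k + 3) := Nat.mul_le_mul le_rfl (by omega)
      rw [e1] at ht
      simp
      omega
    · rw [hI]
      constructor
      · rintro ⟨e, he, δ, hδ, h1, z, h2, h3, h4, h5⟩
        exact ⟨h1, e, by omega, z, h2, h4, h5⟩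
      · rintro ⟨h1, e, he, z, h2, h4, h5⟩
        have := hD.diff_le (x := lx - i) (by omega) h2
        exact ⟨e, by omega, z + k + 1 - (lx - i), by omega, h1, z, h2, by omega, h4, h5⟩

end

/-- The string on which longest common prefixes are queried. Common prefixes of its suffixes may run
past the four parts, and are then cut off. -/
def workString (T P : List ℕ) : List ℕ := T ++ P ++ T.reverse ++ P.reverse

/-- The result of the preprocessing. The queries refer to a string `S` that has the same equalities
between letters as the work string. -/
structure Prepared (T P : List ℕ) (s : State) : Prop where
  regn : s.reg rLt = T.length
  regm : s.reg rLp = P.length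
  lce : ∃ S, LceReady (2 * (T.length + P.length)) S s ∧
    ∀ p < 2 * (T.length + P.length), ∀ q < 2 * (T.length + P.length),
      S p = S q ↔ (workString T P).getD p 0 = (workString T P).getD q 0

theorem Prepared.frame {T P : List ℕ} {s s' : State} {p : Program} (h : Prepared T P s)
    (hF : Frame p s s') (hr : ∀ x ∈ [rLt, rLp, rBs, rNb], x ∉ p.wr)
    (hm : ∀ a ∈ [aG, aLg, aPw, aMk, aSp, aRnk], a ∉ p.wm) : Prepared T P s' where
  regn := (hF.reg _ (hr _ (by simp))).trans h.regn
  regm := (hF.reg _ (hr _ (by simp))).trans h.regm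
  lce := by
    obtain ⟨S, h1, h2⟩ := h.lce
    exact ⟨S, h1.frame hF (fun x hx => hr x (by simp at hx ⊢; omega)) hm, h2⟩

section
variable {T P : List ℕ} {x : ℕ}

theorem getD_workString_text (h : x < T.length) : (workString T P).getD x 0 = T.getD x 0 := by
  rw [workString, List.append_assoc, List.append_assoc, List.getD_append _ _ _ _ h]

theorem getD_workString_pattern (h : x < P.length) :
    (workString T P).getD (T.length + x) 0 = P.getD x 0 := by
  rw [workString, List.append_assoc, List.append_assoc,
    List.getD_append_right _ _ _ _ (by omega), Nat.add_sub_cancel_left,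
    List.getD_append _ _ _ _ h]

theorem getD_workString_text_reverse (h : x < T.length) :
    (workString T P).getD (T.length + P.length + x) 0 = T.reverse.getD x 0 := by
  rw [workString, List.append_assoc,
    List.getD_append_right _ _ _ _ (by simp), List.length_append, Nat.add_sub_cancel_left,
    List.getD_append _ _ _ _ (by simpa)]

theorem getD_workString_pattern_reverse :
    (workString T P).getD (T.length + P.length + T.length + x) 0 = P.reverse.getD x 0 := by
  rw [workString, List.getD_append_right _ _ _ _ (by simp; omega), List.length_append,
    List.length_append, List.length_reverse, Nat.add_sub_cancel_left]

end

/-- Reports the starting positions for the split position `j` in register `3`: compares `T[j .. n)`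
with the pattern, then the reversal of `T[0 .. j)` with the reversed pattern. -/
def reportSplit : Program :=
  rLx ≔ rg rLt - rg 3 ;;
  rLy ≔ rg rLp ;;
  rUo ≔ rg 3 ;;
  rVo ≔ rg rLt ;;
  furthest ;;
  prefixLengths ;;
  rLx ≔ rg 3 ;;
  rUo ≔ rg rLt + rg rLp + (rg rLt - rg 3) ;;
  rVo ≔ rg rLt + rg rLp + rg rLt ;;
  furthest ;;
  pushIntervals

theorem reportSplit_spec {B k j : ℕ} {T P : List ℕ} {s : State} (hB : Bdd B s)
    (h : Prepared T P s) (hk : s.reg 2 = k) (hj : s.reg 3 = j) (hjT : j ≤ T.length)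
    (hxB : 4 * (T.length + P.length) + 4 * k + 10 < B) (hkB : (k + 2) * (2 * k + 3) < B) :
    wp B reportSplit s fun s' t => t ≤ 5000 * ((k + 1) * (2 * k + 3)) ∧
      s'.reg 0 ≤ (k + 1) * (2 * k + 3) ∧ ∀ i, Covered s' i ↔ i ∈ anchoredOcc k P T j := by
  obtain ⟨S, hlce, hS⟩ := h.lce
  have hn := h.regn
  have hm := h.regm
  have hD1 : EditTable (fun x y => S (j + x) = S (T.length + y)) (T.length - j) P.length fun x y =>
      editDist ((T.drop j).take x) (P.take y) := by
    have := editTable_take (U := T.drop j) (V := P)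
      (mt := fun x y => S (j + x) = S (T.length + y)) ?_
    · rwa [List.length_drop] at this
    · intro x hx y hy
      rw [List.length_drop] at hx
      rw [hS _ (by omega) _ (by omega), getD_workString_text (by omega),
        getD_workString_pattern hy]
      simp [List.getD_eq_getElem?_getD]
  have hD2 : EditTable (fun x y => S (T.length + P.length + (T.length - j) + x) =
      S (T.length + P.length + T.length + y)) j P.length fun x y =>
      editDist ((T.take j).reverse.take x) (P.reverse.take y) := by
    have := editTable_take (U := (T.take j).reverse) (V := P.reverse)
      (mt := fun x y => S (T.length + P.length + (T.length - j) + x) =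
        S (T.length + P.length + T.length + y)) ?_
    · rwa [List.length_reverse, List.length_take, List.length_reverse,
        Nat.min_eq_left hjT] at this
    · intro x hx y hy
      rw [List.length_reverse, List.length_take] at hx
      rw [List.length_reverse] at hy
      rw [hS _ (by omega) _ (by omega), add_assoc (T.length + P.length),
        getD_workString_text_reverse (by omega), getD_workString_pattern_reverse,
        List.reverse_take]
      simp [List.getD_eq_getElem?_getD]
  rw [reportSplit, wp_seq, wp_assign, wp_seq, wp_assign, wp_seq, wp_assign, wp_seq, wp_assign]
  simp [hn, hm, hj]
  refine ⟨by omega, by omega, by omega, by omega, ?_⟩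
  set s1 := (((s.setReg rLx (T.length - j)).setReg rLy P.length).setReg rUo j).setReg rVo T.length
    with hs1
  have hB1 : Bdd B s1 := (((hB.setReg (by omega)).setReg (by omega)).setReg (by omega)).setReg
    (by omega)
  have h1 : Comparison (2 * (T.length + P.length)) k (T.length - j) P.length j T.length S s1 := by
    refine ⟨hlce.congr ?_ ?_ ?_ ?_ ?_ ?_ ?_ ?_, ?_, ?_, ?_, ?_, ?_, fun x hx y hy => by omega⟩
    all_goals simp [hs1, hk]
  have q1 : s1.reg 3 = j := by simp [hs1, hj]
  have q2 : s1.reg rLt = T.length := by simp [hs1, hn]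
  have q3 : s1.reg rLp = P.length := by simp [hs1, hm]
  clear_value s1
  refine (furthest_spec hB1 h1 hD1 (by omega) (by omega) (by omega) hkB).call hB1 ?_
  rintro s2 t2 hF2 hB2 ⟨ht2, hZ2⟩
  refine (prefixLengths_spec hB2 (h1.frame hF2 (by decide) (by decide)).regk
    (h1.frame hF2 (by decide) (by decide)).reglx hD1 hZ2 (by omega) hkB).call hB2 ?_
  rintro s3 t3 hF3 hB3 ⟨ht3, hL3⟩
  have h3 := (h1.frame hF2 (by decide) (by decide)).frame hF3 (by decide) (by decide)
  have q4 : s3.reg 3 = j := by rw [hF3.reg _ (by decide), hF2.reg _ (by decide), q1]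
  have q5 : s3.reg rLt = T.length := by rw [hF3.reg _ (by decide), hF2.reg _ (by decide), q2]
  have q6 : s3.reg rLp = P.length := by rw [hF3.reg _ (by decide), hF2.reg _ (by decide), q3]
  simp [q4, q5, q6]
  refine ⟨by omega, by omega, by omega, ?_⟩
  set s4 := ((s3.setReg rLx j).setReg rUo (T.length + P.length + (T.length - j))).setReg rVo
    (T.length + P.length + T.length) with hs4
  have hB4 : Bdd B s4 := ((hB3.setReg (by omega)).setReg (by omega)).setReg (by omega)
  have h4 : Comparison (2 * (T.length + P.length)) k j P.length
      (T.length + P.length + (T.length - j)) (T.length + P.length + T.length) S s4 := by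
    refine ⟨h3.lce.congr ?_ ?_ ?_ ?_ ?_ ?_ ?_ ?_, ?_, ?_, ?_, ?_, ?_, fun x hx y hy => by omega⟩
    all_goals simp [hs4, h3.regk, h3.regly]
  have q7 : s4.mem aLe = s3.mem aLe := by simp [hs4]
  clear_value s4
  refine (furthest_spec hB4 h4 hD2 (by omega) (by omega) (by omega) hkB).call hB4 ?_
  rintro s5 t5 hF5 hB5 ⟨ht5, hZ5⟩
  have h5 := h4.frame hF5 (by decide) (by decide)
  refine (pushIntervals_spec hB5 h5.regk h5.reglx h5.regly hD2 hZ5 (by omega) hkB).mono ?_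
  rintro s6 t6 ⟨ht6, hn6, hI6⟩
  refine ⟨?_, hn6, fun i => ?_⟩
  · have : 1 ≤ (k + 1) * (2 * k + 3) := Nat.mul_pos (by omega) (by omega)
    omega
  · rw [hI6, mem_anchoredOcc_iff hjT, hF5.mem _ (by decide), q7]
    refine and_congr_right fun _ => exists_congr fun e => and_congr_right fun he =>
      exists_congr fun z => and_congr_right fun hz => and_congr_right fun _ => ?_
    exact (hL3 (k - e) (by omega) (P.length - z) (by omega)).symm

open CircularMatching

/-! ### Preprocessing -/

/-- Stores the letters of the work string, increased by one, in `aKey`. -/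
def buildKeys : Program :=
  forLoop rI 0 (rg rLt)
    (.store aKey (rg rI) (ld 0 (rg rI) + 1) ;;
      .store aKey (rg rLt + rg rLp + rg rI) (ld 0 (rg rLt - 1 - rg rI) + 1)) ;;
  forLoop rI 0 (rg rLp)
    (.store aKey (rg rLt + rg rI) (ld 1 (rg rI) + 1) ;;
      .store aKey (rg rLt + rg rLp + rg rLt + rg rI) (ld 1 (rg rLp - 1 - rg rI) + 1))

/-- Prepares the queries for longest common prefixes on the work string. -/
def preprocess : Program :=
  rLt ≔ rg 0 ;;
  rLp ≔ rg 1 ;;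
  rN ≔ 2 * (rg rLt + rg rLp) ;;
  buildKeys ;;
  suffixSort ;;
  kasai ;;
  logTables ;;
  stackMasks ;;
  sparseTable

section
variable {T P : List ℕ} {x : ℕ}

theorem getD_reverse {L : List ℕ} (h : x < L.length) :
    L.reverse.getD x 0 = L.getD (L.length - 1 - x) 0 := by
  rw [List.getD_eq_getElem _ _ (by simpa), List.getD_eq_getElem _ _ (by omega),
    List.getElem_reverse]

theorem buildKeys_spec {B : ℕ} {s : State} (hB : Bdd B s) (hn : s.reg rLt = T.length)
    (hm : s.reg rLp = P.length) (hT : ∀ i, s.mem 0 i = T.getD i 0)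
    (hP : ∀ i, s.mem 1 i = P.getD i 0) (hTB : ∀ x ∈ T ++ P, x + 1 < B) (hNB : 1 < B) :
    wp B buildKeys s fun s' t => t ≤ 60 * (T.length + P.length) + 60 ∧
      ∀ p < 2 * (T.length + P.length), s'.mem aKey p = (workString T P).getD p 0 + 1 := by
  have hTB' : ∀ i, T.getD i 0 + 1 < B := fun i => by
    rcases Nat.lt_or_ge i T.length with h | h
    · rw [List.getD_eq_getElem _ _ h]
      exact hTB _ (by simp)
    · rw [List.getD_eq_default _ _ h]; omega
  have hPB' : ∀ i, P.getD i 0 + 1 < B := fun i => by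
    rcases Nat.lt_or_ge i P.length with h | h
    · rw [List.getD_eq_getElem _ _ h]
      exact hTB _ (by simp)
    · rw [List.getD_eq_default _ _ h]; omega
  have hnB : T.length < B := hn ▸ hB.1 _
  have hmB : P.length < B := hm ▸ hB.1 _
  rw [buildKeys, wp_seq]
  refine wp_for 0 T.length 40 (fun q s' => ∀ i < q,
    s'.mem aKey i = (workString T P).getD i 0 + 1 ∧ s'.mem aKey (T.length + P.length + i) =
      (workString T P).getD (T.length + P.length + i) 0 + 1) hB (by decide) hnB
      (by simp) (by omega) ?_ ?_ ?_ ?_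
  · intro s' hF
    simp [hF.reg rLt (by decide), hn]
  · intro i hi; omega
  · intro q s' _ hq hi hF hB' hI
    have e1 : s'.reg rLt = T.length := by rw [hF.reg _ (by decide), hn]
    have e2 : s'.reg rLp = P.length := by rw [hF.reg _ (by decide), hm]
    have e3 : s'.mem 0 = s.mem 0 := hF.mem _ (by decide)
    simp only [wp_seq, wp_store, ev_add, ev_sub, ev_reg, ev_load, ev_ofNat, reg_setMem, mem_setMem,
      mem_setReg, hi, e1, e2, e3, hT, if_true, show (0 = aKey) = False by simp, if_false]
    refine ⟨hTB' _, hTB' _, by simp, fun i hi => ?_⟩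
    rw [← getD_reverse hq, ← getD_workString_text_reverse hq, ← getD_workString_text (P := P) hq]
    by_cases hiq : i = q
    · subst hiq
      rw [Function.update_self, Function.update_of_ne (by omega), Function.update_self]
      exact ⟨rfl, rfl⟩
    · rw [Function.update_of_ne (by omega), Function.update_of_ne (by omega),
        Function.update_of_ne (by omega), Function.update_of_ne (by omega)]
      exact hI i (by omega)
  · intro s1 t1 ht1 _ hF1 hB1 hI1
    refine wp_for 0 P.length 40 (fun q s' => (∀ i < T.length,
      s'.mem aKey i = (workString T P).getD i 0 + 1 ∧ s'.mem aKey (T.length + P.length + i) =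
        (workString T P).getD (T.length + P.length + i) 0 + 1) ∧ ∀ i < q,
      s'.mem aKey (T.length + i) = (workString T P).getD (T.length + i) 0 + 1 ∧
        s'.mem aKey (T.length + P.length + T.length + i) =
          (workString T P).getD (T.length + P.length + T.length + i) 0 + 1) hB1 (by decide) hmB
      (by simp) (by omega) ?_ ?_ ?_ ?_
    · intro s' hF
      simp [hF.reg rLp (by decide), hF1.reg rLp (by decide), hm]
    · exact ⟨hI1, fun i hi => by omega⟩
    · rintro q s' _ hq hi hF hB' ⟨hI, hI'⟩
      have e1 : s'.reg rLt = T.length := by rw [hF.reg _ (by decide), hF1.reg _ (by decide), hn]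
      have e2 : s'.reg rLp = P.length := by rw [hF.reg _ (by decide), hF1.reg _ (by decide), hm]
      have e3 : s'.mem 1 = s.mem 1 := by rw [hF.mem _ (by decide), hF1.mem _ (by decide)]
      simp only [wp_seq, wp_store, ev_add, ev_sub, ev_reg, ev_load, ev_ofNat, reg_setMem, mem_setMem,
        mem_setReg, hi, e1, e2, e3, hP, if_true, show (1 = aKey) = False by simp,
        if_false]
      refine ⟨hPB' _, hPB' _, by simp, fun i hi => ?_, fun i hi => ?_⟩
      · rw [Function.update_of_ne (by omega), Function.update_of_ne (by omega),
          Function.update_of_ne (by omega), Function.update_of_ne (by omega)]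
        exact hI i hi
      rw [← getD_reverse hq, ← getD_workString_pattern_reverse (T := T),
        ← getD_workString_pattern (T := T) hq]
      by_cases hiq : i = q
      · subst hiq
        rw [Function.update_self, Function.update_of_ne (by omega), Function.update_self]
        exact ⟨rfl, rfl⟩
      · rw [Function.update_of_ne (by omega), Function.update_of_ne (by omega),
          Function.update_of_ne (by omega), Function.update_of_ne (by omega)]
        exact hI' i (by omega)
    · rintro s2 t2 ht2 _ hF2 hB2 ⟨hI, hI'⟩
      simp at ht1 ht2
      refine ⟨by omega, fun p hp => ?_⟩
      rcases Nat.lt_or_ge p T.length with h1 | h1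
      · exact (hI p h1).1
      rcases Nat.lt_or_ge p (T.length + P.length) with h2 | h2
      · have := (hI' (p - T.length) (by omega)).1
        rwa [Nat.add_sub_cancel' h1] at this
      rcases Nat.lt_or_ge p (T.length + P.length + T.length) with h3 | h3
      · have := (hI (p - (T.length + P.length)) (by omega)).2
        rwa [Nat.add_sub_cancel' h2] at this
      · have := (hI' (p - (T.length + P.length + T.length)) (by omega)).2
        rwa [Nat.add_sub_cancel' h3] at this

theorem getD_workString_lt {c : ℕ} (hTP : ∀ x ∈ T ++ P, x < c)
    (h : x < 2 * (T.length + P.length)) : (workString T P).getD x 0 < c := by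
  have hlen : x < (workString T P).length := by simp [workString]; omega
  rw [List.getD_eq_getElem _ _ hlen]
  have := List.getElem_mem hlen
  simp only [workString, List.mem_append, List.mem_reverse] at this
  exact hTP _ (by simp; tauto)

theorem preprocess_spec {B c : ℕ} {s : State} (hB : Bdd B s) (hn : s.reg 0 = T.length)
    (hm : s.reg 1 = P.length) (hT : ∀ i, s.mem 0 i = T.getD i 0)
    (hP : ∀ i, s.mem 1 i = P.getD i 0) (hll : ∀ i, s.mem aLl i = 0) (hrnk : ∀ i, s.mem aRnk i = 0)
    (hT0 : 0 < T.length) (hPT : P.length ≤ T.length)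
    (hTP : ∀ x ∈ T ++ P, x < (T.length + 1) ^ c) (hcB : (T.length + 1) ^ (c + 20) ≤ B) :
    wp B preprocess s fun s' t => t ≤ 500000 * (c + 2) * T.length ∧ Prepared T P s' := by
  obtain ⟨M, hM⟩ : ∃ M, M = T.length + 1 := ⟨_, rfl⟩
  obtain ⟨N, hN⟩ : ∃ N, N = 2 * (T.length + P.length) := ⟨_, rfl⟩
  rw [← hM] at hTP hcB
  have hMc : 1 ≤ M ^ c := Nat.one_le_pow _ _ (by omega)
  -- the bound on words exceeds everything that is needed
  have hB0 : 32768 * M ^ (c + 5) ≤ B := by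
    calc 32768 * M ^ (c + 5) = 2 ^ 15 * M ^ (c + 5) := by norm_num
      _ ≤ M ^ 15 * M ^ (c + 5) := Nat.mul_le_mul (Nat.pow_le_pow_left (by omega) _) le_rfl
      _ = M ^ (c + 20) := by rw [← pow_add]; congr 1; omega
      _ ≤ B := hcB
  have hpow : ∀ i ≤ 5, M ^ i ≤ M ^ (c + 5) := fun i hi => Nat.pow_le_pow_right (by omega) (by omega)
  have hB1 : (M ^ c + 1) * (N + 2) < B := by
    have h1 : (M ^ c + 1) * (N + 2) ≤ (2 * M ^ c) * (4 * M) := Nat.mul_le_mul (by omega) (by omega)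
    have h2 : (2 * M ^ c) * (4 * M) = 8 * M ^ (c + 1) := by ring
    have h3 : M ^ (c + 1) ≤ M ^ (c + 5) := Nat.pow_le_pow_right (by omega) (by omega)
    have h4 := hpow 0 (by omega)
    rw [pow_zero] at h4
    omega
  have hB2 : 100 * (N + 2) ^ 4 < B := by
    have h1 : (N + 2) ^ 4 ≤ (4 * M) ^ 4 := Nat.pow_le_pow_left (by omega) _
    have h2 : (4 * M) ^ 4 = 256 * M ^ 4 := by ring
    have h3 := hpow 4 (by omega)
    have h4 := hpow 0 (by omega)
    rw [pow_zero] at h4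
    omega
  have hB3 : 100 * (N + 2) < B := by
    have : (N + 2) ^ 1 ≤ (N + 2) ^ 4 := Nat.pow_le_pow_right (by omega) (by omega)
    rw [pow_one] at this
    omega
  have hB4 : M ^ c + 1 < B := by
    have : (M ^ c + 1) * 1 ≤ (M ^ c + 1) * (N + 2) := Nat.mul_le_mul le_rfl (by omega)
    omega
  have hX : M ^ c + 1 ≤ (N + 2) ^ (c + 1) := by
    have h1 : M ^ c ≤ (N + 2) ^ c := Nat.pow_le_pow_left (by omega) _
    have h2 : (N + 2) ^ c * 2 ≤ (N + 2) ^ c * (N + 2) := Nat.mul_le_mul le_rfl (by omega)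
    rw [pow_succ]
    omega
  rw [preprocess, wp_seq, wp_assign, wp_seq, wp_assign, wp_seq, wp_assign]
  simp [hn, hm]
  refine ⟨by omega, by omega, by omega, ?_⟩
  set s1 := ((s.setReg rLt T.length).setReg rLp P.length).setReg rN (2 * (T.length + P.length))
    with hs1
  have hBs1 : Bdd B s1 := ((hB.setReg (by omega)).setReg (by omega)).setReg (by omega)
  have p1 : s1.reg rLt = T.length := by simp [hs1]
  have p2 : s1.reg rLp = P.length := by simp [hs1]
  have p3 : s1.reg rN = N := by simp [hs1, hN]
  have p4 : s1.mem = s.mem := by simp [hs1]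
  clear_value s1
  refine (buildKeys_spec hBs1 p1 p2 (by rw [p4]; exact hT) (by rw [p4]; exact hP)
    (fun x hx => by have := hTP x hx; omega) (by omega)).call hBs1 ?_
  rintro s2 t2 hF2 hBs2 ⟨ht2, hK2⟩
  rw [← hN] at hK2
  refine (suffixSort_spec (N := N) (X₀ := M ^ c + 1) (c := c + 1) (K := s2.mem aKey) hBs2
    (by rw [hF2.reg _ (by decide), p3]) (by omega) rfl
    (by rw [hF2.mem _ (by decide), p4]; exact hll) (by rw [hF2.mem _ (by decide), p4]; exact hrnk)
    (fun x hx => by rw [hK2 x hx]; omega)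
    (fun x hx => by rw [hK2 x hx]; have := getD_workString_lt hTP (hN ▸ hx); omega) (by omega) hX
    hB1 hB2).call hBs2 ?_
  rintro s3 t3 hF3 hBs3 ⟨ht3, S, hS, hSK, hll3, hf3, hrnk3⟩
  have q3 : s3.reg rN = N := by rw [hF3.reg _ (by decide), hF2.reg _ (by decide), p3]
  refine (kasai_spec hBs3 hS q3 hll3 rfl hf3 hrnk3 (by omega)).call hBs3 ?_
  rintro s4 t4 hF4 hBs4 ⟨ht4, hg4⟩
  have q4 : s4.reg rN = N := by rw [hF4.reg _ (by decide), q3]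
  refine (logTables_spec hBs4 q4 (by omega) (by omega)).call hBs4 ?_
  rintro s5 t5 hF5 hBs5 ⟨ht5, hbs5, hlg5, hpw5⟩
  have q5 : s5.reg rN = N := by rw [hF5.reg _ (by decide), q4]
  have hb0 : 0 < Nat.log 2 N := Nat.log_pos (by omega) (by omega)
  have hbN : 2 ^ Nat.log 2 N ≤ N := Nat.pow_log_le_self 2 (by omega)
  refine (stackMasks_spec hBs5 q5 hb0 hbs5 hpw5 rfl (by omega) (by omega)).call hBs5 ?_
  rintro s6 t6 hF6 hBs6 ⟨ht6, hmk6⟩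
  have q6 : s6.reg rN = N := by rw [hF6.reg _ (by decide), q5]
  have hbr : BlocksReady N (Nat.log 2 N) (s4.mem aG) s6 := by
    refine ⟨hb0, hbN, Nat.lt_pow_succ_log_self (by omega) N, ?_, ?_, ?_, ?_, ?_⟩
    · rw [hF6.reg _ (by decide), hbs5]
    · rw [hF6.mem _ (by decide), hF5.mem _ (by decide)]
    · rw [hF6.mem _ (by decide)]; exact hlg5
    · rw [hF6.mem _ (by decide)]; exact hpw5
    · rw [hF5.mem aG (by decide)] at hmk6; exact hmk6
  refine (sparseTable_spec hBs6 hbr q6 (by omega)).call hBs6 ?_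
  rintro s7 t7 hF7 hBs7 ⟨ht7, hr7⟩
  refine ⟨?_, ?_, ?_, S, ?_, ?_⟩
  · have h1 : 100000 * N * (c + 1 + 1) ≤ 100000 * (4 * T.length) * (c + 2) :=
      Nat.mul_le_mul (Nat.mul_le_mul le_rfl (by omega)) le_rfl
    have h2 : 100000 * (4 * T.length) * (c + 2) = 400000 * ((c + 2) * T.length) := by ring
    have h3 : 500000 * (c + 2) * T.length = 500000 * ((c + 2) * T.length) := by ring
    have h4 : 1 * T.length ≤ (c + 2) * T.length := Nat.mul_le_mul (by omega) le_rfl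
    omega
  · rw [hF7.reg _ (by decide), hF6.reg _ (by decide), hF5.reg _ (by decide),
      hF4.reg _ (by decide), hF3.reg _ (by decide), hF2.reg _ (by decide), p1]
  · rw [hF7.reg _ (by decide), hF6.reg _ (by decide), hF5.reg _ (by decide),
      hF4.reg _ (by decide), hF3.reg _ (by decide), hF2.reg _ (by decide), p2]
  · rw [← hN]
    refine ⟨_, _, _, _, hr7, hS, hf3, hg4, fun t ht => ?_⟩
    rw [hF7.mem _ (by decide), hF6.mem _ (by decide), hF5.mem _ (by decide),
      hF4.mem _ (by decide)]
    exact hrnk3 t ht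
  · rw [← hN]
    intro p hp q hq
    rw [hSK p hp q hq, hK2 p hp, hK2 q hq, Nat.add_right_cancel_iff]

end

/-! ### Collecting the positions for all split positions -/

notation "aMx" => (30 : ℕ)

/-- Raises the entry of `aMx` at the left end of each reported interval above its right end. -/
def markIntervals : Program :=
  forLoop rI 0 (rg 0)
    (ifThen (ld aMx (ld 2 (rg rI)) <! ld 3 (rg rI) + 1)
      (.store aMx (ld 2 (rg rI)) (ld 3 (rg rI) + 1)))

/-- Lists, without repetition, the positions up to `rLt` that lie in a marked interval. The sweep
keeps in `rC` the largest entry of `aMx` seen so far. -/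
def listMarked : Program :=
  0 ≔ 0 ;;
  rC ≔ 0 ;;
  forLoop rI 0 (rg rLt + 1)
    (maxC (ld aMx (rg rI)) ;;
      ifThen (rg rI <! rg rC) (.store 2 (rg 0) (rg rI) ;; 0 ≔ rg 0 + 1))

/-- Solves the reporting problem: the intervals of every split position are recorded right after they
have been computed, since the next position overwrites them. -/
def reportAll : Program :=
  preprocess ;;
  forLoop 3 0 (rg rLt + 1) (reportSplit ;; markIntervals) ;;
  listMarked

/-- `i` lies in a marked interval. -/
def Marked (s : State) (i : ℕ) : Prop := ∃ l ≤ i, i < s.mem aMx l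

theorem markIntervals_spec {B r : ℕ} {s : State} (hB : Bdd B s) (hr : s.reg 0 = r)
    (h3 : ∀ q < r, s.mem 3 q + 1 < B) :
    wp B markIntervals s fun s' t => t ≤ 50 * r + 50 ∧
      ∀ i, Marked s' i ↔ Marked s i ∨ Covered s i := by
  have hrB : r < B := hr ▸ hB.1 _
  refine wp_for 0 r 30 (fun q s' => ∀ i, Marked s' i ↔ Marked s i ∨
    ∃ q' < q, s.mem 2 q' ≤ i ∧ i ≤ s.mem 3 q') hB (by decide) hrB
    (by simp) (by omega) ?_ ?_ ?_ ?_
  · intro s' hF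
    simp [hF.reg 0 (by decide), hr]
  · simp [Marked]
  · intro q s' _ hq hi hF hB' hI
    have e1 : s'.mem 2 = s.mem 2 := hF.mem _ (by decide)
    have e2 : s'.mem 3 = s.mem 3 := hF.mem _ (by decide)
    have hsplit : ∀ i, (∃ q' < q + 1, s.mem 2 q' ≤ i ∧ i ≤ s.mem 3 q') ↔
        (∃ q' < q, s.mem 2 q' ≤ i ∧ i ≤ s.mem 3 q') ∨ (s.mem 2 q ≤ i ∧ i ≤ s.mem 3 q) := by
      intro i
      constructor
      · rintro ⟨q', h1, h2⟩
        rcases (Nat.lt_succ_iff.1 h1).lt_or_eq with h3 | rfl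
        · exact .inl ⟨q', h3, h2⟩
        · exact .inr h2
      · rintro (⟨q', h1, h2⟩ | h2)
        · exact ⟨q', by omega, h2⟩
        · exact ⟨q, by omega, h2⟩
    have h3q := h3 q hq
    simp only [Marked] at hI
    simp only [hsplit, ← or_assoc, ← hI, Marked]
    simp [hi, e1, e2]
    generalize s.mem 2 q = l at *
    generalize s.mem 3 q = u at *
    refine ⟨fun hlt => ⟨h3q, fun i => ?_⟩, fun hlt i => ?_⟩
    · constructor
      · rintro ⟨l', h1, h2⟩
        by_cases hll : l' = l
        · subst hll
          rw [Function.update_self] at h2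
          exact .inr ⟨h1, by omega⟩
        · rw [Function.update_of_ne hll] at h2
          exact .inl ⟨l', h1, h2⟩
      · rintro (⟨l', h1, h2⟩ | ⟨h1, h2⟩)
        · refine ⟨l', h1, ?_⟩
          by_cases hll : l' = l
          · subst hll
            rw [Function.update_self]
            omega
          · rwa [Function.update_of_ne hll]
        · refine ⟨l, h1, ?_⟩
          rw [Function.update_self]
          omega
    · exact fun h1 h2 => ⟨l, h1, by omega⟩
  · intro s' t ht _ hF hB' hI
    simp at ht
    refine ⟨by omega, fun i => ?_⟩
    rw [hI, Covered, hr]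

theorem listMarked_spec {B n : ℕ} {s : State} (hB : Bdd B s) (hn : s.reg rLt = n)
    (hnB : n + 2 < B) :
    wp B listMarked s fun s' t => t ≤ 100 * n + 200 ∧
      Reports s' {i | i ≤ n ∧ Marked s i} := by
  classical
  rw [listMarked, wp_seq, wp_assign, wp_seq, wp_assign]
  simp only [ev_ofNat]
  refine ⟨by omega, by omega, ?_⟩
  refine wp_for 0 (n + 1) 50 (fun q s' => s'.reg 0 ≤ q ∧
    (∀ l < q, s.mem aMx l ≤ s'.reg rC) ∧ (s'.reg rC = 0 ∨ ∃ l < q, s'.reg rC = s.mem aMx l) ∧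
    (List.range (s'.reg 0)).map (s'.mem 2) = (List.range q).filter fun i => Marked s i)
    ((hB.setReg (by omega)).setReg (by omega)) (by decide) (by omega) (by simp) (by omega) ?_ ?_ ?_ ?_
  · intro s' hF
    simp [hF.reg rLt (by decide), hn]
  · simp
  · rintro q s' _ hq hi hF hB' ⟨h1, h2, h3, h4⟩
    have e1 : s'.mem aMx = s.mem aMx := by rw [hF.mem _ (by decide)]; simp
    have hv := hB.2 aMx q
    have key : ∀ c, c = max (s'.reg rC) (s.mem aMx q) →
        (∀ l < q + 1, s.mem aMx l ≤ c) ∧ (c = 0 ∨ ∃ l < q + 1, c = s.mem aMx l) ∧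
          (Marked s q ↔ q < c) := by
      rintro c rfl
      have k1 : ∀ l < q + 1, s.mem aMx l ≤ max (s'.reg rC) (s.mem aMx q) := fun l hl => by
        rcases (Nat.lt_succ_iff.1 hl).lt_or_eq with h5 | rfl
        · exact (h2 l h5).trans (le_max_left _ _)
        · exact le_max_right _ _
      have k2 : max (s'.reg rC) (s.mem aMx q) = 0 ∨
          ∃ l < q + 1, max (s'.reg rC) (s.mem aMx q) = s.mem aMx l := by
        rcases le_total (s'.reg rC) (s.mem aMx q) with h5 | h5
        · rw [max_eq_right h5]
          exact .inr ⟨q, by omega, rfl⟩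
        · rw [max_eq_left h5]
          exact h3.imp_right fun ⟨l, h6, h7⟩ => ⟨l, by omega, h7⟩
      refine ⟨k1, k2, ?_⟩
      constructor
      · rintro ⟨l, h5, h6⟩
        exact h6.trans_le (k1 l (by omega))
      · intro h5
        rcases k2 with h6 | ⟨l, h6, h7⟩
        · omega
        · exact ⟨l, by omega, by omega⟩
    have hmap : (List.range (s'.reg 0)).map (Function.update (s'.mem 2) (s'.reg 0) q) =
        (List.range (s'.reg 0)).map (s'.mem 2) := by
      refine List.map_congr_left fun i hi => ?_
      rw [Function.update_of_ne (List.mem_range.1 hi).ne]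
    have hyes : Marked s q → (List.range (s'.reg 0 + 1)).map
        (Function.update (s'.mem 2) (s'.reg 0) q) =
        (List.range (q + 1)).filter fun i => Marked s i := fun h => by
      rw [List.range_succ, List.range_succ, List.map_append, List.filter_append, hmap, h4]
      simp [h]
    have hno : ¬ Marked s q → (List.range (s'.reg 0)).map (s'.mem 2) =
        (List.range (q + 1)).filter fun i => Marked s i := fun h => by
      rw [List.range_succ, List.filter_append, h4]
      simp [h]
    rw [wp_seq]
    refine (maxC_spec (v := s.mem aMx q) (by simp [hi, e1]) rfl hv).call hB' ?_
    rintro s2 t2 hF2 hB2 ⟨ht2, hc2⟩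
    have e2 : s2.reg rI = q := by rw [hF2.reg _ (by decide), hi]
    have e3 : s2.reg 0 = s'.reg 0 := hF2.reg _ (by decide)
    have e4 : s2.mem 2 = s'.mem 2 := hF2.mem _ (by decide)
    obtain ⟨k1, k2, k3⟩ := key _ hc2
    simp at ht2
    simp [e2, e3, e4]
    rw [← not_lt, ← k3]
    refine ⟨fun hm => ⟨by omega, by omega, by omega, by omega, fun l hl => k1 l (by omega), ?_,
      hyes hm⟩, fun hm => ⟨by omega, by omega, fun l hl => k1 l (by omega), ?_,
      hno (by rw [k3]; omega)⟩⟩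
    all_goals exact k2.imp_right fun ⟨l, h5, h6⟩ => ⟨l, by omega, h6⟩
  · rintro s' t ht _ hF hB' ⟨-, -, -, h4⟩
    simp at ht
    refine ⟨by simp; omega, ?_, fun i => ?_⟩
    · rw [h4]
      exact List.nodup_range.filter _
    · rw [h4]
      simp

theorem reportAll_spec {B c k : ℕ} {T P : List ℕ} {s : State} (hB : Bdd B s)
    (hn : s.reg 0 = T.length) (hm : s.reg 1 = P.length) (hk : s.reg 2 = k)
    (hT : ∀ i, s.mem 0 i = T.getD i 0) (hP : ∀ i, s.mem 1 i = P.getD i 0)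
    (hz : ∀ a i, 2 ≤ a → s.mem a i = 0) (hT0 : 0 < T.length) (hPT : P.length ≤ T.length)
    (hk0 : 0 < k) (hTP : ∀ x ∈ T ++ P, x < (T.length + 1) ^ c)
    (hcB : (T.length + 1) ^ (c + 20) ≤ B)
    (hxB : 4 * (T.length + P.length) + 4 * k + 10 < B) (hkB : (k + 2) * (2 * k + 3) < B) :
    wp B reportAll s fun s' t => t ≤ 1000000 * (c + 2) * T.length * k ^ 2 ∧
      Reports s' (circEditOcc k P T) := by
  obtain ⟨W, hW⟩ : ∃ W, W = (k + 1) * (2 * k + 3) := ⟨_, rfl⟩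
  have hWk : W ≤ 10 * k ^ 2 := by
    have h1 : k + 1 ≤ 2 * k := by omega
    have h2 : 2 * k + 3 ≤ 5 * k := by omega
    have h3 := Nat.mul_le_mul h1 h2
    have h4 : 2 * k * (5 * k) = 10 * k ^ 2 := by ring
    omega
  rw [reportAll, wp_seq]
  refine (preprocess_spec hB hn hm hT hP (fun i => hz _ i (by omega)) (fun i => hz _ i (by omega))
    hT0 hPT hTP hcB).call hB ?_
  rintro s1 t1 hF1 hB1 ⟨ht1, hp1⟩
  have q1 : s1.reg 2 = k := by rw [hF1.reg _ (by decide), hk]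
  have q2 : s1.mem aMx = s.mem aMx := hF1.mem _ (by decide)
  rw [wp_seq]
  refine wp_for 0 (T.length + 1) (5100 * W + 100) (fun q s' => ∀ i, Marked s' i ↔
    ∃ j < q, i ∈ anchoredOcc k P T j) hB1 (by decide) (by omega) (by simp) (by omega) ?_ ?_ ?_ ?_
  · intro s' hF
    simp [hF.reg rLt (by decide), hp1.regn]
  · intro i
    simp [Marked, q2, hz]
  · intro j s2 _ hj hi hF2 hB2 hI2
    have hp2 := hp1.frame hF2 (by decide) (by decide)
    have hjT : j ≤ T.length := by omega
    rw [wp_seq]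
    refine (reportSplit_spec hB2 hp2 (by rw [hF2.reg _ (by decide), q1]) hi hjT hxB hkB).call
      hB2 ?_
    rintro s3 t3 hF3 hB3 ⟨ht3, hr3, hc3⟩
    have q3 : s3.mem aMx = s2.mem aMx := hF3.mem _ (by decide)
    refine (markIntervals_spec hB3 rfl fun q hq => ?_).mono ?_
    · -- a reported nonempty interval consists of positions up to `j`
      rcases Nat.lt_or_ge (s3.mem 3 q) (s3.mem 2 q) with h1 | h1
      · have := hB3.2 2 q
        omega
      · have h2 := (hc3 (s3.mem 3 q)).1 ⟨q, hq, h1, le_rfl⟩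
        have := h2.1
        omega
    · rintro s4 t4 ⟨ht4, hm4⟩
      refine ⟨by omega, fun i => ?_⟩
      have e1 : Marked (s4.setReg 3 (j + 1)) i ↔ Marked s4 i := by simp [Marked]
      have e2 : Marked s3 i ↔ Marked s2 i := by simp [Marked, q3]
      rw [e1, hm4, e2, hI2, hc3]
      constructor
      · rintro (⟨j', h1, h2⟩ | h2)
        · exact ⟨j', by omega, h2⟩
        · exact ⟨j, by omega, h2⟩
      · rintro ⟨j', h1, h2⟩
        rcases (Nat.lt_succ_iff.1 h1).lt_or_eq with h3 | rfl
        · exact .inl ⟨j', h3, h2⟩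
        · exact .inr h2
  · intro s2 t2 ht2 _ hF2 hB2 hI2
    have hp2 := hp1.frame hF2 (by decide) (by decide)
    refine (listMarked_spec hB2 hp2.regn (by omega)).mono ?_
    rintro s3 t3 ⟨ht3, hr3⟩
    constructor
    · simp at ht2
      have h1 : 5100 * W + 100 + 3 + 9 ≤ 60000 * k ^ 2 := by
        have : 1 ≤ k ^ 2 := Nat.one_le_pow _ _ hk0
        omega
      have h2 : t2 ≤ (60000 * k ^ 2) * (2 * T.length) + 100 := by
        have := Nat.mul_le_mul h1 (by omega : T.length + 1 ≤ 2 * T.length)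
        omega
      have h3 : (60000 * k ^ 2) * (2 * T.length) = 120000 * (T.length * k ^ 2) := by ring
      have h4 : 500000 * (c + 2) * T.length * 1 ≤ 500000 * (c + 2) * T.length * k ^ 2 :=
        Nat.mul_le_mul le_rfl (Nat.one_le_pow _ _ hk0)
      have h5 : T.length * 1 ≤ T.length * k ^ 2 :=
        Nat.mul_le_mul le_rfl (Nat.one_le_pow _ _ hk0)
      have h6 : 500000 * (c + 2) * T.length * k ^ 2 =
        500000 * (c * (T.length * k ^ 2)) + 1000000 * (T.length * k ^ 2) := by ring
      have h7 : 1000000 * (c + 2) * T.length * k ^ 2 =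
        1000000 * (c * (T.length * k ^ 2)) + 2000000 * (T.length * k ^ 2) := by ring
      omega
    · convert hr3 using 1
      ext i
      rw [circEditOcc_eq]
      simp only [Set.mem_iUnion, Finset.mem_range, exists_prop, Set.mem_ofPred_eq, hI2]
      exact ⟨fun ⟨j, h1, h2⟩ => ⟨h2.1.trans (by omega), j, h1, h2⟩, fun h => h.2⟩

open CircularMatching

/-! ### Word sizes -/

theorem input_reg_lt {B : ℕ} {T P : List ℕ} (hT : T.length < B) (hP : P.length < B) (x : ℕ) :
    (input T P).reg x < B := by
  simp only [input]
  split_ifs <;> omega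

theorem input_bdd {B : ℕ} {T P : List ℕ} (hT : T.length < B) (hP : P.length < B)
    (hTP : ∀ x ∈ T ++ P, x < B) : Bdd B (input T P) := by
  refine ⟨input_reg_lt hT hP, fun a i => ?_⟩
  have key : ∀ L : List ℕ, (∀ x ∈ L, x < B) → L.getD i 0 < B := fun L hL => by
    rcases Nat.lt_or_ge i L.length with h | h
    · rw [List.getD_eq_getElem _ _ h]; exact hL _ (List.getElem_mem h)
    · rw [List.getD_eq_default _ _ h]; omega
  simp only [input]
  split_ifs
  · exact key T fun x hx => hTP x (by simp [hx])
  · exact key P fun x hx => hTP x (by simp [hx])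
  · omega

/-- With `M` the length of the text plus one, or that plus the number of edits, the power
`M ^ (c + 20)` bounds all numbers that occur. -/
theorem bounds_of_pow {M c : ℕ} (hM : 2 ≤ M) :
    100 < M ^ (c + 20) ∧ 1000 * M ^ 2 < M ^ (c + 20) ∧ M ^ c < M ^ (c + 20) := by
  have h1 : 2 ^ 15 * M ^ 5 ≤ M ^ (c + 20) := by
    calc 2 ^ 15 * M ^ 5 ≤ M ^ 15 * M ^ 5 := Nat.mul_le_mul (Nat.pow_le_pow_left hM _) le_rfl
      _ = M ^ 20 := by rw [← pow_add]
      _ ≤ M ^ (c + 20) := Nat.pow_le_pow_right (by omega) (by omega)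
  have h2 : M ^ 2 ≤ M ^ 5 := Nat.pow_le_pow_right (by omega) (by omega)
  have h3 : 1 ≤ M ^ 2 := Nat.one_le_pow _ _ (by omega)
  exact ⟨by omega, by omega, Nat.pow_lt_pow_right (by omega) (by omega)⟩

/-- The exponent `24` of the word bound is the number of leaves that `Program.ok` allows in an
expression. -/
theorem preprocess_run {w c : ℕ} {T P : List ℕ} (hT0 : 0 < T.length) (hPT : P.length ≤ T.length)
    (hTP : ∀ x ∈ T ++ P, x < (T.length + 1) ^ c)
    (hw : (T.length + 1) ^ (24 * (c + 20)) ≤ 2 ^ w) :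
    ∃ t s, Run w preprocess (input T P) t s ∧ t ≤ 500000 * (c + 2) * T.length ∧
      Prepared T P s ∧ Bdd ((T.length + 1) ^ (c + 20)) s := by
  obtain ⟨b1, b2, b3⟩ := bounds_of_pow (M := T.length + 1) (c := c) (by omega)
  have b4 : T.length + 1 ≤ (T.length + 1) ^ 2 := Nat.le_self_pow (by omega) _
  have hB := input_bdd (B := (T.length + 1) ^ (c + 20)) (T := T) (P := P) (by omega) (by omega)
    fun x hx => (hTP x hx).trans b3
  obtain ⟨t, s, h1, h2, h3⟩ := preprocess_spec (T := T) (P := P) hB rfl rfl (fun i => rfl)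
    (fun i => rfl) (fun i => rfl) (fun i => rfl) hT0 hPT hTP le_rfl
  exact ⟨t, s, h1.run b1 ((pow_mul' _ 24 (c + 20)).symm.trans_le hw) hB (by decide +kernel), h2, h3, h1.bdd hB⟩

theorem reportSplit_run {w c k j : ℕ} {T P : List ℕ} {s : State} (hT0 : 0 < T.length)
    (hPT : P.length ≤ T.length) (h : Prepared T P s) (hB : Bdd ((T.length + 1) ^ (c + 20)) s)
    (hk : 0 < k) (hj : j ≤ T.length) (hw : (T.length + k + 1) ^ (24 * (c + 20)) ≤ 2 ^ w) :
    ∃ t s', Run w reportSplit ((s.setReg 2 k).setReg 3 j) t s' ∧ t ≤ 50000 * k ^ 2 ∧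
      s'.reg 0 ≤ 10 * k ^ 2 ∧ ReportsIntervals s' (anchoredOcc k P T j) := by
  obtain ⟨M, hM⟩ : ∃ M, M = T.length + k + 1 := ⟨_, rfl⟩
  rw [← hM] at hw
  obtain ⟨b1, b2, -⟩ := bounds_of_pow (M := M) (c := c) (by omega)
  have b3 : M ≤ M ^ 2 := Nat.le_self_pow (by omega) _
  have b4 : (T.length + 1) ^ (c + 20) ≤ M ^ (c + 20) := Nat.pow_le_pow_left (by omega) _
  have b5 : (k + 2) * (2 * k + 3) ≤ (2 * M) * (3 * M) := Nat.mul_le_mul (by omega) (by omega)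
  have b6 : (2 * M) * (3 * M) = 6 * M ^ 2 := by ring
  have hW : (k + 1) * (2 * k + 3) ≤ 10 * k ^ 2 := by
    have h1 := Nat.mul_le_mul (by omega : k + 1 ≤ 2 * k) (by omega : 2 * k + 3 ≤ 5 * k)
    have h2 : 2 * k * (5 * k) = 10 * k ^ 2 := by ring
    omega
  have hB1 : Bdd (M ^ (c + 20)) ((s.setReg 2 k).setReg 3 j) :=
    ((hB.mono b4).setReg (by omega)).setReg (by omega)
  have hp : Prepared T P ((s.setReg 2 k).setReg 3 j) := by
    obtain ⟨S, h1, h2⟩ := h.lce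
    exact ⟨by simpa using h.regn, by simpa using h.regm, S,
      h1.congr (by simp) rfl rfl rfl rfl (by simp) rfl rfl, h2⟩
  obtain ⟨t, s', h1, h2, h3, h4⟩ := reportSplit_spec (k := k) (j := j) hB1 hp (by simp) (by simp) hj
    (by omega) (by omega)
  refine ⟨t, s', h1.run b1 ((pow_mul' _ 24 (c + 20)).symm.trans_le hw) hB1 (by decide +kernel), by omega, by omega, ?_⟩
  ext i
  rw [← h4]
  simp only [Covered, Set.mem_iUnion, Set.mem_Icc, Finset.mem_range, exists_prop]

theorem reportAll_run {w c k : ℕ} {T P : List ℕ} (hT0 : 0 < T.length) (hPT : P.length ≤ T.length)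
    (hk : 0 < k) (hTP : ∀ x ∈ T ++ P, x < (T.length + 1) ^ c)
    (hw : (T.length + k + 1) ^ (24 * (c + 20)) ≤ 2 ^ w) :
    ∃ t s, Run w reportAll ((input T P).setReg 2 k) t s ∧
      t ≤ 1000000 * (c + 2) * T.length * k ^ 2 ∧ Reports s (circEditOcc k P T) := by
  obtain ⟨M, hM⟩ : ∃ M, M = T.length + k + 1 := ⟨_, rfl⟩
  rw [← hM] at hw
  obtain ⟨b1, b2, b7⟩ := bounds_of_pow (M := M) (c := c) (by omega)
  have b3 : M ≤ M ^ 2 := Nat.le_self_pow (by omega) _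
  have b4 : (T.length + 1) ^ (c + 20) ≤ M ^ (c + 20) := Nat.pow_le_pow_left (by omega) _
  have b5 : (k + 2) * (2 * k + 3) ≤ (2 * M) * (3 * M) := Nat.mul_le_mul (by omega) (by omega)
  have b6 : (2 * M) * (3 * M) = 6 * M ^ 2 := by ring
  have b8 : (T.length + 1) ^ c ≤ M ^ c := Nat.pow_le_pow_left (by omega) _
  have hB : Bdd (M ^ (c + 20)) ((input T P).setReg 2 k) :=
    (input_bdd (by omega) (by omega) fun x hx => by have := hTP x hx; omega).setReg (by omega)
  obtain ⟨t, s, h1, h2, h3⟩ := reportAll_spec (k := k) (T := T) (P := P) hB (by simp [input])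
    (by simp [input]) (by simp) (fun i => by simp [input]) (fun i => by simp [input])
    (fun a i ha => (if_neg (by omega)).trans (if_neg (by omega))) hT0 hPT hk hTP b4
    (by omega) (by omega)
  exact ⟨t, s, h1.run b1 ((pow_mul' _ 24 (c + 20)).symm.trans_le hw) hB (by decide +kernel), h2, h3⟩

end WordRAM

theorem theorem2 :
    -- one program solves the reporting version in time `O(n k ^ 2)`
    (∃ prog : WordRAM.Program, ∀ c : ℕ, ∃ a C : ℕ, c < a ∧
      ∀ (w k : ℕ) (T P : List ℕ), 0 < T.length → P.length ≤ T.length → 0 < k →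
        (∀ x ∈ T ++ P, x < (T.length + 1) ^ c) → (T.length + k + 1) ^ a ≤ 2 ^ w →
        ∃ (t : ℕ) (s : WordRAM.State),
          WordRAM.Run w prog ((WordRAM.input T P).setReg 2 k) t s ∧
          t ≤ C * T.length * k ^ 2 ∧
          WordRAM.Reports s (CircularMatching.circEditOcc k P T)) ∧
    -- the occurrences are classified by their split positions
    (∀ (k : ℕ) (T P : List ℕ), CircularMatching.circEditOcc k P T =
      ⋃ j ∈ Finset.range (T.length + 1), CircularMatching.anchoredOcc k P T j) ∧
    -- after linear-time preprocessing of `T` and `P`, for every `k` and every split position `j`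
    -- the starting positions are reported in time `O(k ^ 2)` as `O(k ^ 2)` intervals
    (∃ prep query : WordRAM.Program, ∀ c : ℕ, ∃ a C : ℕ, c < a ∧
      ∀ (w : ℕ) (T P : List ℕ), 0 < T.length → P.length ≤ T.length →
        (∀ x ∈ T ++ P, x < (T.length + 1) ^ c) → (T.length + 1) ^ a ≤ 2 ^ w →
        ∃ (t₀ : ℕ) (s₀ : WordRAM.State),
          WordRAM.Run w prep (WordRAM.input T P) t₀ s₀ ∧
          t₀ ≤ C * T.length ∧
          ∀ k j : ℕ, 0 < k → j ≤ T.length → (T.length + k + 1) ^ a ≤ 2 ^ w →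
            ∃ (t : ℕ) (s : WordRAM.State),
              WordRAM.Run w query ((s₀.setReg 2 k).setReg 3 j) t s ∧
              t ≤ C * k ^ 2 ∧
              s.reg 0 ≤ C * k ^ 2 ∧
              WordRAM.ReportsIntervals s (CircularMatching.anchoredOcc k P T j)) := by
  refine ⟨⟨WordRAM.reportAll, fun c => ⟨24 * (c + 20), 1000000 * (c + 2), by omega, ?_⟩⟩,
    CircularMatching.circEditOcc_eq,
    ⟨WordRAM.preprocess, WordRAM.reportSplit, fun c => ⟨24 * (c + 20), 500000 * (c + 2), by omega, ?_⟩⟩⟩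
  · intro w k T P hT0 hPT hk hTP hw
    exact WordRAM.reportAll_run hT0 hPT hk hTP hw
  · intro w T P hT0 hPT hTP hw
    obtain ⟨t₀, s₀, h1, h2, h3, h4⟩ := WordRAM.preprocess_run hT0 hPT hTP hw
    refine ⟨t₀, s₀, h1, h2, fun k j hk hj hw' => ?_⟩
    obtain ⟨t, s, h5, h6, h7, h8⟩ := WordRAM.reportSplit_run hT0 hPT h3 h4 hk hj hw'
    have hC : 50000 * k ^ 2 ≤ 500000 * (c + 2) * k ^ 2 := Nat.mul_le_mul (by omega) le_rfl
    exact ⟨t, s, h5, by omega, by omega, h8⟩
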